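/- Setting. Let $N=\binom n2$ and let the edges of the complete graph $K_n$ be presented one at a time, in uniformly random order $e_1,\dots,e_N$. A player, Builder, starts with the empty graph $B_0$ on the same $n$ vertices; when $e_s$ is presented he must immediately and irrevocably decide whether to purchase it, and $B_s$ denotes the graph formed by the edges purchased among $e_1,\dots,e_s$. For $0\le t\le N$ and $b\ge 0$, a $(t,b)$-strategy is a (potentially random) function that for every $s\le t$ decides whether to purchase $e_s$, given $s$, $e_s$ and $B_{s-1}$, in such a way that $B_s$ always has at most $b$ edges for all $s\le t$; its randomness is independent of the order of the edges. For functions $f,g$ of $n$, $f\ll g$ (equivalently $g\gg f$) means $f=o(g)$ as $n\to\infty$. $C_\ell$ is the cycle of length $\ell$, and $H\subseteq B_t$ means that $B_t$ contains a copy of $H$ as a (not necessarily induced) subgraph. Theorem (Short cycles). Let $k\ge 1$ be an integer and let $H=C_{2k+1}$ or $H=C_{2k+2}$. Let $t=t(n)\le\binom n2$ and $b=b(n)$ be non-negative integers, and write $$b^*=b^*(n,t,k)=\max\left\{\frac{n^{k+2}}{t^{k+1}},\ \frac{n}{\sqrt t}\right\}.$$ (1) If $t\gg n\log n$ and $b\gg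 b^*$, then there exists, for each $n$, a $(t,b)$-strategy of Builder such that $\lim_{n\to\infty}\mathbb P(H\subseteq B_t)=1$. (2) If $t\ll n$ or $b\ll b^*$, then for any choice, for each $n$, of a $(t,b)$-strategy of Builder, $\lim_{n\to\infty}\mathbb P(H\subseteq B_t)=0$. (Where $t=0$ and $b^*$ is undefined, the condition $b\ll b^*$ is read as requiring $b=0$ at such $n$, for all large $n$.) -/

import Mathlib

open Filter Asymptotics Topology

namespace BuilderGame

/-- An order in which the edges of the complete graph on `Fin n` are presented:
`σ i` is the edge presented at time `i + 1`. -/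
abbrev EdgeOrder (n : ℕ) : Type :=
  Fin (n.choose 2) ≃ (⊤ : SimpleGraph (Fin n)).edgeSet

noncomputable instance (n : ℕ) : Fintype (EdgeOrder n) := by
  classical exact inferInstance

instance (n : ℕ) : Nonempty (EdgeOrder n) := by
  classical
  refine ⟨Fintype.equivOfCardEq ?_⟩
  rw [Fintype.card_fin, ← SimpleGraph.edgeFinset_card, SimpleGraph.card_edgeFinset_top_eq_card_choose_two,
    Fintype.card_fin]

/-- A deterministic decision rule. `f i e G` holds if Builder purchases the edge `e` when it is
presented at time `i + 1` and Builder's graph just before that is `G`. -/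
abbrev Rule (n : ℕ) : Type :=
  ℕ → Sym2 (Fin n) → SimpleGraph (Fin n) → Prop

open Classical in
/-- Builder's graph `B_s` after `s` edges of the order `σ` have been presented, when Builder
follows the rule `f`. (Once all `n.choose 2` edges have been presented nothing changes.) -/
noncomputable def builderGraph {n : ℕ} (f : Rule n) (σ : EdgeOrder n) : ℕ → SimpleGraph (Fin n)
  | 0 => ⊥
  | i + 1 =>
    if h : i < n.choose 2 then
      if f i (σ ⟨i, h⟩) (builderGraph f σ i) then
        builderGraph f σ i ⊔ SimpleGraph.fromEdgeSet {(σ ⟨i, h⟩ : Sym2 (Fin n))}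
      else builderGraph f σ i
    else builderGraph f σ i

/-- A deterministic `(t, b)`-strategy on `n` vertices: a rule under which, whatever the order of
the edges, Builder's graph has at most `b` edges at each time `s ≤ t`. -/
structure DetStrategy (n t b : ℕ) : Type where
  rule : Rule n
  budget : ∀ (σ : EdgeOrder n) (s : ℕ), s ≤ t → (builderGraph rule σ s).edgeSet.ncard ≤ b

/-- A (potentially random) `(t, b)`-strategy on `n` vertices: a random deterministic
`(t, b)`-strategy, to be drawn independently of the order of the edges. -/
abbrev Strategy (n t b : ℕ) : Type :=
  PMF (DetStrategy n t b)

/-- The law of Builder's graph `B_t`, when Builder follows `S` and the edges of the complete graph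
are presented in a uniformly random order, independent of the randomness of `S`. -/
noncomputable def finalGraph {n t b : ℕ} (S : Strategy n t b) : PMF (SimpleGraph (Fin n)) :=
  S.bind fun f =>
    (PMF.uniformOfFintype (EdgeOrder n)).map fun σ => builderGraph f.rule σ t

/-- The probability that `B_t` contains a copy of `H` (as a not necessarily induced subgraph). -/
noncomputable def probContains {n t b m : ℕ} (H : SimpleGraph (Fin m)) (S : Strategy n t b) :
    ENNReal :=
  (finalGraph S).toOuterMeasure {G | H.IsContained G}

/-- The budget threshold `b* = max {n ^ (k + 2) / t ^ (k + 1), n / √t}`. -/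
noncomputable def bStar (k n t : ℕ) : ℝ :=
  max ((n : ℝ) ^ (k + 2) / (t : ℝ) ^ (k + 1)) ((n : ℝ) / Real.sqrt t)

end BuilderGame

namespace BuilderGame

/-! Write N for the number of pairs, p = t/N and ℓ for the length of the cycle. A random strategy is
a mixture of deterministic ones, so everything reduces to averages over the finitely many orders.
Randomness is used only through exchange symmetries. Given the past, the next edge is uniform among
the remaining ones (`avg_step`), which yields an upper bound for hitting a small history-dependent
set (`pr_hit_le`) and a Chernoff-type bound against rarely hitting a large one (`pr_few_hits_le`). A
fixed set of m pairs is fully presented by time t with probability at most p ^ m (`pr_shown_le`).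

Impossibility. If t is a small multiple of n, the expected number of presented cycles is already
small. Otherwise consider the last edge of a cycle: it must join the ends of a path with ℓ - 1 ≤ 2k
+ 1 edges in Builder's graph. At most 2b vertices are not isolated, so at most (2b)² pairs qualify,
and one of them is hit with probability O(t b² / n²); this gives the term n / √t. For the other
term, a sharper count is needed. Small vertex sets span few presented edges, so Builder's graph is
3-degenerate, and cycles through a vertex of degree much larger than t/n are unlikely. Orient along
a degeneracy order: a walk of at most 2k + 1 steps has, in one of its two directions, at most k
steps against the order. Steps along it have at most 3 choices, the others Δ = O(t/n), so only O(b Δ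
^ k) pairs are joined (`card_joined_le`), and the closing probability is O(b (t/n) ^ (k+1) / n).

Construction. Builder grows r disjoint trees with branching number d in consecutive stages between
disjoint blocks of vertices, spending O(r d ^ k) edges, and then waits for an edge between suitable
leaves. For odd ℓ these are leaves below different children of the same root; for even ℓ each root
first receives one partner, and the leaves lie below the root and below the partner. Either way
there are of order r d ^ (2k) closing pairs. The growth succeeds because d is a small multiple of D
= τ/n, where τ is the length of a stage, and D exceeds a large multiple of log n. Closing pairs lie
inside the last block, where the growth never buys anything, so their positions in the order are
exchangeable and at most half of them are lost during the growth (`pr_half_shown_le`). One of the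
others then appears if r d ^ (2k) D exceeds a large multiple of n (`Plan.prContains_ge`). Taking d
of order D when the budget permits, and r = 1 with d ^ k of order b otherwise, turns this condition
into the two terms of b* (`exists_branching`, `branching_large`). -/

/-- The average of `f` over all orders of the edges. -/
noncomputable def avg (n : ℕ) (f : EdgeOrder n → ℝ) : ℝ :=
  (∑ σ, f σ) / Fintype.card (EdgeOrder n)

open Classical in
/-- The probability of an event that depends on the order of the edges. -/
noncomputable def pr (n : ℕ) (E : EdgeOrder n → Prop) : ℝ :=
  avg n fun σ => if E σ then 1 else 0

/-! ### Averages and probabilities over uniformly random orders. -/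

section Basic

variable {n : ℕ}

lemma card_edgeOrder_pos : (0 : ℝ) < Fintype.card (EdgeOrder n) := by
  exact_mod_cast Fintype.card_pos

lemma avg_mono {f g : EdgeOrder n → ℝ} (h : ∀ σ, f σ ≤ g σ) : avg n f ≤ avg n g := by
  unfold avg
  gcongr
  exact h _

lemma avg_congr {f g : EdgeOrder n → ℝ} (h : ∀ σ, f σ = g σ) : avg n f = avg n g := by
  rw [funext h]

lemma avg_const (c : ℝ) : avg n (fun _ => c) = c := by
  have := card_edgeOrder_pos (n := n)
  unfold avg
  simp only [Finset.sum_const, Finset.card_univ, nsmul_eq_mul]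
  field_simp

lemma avg_nonneg {f : EdgeOrder n → ℝ} (h : ∀ σ, 0 ≤ f σ) : 0 ≤ avg n f := by
  simpa [avg_const] using avg_mono (f := fun _ => 0) h

lemma avg_add (f g : EdgeOrder n → ℝ) : avg n (fun σ => f σ + g σ) = avg n f + avg n g := by
  unfold avg
  rw [Finset.sum_add_distrib, add_div]

lemma avg_const_mul (c : ℝ) (f : EdgeOrder n → ℝ) :
    avg n (fun σ => c * f σ) = c * avg n f := by
  unfold avg
  rw [← Finset.mul_sum, mul_div_assoc]

lemma avg_mul_const (c : ℝ) (f : EdgeOrder n → ℝ) :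
    avg n (fun σ => f σ * c) = avg n f * c := by
  simp_rw [mul_comm _ c]
  exact avg_const_mul c f

lemma avg_finset_sum {ι : Type*} (s : Finset ι) (f : ι → EdgeOrder n → ℝ) :
    avg n (fun σ => ∑ i ∈ s, f i σ) = ∑ i ∈ s, avg n (f i) := by
  unfold avg
  rw [Finset.sum_comm, Finset.sum_div]

lemma avg_comp_equiv (e : Equiv.Perm (EdgeOrder n)) (f : EdgeOrder n → ℝ) :
    avg n (fun σ => f (e σ)) = avg n f := by
  unfold avg
  rw [Equiv.sum_comp e f]

lemma pr_def (E : EdgeOrder n → Prop) [DecidablePred E] :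
    pr n E = avg n fun σ => if E σ then 1 else 0 := by
  unfold pr
  congr!

lemma pr_mono {E F : EdgeOrder n → Prop} (h : ∀ σ, E σ → F σ) : pr n E ≤ pr n F := by
  classical
  refine avg_mono fun σ => ?_
  by_cases hE : E σ
  · simp [hE, h σ hE]
  · simp only [hE, if_false]
    split_ifs <;> norm_num

lemma pr_nonneg (E : EdgeOrder n → Prop) : 0 ≤ pr n E :=
  avg_nonneg fun σ => by split_ifs <;> norm_num

lemma pr_le_one (E : EdgeOrder n → Prop) : pr n E ≤ 1 := by
  refine (avg_mono (g := fun _ => 1) fun σ => ?_).trans (avg_const 1).le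
  split_ifs <;> norm_num

lemma pr_eq_zero {E : EdgeOrder n → Prop} (h : ∀ σ, ¬ E σ) : pr n E = 0 := by
  unfold pr
  simp [h, avg_const]

lemma pr_or_le (E F : EdgeOrder n → Prop) : pr n (fun σ => E σ ∨ F σ) ≤ pr n E + pr n F := by
  classical
  unfold pr
  rw [← avg_add]
  refine avg_mono fun σ => ?_
  by_cases hE : E σ <;> by_cases hF : F σ <;> simp [hE, hF]

lemma pr_compl (E : EdgeOrder n → Prop) : pr n E = 1 - pr n (fun σ => ¬ E σ) := by
  classical
  have : pr n E + pr n (fun σ => ¬ E σ) = 1 := by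
    unfold pr
    rw [← avg_add]
    refine (avg_congr fun σ => ?_).trans (avg_const 1)
    by_cases hE : E σ <;> simp [hE]
  linarith

lemma pr_exists_le {ι : Type*} (s : Finset ι) (E : ι → EdgeOrder n → Prop) :
    pr n (fun σ => ∃ i ∈ s, E i σ) ≤ ∑ i ∈ s, pr n (E i) := by
  classical
  unfold pr
  rw [← avg_finset_sum]
  refine avg_mono fun σ => ?_
  split_ifs with h
  · obtain ⟨i, hi, hE⟩ := h
    refine le_trans ?_ (Finset.single_le_sum (f := fun i => if E i σ then (1 : ℝ) else 0)
      (fun j _ => by positivity) hi)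
    simp [hE]
  · exact Finset.sum_nonneg fun j _ => by positivity

lemma pr_exists_le_card_mul {ι : Type*} (s : Finset ι) (E : ι → EdgeOrder n → Prop) {c : ℝ}
    (h : ∀ i ∈ s, pr n (E i) ≤ c) : pr n (fun σ => ∃ i ∈ s, E i σ) ≤ s.card * c := by
  refine (pr_exists_le s E).trans ((Finset.sum_le_sum h).trans ?_)
  simp

lemma markov {f : EdgeOrder n → ℝ} {E : EdgeOrder n → Prop} {c : ℝ} (hc : 0 < c)
    (hf : ∀ σ, 0 ≤ f σ) (h : ∀ σ, E σ → c ≤ f σ) : pr n E ≤ avg n f / c := by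
  classical
  rw [le_div_iff₀ hc, pr, ← avg_mul_const]
  refine avg_mono fun σ => ?_
  split_ifs with hE
  · simpa using h σ hE
  · simpa using hf σ

end Basic

/-! ### Exchanging two edges; presented sets are negatively correlated. -/

section Shown

variable {n : ℕ}

/-- The pair `e` is one of the first `s` edges of the order `σ`. -/
def Shown (σ : EdgeOrder n) (s : ℕ) (e : Sym2 (Fin n)) : Prop :=
  ∃ i : Fin (n.choose 2), (i : ℕ) < s ∧ (σ i : Sym2 (Fin n)) = e

lemma Shown.mono {σ : EdgeOrder n} {s s' : ℕ} (h : s ≤ s') {e : Sym2 (Fin n)}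
    (he : Shown σ s e) : Shown σ s' e := by
  obtain ⟨i, hi, rfl⟩ := he
  exact ⟨i, by omega, rfl⟩

lemma Shown.not_isDiag {σ : EdgeOrder n} {s : ℕ} {e : Sym2 (Fin n)} (he : Shown σ s e) :
    ¬ e.IsDiag := by
  obtain ⟨i, -, rfl⟩ := he
  exact SimpleGraph.not_isDiag_of_mem_edgeSet _ (σ i).2

lemma shown_coe {σ : EdgeOrder n} {s : ℕ} (e : (⊤ : SimpleGraph (Fin n)).edgeSet) :
    Shown σ s e ↔ (σ.symm e : ℕ) < s := by
  constructor
  · rintro ⟨i, hi, h⟩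
    rw [← Subtype.ext h]
    simpa
  · intro h
    exact ⟨σ.symm e, h, by simp⟩

lemma card_edgeSet_top : Fintype.card (⊤ : SimpleGraph (Fin n)).edgeSet = n.choose 2 := by
  rw [← SimpleGraph.edgeFinset_card, SimpleGraph.card_edgeFinset_top_eq_card_choose_two,
    Fintype.card_fin]

open Classical in
lemma sum_shown (σ : EdgeOrder n) {t : ℕ} (ht : t ≤ n.choose 2) :
    (∑ e : (⊤ : SimpleGraph (Fin n)).edgeSet, if Shown σ t (e : Sym2 (Fin n)) then (1 : ℝ) else 0)
      = t := by
  simp_rw [shown_coe]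
  rw [← Equiv.sum_comp σ]
  simp only [Equiv.symm_apply_apply]
  rw [Finset.sum_boole]
  congr 1
  have : (Finset.univ.filter fun i : Fin (n.choose 2) => (i : ℕ) < t)
      = Finset.univ.map (Fin.castLEEmb ht) := by
    ext i
    simp only [Finset.mem_filter, Finset.mem_univ, true_and, Finset.mem_map, Fin.castLEEmb_apply]
    constructor
    · intro h
      exact ⟨⟨i, h⟩, rfl⟩
    · rintro ⟨j, rfl⟩
      simp
  rw [this, Finset.card_map, Finset.card_univ, Fintype.card_fin]

/-- Exchanging two edges in an order. -/
noncomputable def swapEdges (e e' : (⊤ : SimpleGraph (Fin n)).edgeSet) : Equiv.Perm (EdgeOrder n) := by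
  classical
  exact
  { toFun := fun σ => σ.trans (Equiv.swap e e')
    invFun := fun σ => σ.trans (Equiv.swap e e')
    left_inv := fun σ => by ext; simp
    right_inv := fun σ => by ext; simp }

open Classical in
lemma swapEdges_apply (e e' : (⊤ : SimpleGraph (Fin n)).edgeSet) (σ : EdgeOrder n)
    (i : Fin (n.choose 2)) : swapEdges e e' σ i = Equiv.swap e e' (σ i) := rfl

open Classical in
lemma shown_swapEdges (e e' f : (⊤ : SimpleGraph (Fin n)).edgeSet) (σ : EdgeOrder n) (s : ℕ) :
    Shown (swapEdges e e' σ) s f ↔ Shown σ s (Equiv.swap e e' f) := by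
  rw [shown_coe, shown_coe]
  rfl

/-- The probability that a given set of pairs is among the first `t` edges. -/
theorem pr_shown_le {t : ℕ} (ht : t ≤ n.choose 2) (T : Finset (Sym2 (Fin n))) :
    pr n (fun σ => ∀ e ∈ T, Shown σ t e) ≤ ((t : ℝ) / n.choose 2) ^ T.card := by
  classical
  induction T using Finset.induction_on with
  | empty => simpa using pr_le_one _
  | insert e T he ih =>
    rw [Finset.card_insert_of_notMem he, pow_succ']
    set p : ℝ := (t : ℝ) / n.choose 2 with hp
    have hp0 : 0 ≤ p := by positivity
    by_cases hd : e.IsDiag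
    · rw [pr_eq_zero]
      · positivity
      · exact fun σ h => (h e (Finset.mem_insert_self _ _)).not_isDiag hd
    obtain ⟨e, rfl⟩ : ∃ e' : (⊤ : SimpleGraph (Fin n)).edgeSet, (e' : Sym2 (Fin n)) = e :=
      ⟨⟨e, by simpa [SimpleGraph.edgeSet_top] using hd⟩, rfl⟩
    have hN : 0 < n.choose 2 := by
      rw [← card_edgeSet_top]
      exact Fintype.card_pos_iff.2 ⟨e⟩
    set Φ : EdgeOrder n → Prop := fun σ => ∀ f ∈ T, Shown σ t f with hΦ
    -- Exchanging `e` with any `e'` outside `T` preserves the event for `T` and moves the condition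
    -- from `e` to `e'`; for `e'` in `T` the extra condition is void. Summing over all `e'` then
    -- counts exactly `t` presented edges.
    have key : ∀ e' : (⊤ : SimpleGraph (Fin n)).edgeSet,
        pr n (fun σ => ∀ f ∈ insert (e : Sym2 (Fin n)) T, Shown σ t f) ≤
          avg n (fun σ => (if Φ σ then 1 else 0) *
            (if Shown σ t (e' : Sym2 (Fin n)) then 1 else 0)) := by
      intro e'
      by_cases he' : (e' : Sym2 (Fin n)) ∈ T
      · refine avg_mono fun σ => ?_
        by_cases h : ∀ f ∈ insert (e : Sym2 (Fin n)) T, Shown σ t f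
        · have h1 : Φ σ := fun f hf => h f (Finset.mem_insert_of_mem hf)
          simp only [h1, h1 _ he', if_true, mul_one]
          split_ifs
          norm_num
        · simp only [h, if_false]
          positivity
      · rw [← avg_comp_equiv (swapEdges e e')]
        refine avg_mono fun σ => ?_
        by_cases h : ∀ f ∈ insert (e : Sym2 (Fin n)) T, Shown σ t f
        · have h1 : Φ (swapEdges e e' σ) := by
            intro f hf
            have hs := h f (Finset.mem_insert_of_mem hf)
            have hnd := hs.not_isDiag
            obtain ⟨f, rfl⟩ : ∃ f' : (⊤ : SimpleGraph (Fin n)).edgeSet, (f' : Sym2 (Fin n)) = f :=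
              ⟨⟨f, by simpa [SimpleGraph.edgeSet_top] using hnd⟩, rfl⟩
            rw [shown_swapEdges, Equiv.swap_apply_of_ne_of_ne]
            · exact hs
            · rintro rfl
              exact he hf
            · rintro rfl
              exact he' hf
          have h2 : Shown (swapEdges e e' σ) t (e' : Sym2 (Fin n)) := by
            rw [shown_swapEdges, Equiv.swap_apply_right]
            exact h _ (Finset.mem_insert_self _ _)
          simp only [h1, h2, if_true, mul_one]
          split_ifs
          norm_num
        · simp only [h, if_false]
          positivity
    have hsum := Finset.sum_le_sum fun e' (_ : e' ∈ Finset.univ) => key e'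
    rw [Finset.sum_const, Finset.card_univ, card_edgeSet_top, ← avg_finset_sum, nsmul_eq_mul] at hsum
    simp_rw [← Finset.mul_sum, sum_shown _ ht] at hsum
    rw [avg_mul_const] at hsum
    have hN' : (0 : ℝ) < n.choose 2 := by exact_mod_cast hN
    have h3 : avg n (fun σ => if Φ σ then (1 : ℝ) else 0) ≤ p ^ T.card := by
      rwa [pr_def] at ih
    have h4 := mul_le_mul_of_nonneg_right h3 (Nat.cast_nonneg (α := ℝ) t)
    rw [hp, div_mul_eq_mul_div, le_div_iff₀ hN']
    rw [hp] at h4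
    linarith

end Shown

/-! ### History-dependent sets: uniformity of the next edge and hitting bounds. -/

section Online

variable {n : ℕ}

/-- `f` depends only on the first `s` edges of the order. -/
def Hist {α : Type*} (s : ℕ) (f : EdgeOrder n → α) : Prop :=
  ∀ σ σ' : EdgeOrder n, (∀ i : Fin (n.choose 2), (i : ℕ) < s → σ i = σ' i) → f σ = f σ'

lemma Hist.mono {α : Type*} {s s' : ℕ} (h : s ≤ s') {f : EdgeOrder n → α} (hf : Hist s f) :
    Hist s' f := fun σ σ' H => hf σ σ' fun i hi => H i (by omega)

lemma Hist.comp {α β : Type*} {s : ℕ} {f : EdgeOrder n → α} (hf : Hist s f) (g : α → β) :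
    Hist s fun σ => g (f σ) := fun σ σ' H => congrArg g (hf σ σ' H)

lemma Hist.comp₂ {α β γ : Type*} {s : ℕ} {f : EdgeOrder n → α} {f' : EdgeOrder n → β}
    (hf : Hist s f) (hf' : Hist s f') (g : α → β → γ) :
    Hist s fun σ => g (f σ) (f' σ) := fun σ σ' H => by
  simp only [hf σ σ' H, hf' σ σ' H]

lemma hist_shown (s : ℕ) : Hist s fun σ : EdgeOrder n => Shown σ s := by
  intro σ σ' H
  ext e
  constructor
  · rintro ⟨i, hi, rfl⟩
    exact ⟨i, hi, by rw [H i hi]⟩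
  · rintro ⟨i, hi, rfl⟩
    exact ⟨i, hi, by rw [H i hi]⟩

lemma hist_builderGraph (f : Rule n) (s : ℕ) : Hist s fun σ => builderGraph f σ s := by
  induction s with
  | zero => exact fun _ _ _ => rfl
  | succ s ih =>
    intro σ σ' H
    have h1 := ih σ σ' fun i hi => H i (by omega)
    simp only at h1
    simp only [builderGraph, h1]
    split_ifs with h <;> simp_all [H ⟨s, _⟩ (Nat.lt_succ_self s)]

/-- Exchanging two times in an order. -/
noncomputable def swapTimes (i j : Fin (n.choose 2)) : Equiv.Perm (EdgeOrder n) where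
  toFun := fun σ => (Equiv.swap i j).trans σ
  invFun := fun σ => (Equiv.swap i j).trans σ
  left_inv := fun σ => by ext; simp
  right_inv := fun σ => by ext; simp

lemma swapTimes_apply (i j : Fin (n.choose 2)) (σ : EdgeOrder n) (m : Fin (n.choose 2)) :
    swapTimes i j σ m = σ (Equiv.swap i j m) := rfl

lemma Hist.swapTimes {α : Type*} {s : ℕ} {f : EdgeOrder n → α} (hf : Hist s f)
    {i j : Fin (n.choose 2)} (hi : s ≤ i) (hj : s ≤ j) (σ : EdgeOrder n) :
    f (swapTimes i j σ) = f σ := by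
  refine hf _ _ fun m hm => ?_
  rw [swapTimes_apply, Equiv.swap_apply_of_ne_of_ne]
  · rintro rfl; omega
  · rintro rfl; omega

open Classical in
/-- The number of edges of `A` that are presented at time `s + 1` or later. -/
noncomputable def numLeft (σ : EdgeOrder n) (s : ℕ) (A : Finset (Sym2 (Fin n))) : ℕ :=
  (Finset.univ.filter fun i : Fin (n.choose 2) => s ≤ i ∧ (σ i : Sym2 (Fin n)) ∈ A).card

lemma numLeft_le (σ : EdgeOrder n) (s : ℕ) (A : Finset (Sym2 (Fin n))) :
    numLeft σ s A ≤ A.card := by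
  classical
  refine Finset.card_le_card_of_injOn (fun i => (σ i : Sym2 (Fin n))) ?_ ?_
  · intro i hi
    simp only [Finset.coe_filter, Finset.mem_univ, true_and, Set.mem_ofPred_eq] at hi
    exact hi.2
  · intro i _ j _ h
    exact σ.injective (Subtype.ext h)

/-- Pairs of `A` that were not yet presented are presented later. -/
lemma card_le_numLeft (σ : EdgeOrder n) (s : ℕ) (A A' : Finset (Sym2 (Fin n))) (h : A' ⊆ A)
    (hd : ∀ e ∈ A', ¬ e.IsDiag) (hs : ∀ e ∈ A', ¬ Shown σ s e) : A'.card ≤ numLeft σ s A := by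
  classical
  have hex : ∀ e ∈ A', ∃ i : Fin (n.choose 2), (σ i : Sym2 (Fin n)) = e := by
    intro e he
    exact ⟨σ.symm ⟨e, by simpa [SimpleGraph.edgeSet_top] using hd e he⟩, by simp⟩
  have : A' ⊆ (Finset.univ.filter fun i : Fin (n.choose 2) =>
      s ≤ i ∧ (σ i : Sym2 (Fin n)) ∈ A).image fun i => (σ i : Sym2 (Fin n)) := by
    intro e he
    obtain ⟨i, rfl⟩ := hex e he
    refine Finset.mem_image.2 ⟨i, ?_, rfl⟩
    simp only [Finset.mem_filter, Finset.mem_univ, true_and]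
    refine ⟨?_, h he⟩
    by_contra hlt
    exact hs _ he ⟨i, by omega, rfl⟩
  exact (Finset.card_le_card this).trans Finset.card_image_le

open Classical in
/-- Given the first `s` edges, the next one is uniform among the remaining ones. -/
theorem avg_step {s : ℕ} (hs : s < n.choose 2) {Φ : EdgeOrder n → ℝ} (hΦ : Hist s Φ)
    {A : EdgeOrder n → Finset (Sym2 (Fin n))} (hA : Hist s A) :
    ((n.choose 2 - s : ℕ) : ℝ) *
        avg n (fun σ => Φ σ * if (σ ⟨s, hs⟩ : Sym2 (Fin n)) ∈ A σ then 1 else 0) =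
      avg n fun σ => Φ σ * numLeft σ s (A σ) := by
  -- Exchanging time `s` with a later time `i` does not affect the past, so every later position is
  -- equally likely to hold an edge of `A`; summing over `i` gives `numLeft`.
  have key : ∀ i : Fin (n.choose 2), s ≤ i →
      avg n (fun σ => Φ σ * if (σ ⟨s, hs⟩ : Sym2 (Fin n)) ∈ A σ then 1 else 0) =
      avg n (fun σ => Φ σ * if (σ i : Sym2 (Fin n)) ∈ A σ then 1 else 0) := by
    intro i hi
    rw [← avg_comp_equiv (swapTimes ⟨s, hs⟩ i)]
    refine avg_congr fun σ => ?_
    rw [hΦ.swapTimes le_rfl hi, hA.swapTimes le_rfl hi, swapTimes_apply, Equiv.swap_apply_left]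
  have hcard : (Finset.univ.filter fun i : Fin (n.choose 2) => s ≤ i).card = n.choose 2 - s := by
    have : (Finset.univ.filter fun i : Fin (n.choose 2) => s ≤ i) = Finset.Ici ⟨s, hs⟩ := by
      ext i
      simp [Fin.le_def]
    rw [this, Fin.card_Ici]
  have hsum : ((n.choose 2 - s : ℕ) : ℝ) *
        avg n (fun σ => Φ σ * if (σ ⟨s, hs⟩ : Sym2 (Fin n)) ∈ A σ then 1 else 0) =
      ∑ i ∈ Finset.univ.filter fun i : Fin (n.choose 2) => s ≤ i,
        avg n (fun σ => Φ σ * if (σ i : Sym2 (Fin n)) ∈ A σ then 1 else 0) := by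
    rw [← hcard, ← nsmul_eq_mul, ← Finset.sum_const]
    refine Finset.sum_congr rfl fun i hi => key i (by simpa using hi)
  rw [hsum, ← avg_finset_sum]
  refine avg_congr fun σ => ?_
  rw [← Finset.mul_sum, Finset.sum_boole, Finset.filter_filter, numLeft]

/-- The chance that one of the first `t` edges belongs to a set of at most `K` pairs, which may
depend on the edges presented before. -/
theorem pr_hit_le {t : ℕ} (ht : 2 * t ≤ n.choose 2) (A : ℕ → EdgeOrder n → Finset (Sym2 (Fin n)))
    (hA : ∀ s, Hist s (A s)) {K : ℝ} (hK0 : 0 ≤ K) (hK : ∀ s < t, ∀ σ, ((A s σ).card : ℝ) ≤ K) :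
    pr n (fun σ => ∃ i : Fin (n.choose 2), (i : ℕ) < t ∧ (σ i : Sym2 (Fin n)) ∈ A i σ) ≤
      2 * t * K / n.choose 2 := by
  classical
  have hone : ∀ i ∈ Finset.univ.filter (fun i : Fin (n.choose 2) => (i : ℕ) < t),
      pr n (fun σ => (σ i : Sym2 (Fin n)) ∈ A i σ) ≤ 2 * K / n.choose 2 := by
    intro i hi
    simp only [Finset.mem_filter, Finset.mem_univ, true_and] at hi
    have hN : (0 : ℝ) < n.choose 2 := by exact_mod_cast (Nat.zero_le _).trans_lt i.2
    have h := avg_step i.2 (Φ := fun _ => 1) (fun _ _ _ => rfl) (hA i)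
    have h2 : avg n (fun σ => (1 : ℝ) * numLeft σ i (A i σ)) ≤ K := by
      refine (avg_mono fun σ => ?_).trans (avg_const K).le
      rw [one_mul]
      exact (Nat.cast_le.2 (numLeft_le _ _ _)).trans (hK i hi σ)
    simp only [Fin.eta, one_mul] at h h2
    rw [← h] at h2
    -- Since `2 * t ≤ n.choose 2`, at least half of the edges are still to come at each time; this
    -- is the factor 2 in the bound.
    have h3 : (n.choose 2 : ℝ) / 2 ≤ ((n.choose 2 - i : ℕ) : ℝ) := by
      rw [Nat.cast_sub i.2.le]
      have : (2 : ℝ) * i ≤ n.choose 2 := by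
        exact_mod_cast (by omega : 2 * (i : ℕ) ≤ n.choose 2)
      linarith
    have h4 := mul_le_mul_of_nonneg_right h3
      (pr_nonneg (fun σ : EdgeOrder n => (σ i : Sym2 (Fin n)) ∈ A i σ))
    rw [le_div_iff₀ hN]
    rw [pr_def] at h4 ⊢
    linarith
  have h1 := pr_exists_le_card_mul _ (fun (i : Fin (n.choose 2)) (σ : EdgeOrder n) =>
    (σ i : Sym2 (Fin n)) ∈ A i σ) hone
  refine (pr_mono ?_).trans (h1.trans ?_)
  · rintro σ ⟨i, hi, h⟩
    exact ⟨i, by simpa using hi, h⟩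
  · have : ((Finset.univ.filter fun i : Fin (n.choose 2) => (i : ℕ) < t).card : ℝ) ≤ t := by
      norm_cast
      conv_rhs => rw [← Finset.card_range t]
      exact Finset.card_le_card_of_injOn (fun i => (i : ℕ)) (fun i hi => by simpa using hi)
        (fun i _ j _ h => Fin.ext h)
    calc _ ≤ (t : ℝ) * (2 * K / n.choose 2) := by gcongr
      _ = _ := by ring

open Classical in
/-- The number of times in `[s₀, s)` at which the presented edge belongs to the set `A`. -/
noncomputable def hits (A : ℕ → EdgeOrder n → Finset (Sym2 (Fin n))) (σ : EdgeOrder n)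
    (s₀ : ℕ) : ℕ → ℕ
  | 0 => 0
  | s + 1 => hits A σ s₀ s +
      if ∃ h : s < n.choose 2, s₀ ≤ s ∧ (σ ⟨s, h⟩ : Sym2 (Fin n)) ∈ A s σ then 1 else 0

lemma hist_hits {A : ℕ → EdgeOrder n → Finset (Sym2 (Fin n))} (hA : ∀ s, Hist s (A s))
    (s₀ s : ℕ) : Hist s fun σ => hits A σ s₀ s := by
  induction s with
  | zero => exact fun _ _ _ => rfl
  | succ s ih =>
    intro σ σ' H
    have h1 := ih σ σ' fun i hi => H i (by omega)
    have h2 := hA s σ σ' fun i hi => H i (by omega)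
    simp only at h1
    simp only [hits, h1, h2]
    congr 1
    by_cases hs : s < n.choose 2
    · simp only [hs, exists_true_left]
      rw [H ⟨s, hs⟩ (Nat.lt_succ_self s)]
    · simp [hs]

open Classical in
/-- Exponential moment bound behind `pr_few_hits_le`. -/
theorem avg_hits_le {A : ℕ → EdgeOrder n → Finset (Sym2 (Fin n))} (hA : ∀ s, Hist s (A s))
    {Good : ℕ → EdgeOrder n → Prop} (hG : ∀ s, Hist s (Good s))
    (hmono : ∀ s σ, Good (s + 1) σ → Good s σ) {q : ℝ} (hq1 : q ≤ 1) {s₀ : ℕ}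
    (hq : ∀ s σ, s₀ ≤ s → Good s σ → q * n.choose 2 ≤ numLeft σ s (A s σ)) (τ : ℕ)
    (hτ : s₀ + τ ≤ n.choose 2) :
    avg n (fun σ => (if Good (s₀ + τ) σ then 1 else 0) * (1 / 2) ^ hits A σ s₀ (s₀ + τ)) ≤
      (1 - q / 2) ^ τ := by
  induction τ with
  | zero =>
    refine (avg_mono (g := fun _ => 1) fun σ => ?_).trans (by simp [avg_const])
    have : ((1 : ℝ) / 2) ^ hits A σ s₀ (s₀ + 0) ≤ 1 := pow_le_one₀ (by norm_num) (by norm_num)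
    split_ifs
    · simpa using this
    · simp
  | succ τ ih =>
    set s := s₀ + τ with hs
    have hsN : s < n.choose 2 := by omega
    have ih := ih (by omega)
    set Φ : EdgeOrder n → ℝ := fun σ => (if Good s σ then 1 else 0) * (1 / 2) ^ hits A σ s₀ s
      with hΦdef
    have hΦ : Hist s Φ := (hG s).comp₂ (hist_hits hA s₀ s)
      (fun g h => (if g then (1 : ℝ) else 0) * (1 / 2) ^ h)
    have hΦ0 : ∀ σ, 0 ≤ Φ σ := fun σ => by simp only [hΦdef]; positivity
    have hN : (0 : ℝ) < n.choose 2 := by exact_mod_cast (Nat.zero_le _).trans_lt hsN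
    have hstep := avg_step hsN hΦ (hA s)
    set a := avg n (fun σ => Φ σ * if (σ ⟨s, hsN⟩ : Sym2 (Fin n)) ∈ A s σ then 1 else 0) with ha
    have ha0 : 0 ≤ a := avg_nonneg fun σ => mul_nonneg (hΦ0 σ) (by positivity)
    have h1 : q * n.choose 2 * avg n Φ ≤ n.choose 2 * a := by
      calc q * n.choose 2 * avg n Φ = avg n fun σ => q * n.choose 2 * Φ σ :=
            (avg_const_mul _ _).symm
        _ ≤ avg n fun σ => Φ σ * numLeft σ s (A s σ) := by
            refine avg_mono fun σ => ?_
            by_cases hg : Good s σ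
            · rw [mul_comm]
              exact mul_le_mul_of_nonneg_left (hq s σ (by omega) hg) (hΦ0 σ)
            · simp [hΦdef, hg]
        _ = ((n.choose 2 - s : ℕ) : ℝ) * a := hstep.symm
        _ ≤ n.choose 2 * a := by
            gcongr
            omega
    have h2 : q * avg n Φ ≤ a := by
      have : n.choose 2 * (q * avg n Φ) ≤ (n.choose 2 : ℝ) * a := by linarith
      exact le_of_mul_le_mul_left this hN
    -- A hit halves the weight and leaving `Good` sets it to zero, so one step subtracts at least
    -- half of the weight carried by hits.
    have h3 : avg n (fun σ => (if Good (s + 1) σ then 1 else 0) * (1 / 2) ^ hits A σ s₀ (s + 1)) ≤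
        avg n Φ - a / 2 := by
      have : avg n Φ - a / 2 = avg n fun σ => Φ σ +
          (-1 / 2) * (Φ σ * if (σ ⟨s, hsN⟩ : Sym2 (Fin n)) ∈ A s σ then 1 else 0) := by
        rw [avg_add, avg_const_mul]
        ring
      rw [this]
      refine avg_mono fun σ => ?_
      by_cases hg : Good (s + 1) σ
      · have hg' := hmono s σ hg
        have hle : s₀ ≤ s := by omega
        simp only [hg, hΦdef, hg', if_true, hits, hle, hsN, exists_true_left, true_and, pow_add]
        by_cases hm : (σ ⟨s, hsN⟩ : Sym2 (Fin n)) ∈ A s σ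
        · simp only [hm, if_true]
          linarith
        · simp [hm]
      · simp only [hg, if_false, zero_mul]
        have := hΦ0 σ
        split_ifs <;> linarith
    calc _ ≤ avg n Φ - a / 2 := h3
      _ ≤ (1 - q / 2) * avg n Φ := by linarith
      _ ≤ (1 - q / 2) * (1 - q / 2) ^ τ := by
          refine mul_le_mul_of_nonneg_left ih (by linarith)
      _ = _ := by rw [pow_succ']

/-- If at each time of an interval of length `τ` at least `q * n.choose 2` pairs of a (history
dependent) set are still to come, then it is unlikely that they are hit at most `d` times. -/
theorem pr_few_hits_le {A : ℕ → EdgeOrder n → Finset (Sym2 (Fin n))} (hA : ∀ s, Hist s (A s))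
    {Good : ℕ → EdgeOrder n → Prop} (hG : ∀ s, Hist s (Good s))
    (hmono : ∀ s σ, Good (s + 1) σ → Good s σ) {q : ℝ} (hq1 : q ≤ 1) {s₀ : ℕ}
    (hq : ∀ s σ, s₀ ≤ s → Good s σ → q * n.choose 2 ≤ numLeft σ s (A s σ)) {τ : ℕ}
    (hτ : s₀ + τ ≤ n.choose 2) (d : ℕ) :
    pr n (fun σ => Good (s₀ + τ) σ ∧ hits A σ s₀ (s₀ + τ) ≤ d) ≤
      2 ^ d * Real.exp (-(q * τ / 2)) := by
  classical
  have h := avg_hits_le hA hG hmono hq1 hq τ hτ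
  have hm := markov (n := n) (c := (1 / 2) ^ d)
    (f := fun σ => (if Good (s₀ + τ) σ then 1 else 0) * (1 / 2) ^ hits A σ s₀ (s₀ + τ))
    (E := fun σ => Good (s₀ + τ) σ ∧ hits A σ s₀ (s₀ + τ) ≤ d) (by positivity)
    (fun σ => by positivity) (fun σ ⟨hg, hd⟩ => by
      simp only [hg, if_true, one_mul]
      exact pow_le_pow_of_le_one (by norm_num) (by norm_num) hd)
  refine hm.trans ?_
  rw [div_le_iff₀ (by positivity)]
  have h2 : (1 - q / 2) ^ τ ≤ Real.exp (-(q * τ / 2)) := by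
    calc (1 - q / 2) ^ τ ≤ (Real.exp (-(q / 2))) ^ τ := by
          refine pow_le_pow_left₀ (by linarith) ?_ _
          have := Real.add_one_le_exp (-(q / 2))
          linarith
      _ = _ := by
          rw [← Real.exp_nat_mul]
          congr 1
          ring
  calc _ ≤ _ := h
    _ ≤ _ := h2
    _ = _ := by
      rw [mul_right_comm, ← mul_pow]
      norm_num

end Online

/-! ### From random strategies and asymptotics to deterministic strategies and fixed error. -/

section Reduction

variable {n t b m : ℕ}

/-- The probability that Builder's graph contains `H`, for a deterministic rule. -/
noncomputable def prContains (H : SimpleGraph (Fin m)) (f : Rule n) (t : ℕ) : ℝ :=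
  pr n fun σ => H.IsContained (builderGraph f σ t)

lemma toOuterMeasure_map_uniform (H : SimpleGraph (Fin m)) (f : Rule n) :
    ((PMF.uniformOfFintype (EdgeOrder n)).map fun σ => builderGraph f σ t).toOuterMeasure
      {G | H.IsContained G} = ENNReal.ofReal (prContains H f t) := by
  classical
  rw [PMF.toOuterMeasure_map_apply, PMF.toOuterMeasure_uniformOfFintype_apply, prContains,
    pr_def, avg, Finset.sum_boole, ENNReal.ofReal_div_of_pos card_edgeOrder_pos,
    ENNReal.ofReal_natCast, ENNReal.ofReal_natCast]
  congr 2
  rw [Fintype.card_subtype]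
  rfl

lemma probContains_pure (H : SimpleGraph (Fin m)) (f : DetStrategy n t b) :
    probContains H (PMF.pure f) = ENNReal.ofReal (prContains H f.rule t) := by
  rw [probContains, finalGraph, PMF.pure_bind, toOuterMeasure_map_uniform]

lemma probContains_le (H : SimpleGraph (Fin m)) (S : Strategy n t b) {c : ℝ}
    (h : ∀ f : DetStrategy n t b, prContains H f.rule t ≤ c) :
    probContains H S ≤ ENNReal.ofReal c := by
  rw [probContains, finalGraph, PMF.toOuterMeasure_bind_apply]
  calc _ ≤ ∑' f, S f * ENNReal.ofReal c := by
        refine ENNReal.tsum_le_tsum fun f => ?_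
        rw [toOuterMeasure_map_uniform]
        gcongr
        exact h f
    _ = ENNReal.ofReal c := by rw [ENNReal.tsum_mul_right, PMF.tsum_coe, one_mul]

lemma builderGraph_never (σ : EdgeOrder n) (s : ℕ) :
    builderGraph (fun _ _ _ => False) σ s = ⊥ := by
  induction s with
  | zero => rfl
  | succ s ih => simp [builderGraph, ih]

instance : Nonempty (DetStrategy n t b) :=
  ⟨⟨fun _ _ _ => False, fun σ s _ => by simp [builderGraph_never]⟩⟩

/-- There is a deterministic strategy that is optimal up to `ε`. -/
lemma exists_near_optimal (H : SimpleGraph (Fin m)) {ε : ℝ} (hε : 0 < ε) :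
    ∃ f : DetStrategy n t b, ∀ g : DetStrategy n t b,
      prContains H g.rule t ≤ prContains H f.rule t + ε := by
  set s := Set.range fun f : DetStrategy n t b => prContains H f.rule t with hs
  have hne : s.Nonempty := Set.range_nonempty _
  have hbdd : BddAbove s := ⟨1, by rintro _ ⟨f, rfl⟩; exact pr_le_one _⟩
  obtain ⟨_, ⟨f, rfl⟩, hf⟩ := exists_lt_of_lt_csSup hne (sub_lt_self (sSup s) hε)
  refine ⟨f, fun g => ?_⟩
  have := le_csSup hbdd ⟨g, rfl⟩
  simp only at hf this
  linarith

/-- The strategies supplied by `h` depend on the error `η`. Playing for each `n` a strategy that is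
optimal up to `1 / (n + 1)` removes this dependence: it is nearly as good as all of them at once. -/
theorem exists_strategy_tendsto_one {m k : ℕ} (H : SimpleGraph (Fin m))
    (h : ∀ η : ℝ, 0 < η → ∃ K : ℝ, 0 < K ∧ ∃ n₀ : ℕ, ∀ n ≥ n₀, ∀ t b : ℕ, t ≤ n.choose 2 →
      K * (n * Real.log n) ≤ t → K * bStar k n t ≤ b →
      ∃ f : DetStrategy n t b, 1 - η ≤ prContains H f.rule t)
    (t b : ℕ → ℕ) (ht : ∀ n, t n ≤ n.choose 2)
    (h1 : (fun n : ℕ => (n : ℝ) * Real.log n) =o[atTop] fun n => (t n : ℝ))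
    (h2 : (fun n : ℕ => bStar k n (t n)) =o[atTop] fun n => (b n : ℝ)) :
    ∃ S : ∀ n : ℕ, Strategy n (t n) (b n),
      Tendsto (fun n => probContains H (S n)) atTop (𝓝 1) := by
  have hopt : ∀ n : ℕ, ∃ f : DetStrategy n (t n) (b n), ∀ g : DetStrategy n (t n) (b n),
      prContains H g.rule (t n) ≤ prContains H f.rule (t n) + 1 / (n + 1) :=
    fun n => exists_near_optimal H (by positivity)
  choose f hf using hopt
  refine ⟨fun n => PMF.pure (f n), ?_⟩
  simp only [probContains_pure]
  rw [← ENNReal.ofReal_one]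
  refine ENNReal.tendsto_ofReal ?_
  rw [Metric.tendsto_atTop]
  intro ε hε
  obtain ⟨K, hK, n₀, hn₀⟩ := h (ε / 2) (by linarith)
  have e1 := h1.bound (c := 1 / K) (by positivity)
  have e2 := h2.bound (c := 1 / K) (by positivity)
  have e3 : ∀ᶠ n : ℕ in atTop, (1 : ℝ) / (n + 1) < ε / 2 :=
    (tendsto_one_div_add_atTop_nhds_zero_nat (𝕜 := ℝ)).eventually (gt_mem_nhds (by linarith))
  obtain ⟨N, hN⟩ := eventually_atTop.1 (e1.and (e2.and (e3.and (eventually_ge_atTop n₀))))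
  refine ⟨N, fun n hn => ?_⟩
  obtain ⟨a1, a2, a3, a4⟩ := hN n hn
  rw [Real.norm_natCast, one_div, ← div_eq_inv_mul, le_div_iff₀ hK] at a1 a2
  obtain ⟨g, hg⟩ := hn₀ n a4 (t n) (b n) (ht n)
    (by nlinarith [le_abs_self ((n : ℝ) * Real.log n), Real.norm_eq_abs ((n : ℝ) * Real.log n)])
    (by nlinarith [le_abs_self (bStar k n (t n)), Real.norm_eq_abs (bStar k n (t n))])
  have h4 := hf n g
  have h5 : prContains H (f n).rule (t n) ≤ 1 := pr_le_one _
  rw [Real.dist_eq, abs_lt]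
  constructor <;> linarith

/-- A bound valid for every deterministic strategy passes to mixtures, so only the uniformity in `t`
and `b` matters. -/
theorem strategy_tendsto_zero {m k : ℕ} (H : SimpleGraph (Fin m))
    (h : ∀ η : ℝ, 0 < η → ∃ δ : ℝ, 0 < δ ∧ ∃ n₀ : ℕ, ∀ n ≥ n₀, ∀ t b : ℕ, t ≤ n.choose 2 →
      ((t : ℝ) ≤ δ * n ∨ (b : ℝ) ≤ δ * bStar k n t) →
      ∀ f : DetStrategy n t b, prContains H f.rule t ≤ η)
    (t b : ℕ → ℕ) (ht : ∀ n, t n ≤ n.choose 2)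
    (h1 : ((fun n => (t n : ℝ)) =o[atTop] fun n : ℕ => (n : ℝ)) ∨
        ((fun n => (b n : ℝ)) =o[atTop] fun n : ℕ => bStar k n (t n)))
    (S : ∀ n : ℕ, Strategy n (t n) (b n)) :
    Tendsto (fun n => probContains H (S n)) atTop (𝓝 0) := by
  rw [ENNReal.tendsto_nhds_zero]
  intro ε hε
  obtain ⟨η, hη, hηε⟩ : ∃ η : ℝ, 0 < η ∧ ENNReal.ofReal η ≤ ε := by
    by_cases hT : ε = ⊤
    · exact ⟨1, one_pos, by simp [hT]⟩
    · exact ⟨ε.toReal, ENNReal.toReal_pos hε.ne' hT, by rw [ENNReal.ofReal_toReal hT]⟩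
  obtain ⟨δ, hδ, n₀, hn₀⟩ := h η hη
  have e : ∀ᶠ n : ℕ in atTop, ((t n : ℝ) ≤ δ * n ∨ (b n : ℝ) ≤ δ * bStar k n (t n)) := by
    rcases h1 with h1 | h1
    · filter_upwards [h1.bound hδ] with n hn
      rw [Real.norm_natCast, Real.norm_natCast] at hn
      exact Or.inl hn
    · filter_upwards [h1.bound hδ] with n hn
      have h0 : 0 ≤ bStar k n (t n) := le_max_of_le_left (by positivity)
      rw [Real.norm_natCast, Real.norm_of_nonneg h0] at hn
      exact Or.inr hn
  filter_upwards [e, eventually_ge_atTop n₀] with n hn hn'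
  exact (probContains_le H (S n) (hn₀ n hn' _ _ (ht n) hn)).trans hηε

end Reduction

/-! ### Degeneracy orderings and the number of pairs joined by a walk. -/

section Walks

variable {V : Type*}

lemma card_le_two_mul_card_image_mk [DecidableEq V] (P : Finset (V × V)) :
    P.card ≤ 2 * (P.image fun z => s(z.1, z.2)).card := by
  refine Finset.card_le_mul_card_image _ _ fun e he => ?_
  induction e using Sym2.ind with
  | _ a b =>
    have : (P.filter fun z => s(z.1, z.2) = s(a, b)) ⊆ {(a, b), (b, a)} := by
      rintro ⟨x, y⟩ h
      simp only [Finset.mem_filter, Sym2.eq_iff] at h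
      simp only [Finset.mem_insert, Finset.mem_singleton, Prod.mk.injEq]
      exact h.2
    exact (Finset.card_le_card this).trans Finset.card_le_two

open Classical in
/-- A degeneracy ordering. -/
lemma exists_rank (G : SimpleGraph V) (d : ℕ) (S : Finset V)
    (h : ∀ S' ⊆ S, S'.Nonempty → ∃ v ∈ S', (S'.filter fun w => G.Adj v w).card ≤ d) :
    ∃ r : V → ℕ, Set.InjOn r S ∧
      ∀ v ∈ S, (S.filter fun w => G.Adj v w ∧ r v < r w).card ≤ d := by
  induction hc : S.card generalizing S with
  | zero =>
    rw [Finset.card_eq_zero] at hc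
    subst hc
    exact ⟨fun _ => 0, by simp, by simp⟩
  | succ c ih =>
    obtain ⟨v, hv, hd⟩ := h S subset_rfl (Finset.card_pos.1 (by omega))
    obtain ⟨r, hinj, hr⟩ := ih (S.erase v)
      (fun S' hS' => h S' (hS'.trans (Finset.erase_subset _ _)))
      (by rw [Finset.card_erase_of_mem hv]; omega)
    -- The removed vertex `v` of small degree comes first and all other ranks move up by one, so the
    -- later neighbours of `v` are among all its neighbours in `S`.
    refine ⟨fun w => if w = v then 0 else r w + 1, ?_, ?_⟩
    · intro x hx y hy hxy
      by_cases h1 : x = v <;> by_cases h2 : y = v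
      · rw [h1, h2]
      · simp [h1, h2] at hxy
      · simp [h1, h2] at hxy
      · simp only [h1, h2, if_false, Nat.add_right_cancel_iff] at hxy
        exact hinj (Finset.mem_erase.2 ⟨h1, hx⟩) (Finset.mem_erase.2 ⟨h2, hy⟩) hxy
    · intro w hw
      by_cases h1 : w = v
      · subst h1
        refine (Finset.card_le_card ?_).trans hd
        exact Finset.monotone_filter_right _ fun x _ hx => hx.1
      · refine (Finset.card_le_card ?_).trans (hr w (Finset.mem_erase.2 ⟨h1, hw⟩))
        intro x hx
        simp only [Finset.mem_filter, h1, if_false] at hx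
        have hxv : x ≠ v := by
          rintro rfl
          simp at hx
        simp only [hxv, if_false, add_lt_add_iff_right] at hx
        exact Finset.mem_filter.2 ⟨Finset.mem_erase.2 ⟨hxv, hx.1⟩, hx.2⟩

variable [Fintype V]

open Classical in
/-- The vertices that can be reached from `x` by a walk of `j` steps of which at most `d` do not
increase the rank. -/
noncomputable def reach (G : SimpleGraph V) (r : V → ℕ) (x : V) : ℕ → ℕ → Finset V
  | 0, _ => {x}
  | j + 1, 0 => (reach G r x j 0).biUnion fun v => Finset.univ.filter fun w => G.Adj v w ∧ r v < r w
  | j + 1, d + 1 =>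
    ((reach G r x j (d + 1)).biUnion fun v => Finset.univ.filter fun w => G.Adj v w ∧ r v < r w) ∪
      (reach G r x j d).biUnion fun v => Finset.univ.filter fun w => G.Adj v w

-- The last step either goes up, with at most 3 choices, or spends one of the `d` free steps, with
-- at most `Δ` choices; the constant 4 absorbs both, as `3 * 4 ^ j * Δ ^ (d + 1) + 4 ^ j * Δ ^ d * Δ
-- = 4 ^ (j + 1) * Δ ^ (d + 1)`.
open Classical in
lemma card_reach_le (G : SimpleGraph V) (r : V → ℕ) (x : V) {Δ : ℕ} (hΔ : 1 ≤ Δ)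
    (hup : ∀ v, (Finset.univ.filter fun w => G.Adj v w ∧ r v < r w).card ≤ 3)
    (hdeg : ∀ v, (Finset.univ.filter fun w => G.Adj v w).card ≤ Δ) (j d : ℕ) :
    (reach G r x j d).card ≤ 4 ^ j * Δ ^ d := by
  induction j generalizing d with
  | zero => simpa [reach] using Nat.one_le_pow _ _ hΔ
  | succ j ih =>
    have hstep : ∀ d, ((reach G r x j d).biUnion fun v =>
        Finset.univ.filter fun w => G.Adj v w ∧ r v < r w).card ≤ 4 ^ j * Δ ^ d * 3 := fun d =>
      (Finset.card_biUnion_le_card_mul _ _ 3 fun v _ => hup v).trans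
        (Nat.mul_le_mul_right _ (ih d))
    cases d with
    | zero =>
      rw [reach]
      refine (hstep 0).trans ?_
      rw [pow_succ]
      simp only [pow_zero, mul_one]
      omega
    | succ d =>
      rw [reach]
      refine (Finset.card_union_le _ _).trans ?_
      have h2 : ((reach G r x j d).biUnion fun v =>
          Finset.univ.filter fun w => G.Adj v w).card ≤ 4 ^ j * Δ ^ d * Δ :=
        (Finset.card_biUnion_le_card_mul _ _ Δ fun v _ => hdeg v).trans
          (Nat.mul_le_mul_right _ (ih d))
      have h1 := hstep (d + 1)
      have : 4 ^ (j + 1) * Δ ^ (d + 1) = 4 ^ j * Δ ^ (d + 1) * 3 + 4 ^ j * Δ ^ d * Δ := by ring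
      omega

open Classical in
lemma mem_reach (G : SimpleGraph V) (r : V → ℕ) (c : ℕ → V) (j d : ℕ)
    (hadj : ∀ i < j, G.Adj (c i) (c (i + 1)))
    (hd : (∑ i ∈ Finset.range j, if r (c i) < r (c (i + 1)) then 0 else 1) ≤ d) :
    c j ∈ reach G r (c 0) j d := by
  induction j generalizing d with
  | zero => simp [reach]
  | succ j ih =>
    rw [Finset.sum_range_succ] at hd
    have hj := hadj j (Nat.lt_succ_self j)
    have ih' := fun d => ih d fun i hi => hadj i (by omega)
    by_cases hlt : r (c j) < r (c (j + 1))
    · simp only [hlt, if_true, add_zero] at hd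
      have := ih' d hd
      cases d with
      | zero =>
        rw [reach]
        exact Finset.mem_biUnion.2 ⟨c j, this, by simp [hj, hlt]⟩
      | succ d =>
        rw [reach]
        exact Finset.mem_union_left _ (Finset.mem_biUnion.2 ⟨c j, this, by simp [hj, hlt]⟩)
    · simp only [hlt, if_false] at hd
      cases d with
      | zero => omega
      | succ d =>
        rw [reach]
        exact Finset.mem_union_right _
          (Finset.mem_biUnion.2 ⟨c j, ih' d (by omega), by simp [hj]⟩)

open Classical in
/-- The pairs of vertices that are joined by a walk of length `m`. -/
noncomputable def joined (G : SimpleGraph V) (m : ℕ) : Finset (Sym2 V) :=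
  Finset.univ.filter fun e => ∃ c : ℕ → V, e = s(c 0, c m) ∧ ∀ i < m, G.Adj (c i) (c (i + 1))

open Classical in
/-- The vertices that are not isolated. -/
noncomputable def touched (G : SimpleGraph V) : Finset V :=
  Finset.univ.filter fun v => ∃ w, G.Adj v w

open Classical in
/-- A sparse graph of bounded degree has few pairs of vertices that are joined by a walk of given
length `m ≤ 2 * k + 1`: in one of its two directions, such a walk makes at most `k` steps against
a degeneracy ordering. -/
theorem card_joined_le (G : SimpleGraph V) {m k Δ : ℕ} (hm1 : 1 ≤ m) (hm : m ≤ 2 * k + 1)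
    (hΔ : 1 ≤ Δ) (hdeg : ∀ v, (Finset.univ.filter fun w => G.Adj v w).card ≤ Δ)
    (h : ∀ S ⊆ touched G, S.Nonempty → ∃ v ∈ S, (S.filter fun w => G.Adj v w).card ≤ 3) :
    (joined G m).card ≤ (touched G).card * (4 ^ m * Δ ^ k) := by
  obtain ⟨r, hinj, hr⟩ := exists_rank G 3 (touched G) h
  have hup : ∀ v, (Finset.univ.filter fun w => G.Adj v w ∧ r v < r w).card ≤ 3 := by
    intro v
    by_cases hv : v ∈ touched G
    · refine (Finset.card_le_card ?_).trans (hr v hv)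
      intro w hw
      simp only [Finset.mem_filter, Finset.mem_univ, true_and, touched] at hw ⊢
      exact ⟨⟨v, hw.1.symm⟩, hw⟩
    · rw [Finset.card_eq_zero.2]
      · omega
      · ext w
        simp only [Finset.mem_filter, Finset.mem_univ, true_and, touched, not_exists] at hv ⊢
        simp [hv w]
  have hsub : joined G m ⊆ (touched G).biUnion fun x =>
      (reach G r x m k).image fun y => s(x, y) := by
    intro e he
    simp only [joined, Finset.mem_filter, Finset.mem_univ, true_and] at he
    obtain ⟨c, rfl, hc⟩ := he
    have htouch : ∀ i ≤ m, c i ∈ touched G := by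
      intro i hi
      simp only [touched, Finset.mem_filter, Finset.mem_univ, true_and]
      rcases Nat.lt_or_ge i m with h1 | h1
      · exact ⟨_, hc i h1⟩
      · refine ⟨c (i - 1), ?_⟩
        have := hc (i - 1) (by omega)
        rw [Nat.sub_add_cancel (by omega)] at this
        exact this.symm
    -- Ranks of adjacent vertices differ, so each step goes against the order in exactly one of the
    -- two directions. The two counts add up to `m ≤ 2 * k + 1`, hence one of them is at most `k`.
    have hsum : (∑ i ∈ Finset.range m, if r (c i) < r (c (i + 1)) then 0 else 1) +
        (∑ i ∈ Finset.range m, if r (c (i + 1)) < r (c i) then 0 else 1) = m := by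
      rw [← Finset.sum_add_distrib]
      conv_rhs => rw [← Finset.card_range m, Finset.card_eq_sum_ones]
      refine Finset.sum_congr rfl fun i hi => ?_
      have hi := Finset.mem_range.1 hi
      have hne : r (c i) ≠ r (c (i + 1)) := fun heq =>
        (hc i hi).ne (hinj (htouch i hi.le) (htouch (i + 1) hi) heq)
      split_ifs <;> omega
    rcases Nat.lt_or_ge k (∑ i ∈ Finset.range m, if r (c i) < r (c (i + 1)) then 0 else 1) with
      h1 | h1
    -- Too many bad steps forwards: the walk is read backwards, starting from `c m`.
    · refine Finset.mem_biUnion.2 ⟨c m, htouch m le_rfl, Finset.mem_image.2 ⟨c 0, ?_, Sym2.eq_swap⟩⟩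
      have := mem_reach G r (fun i => c (m - i)) m k ?_ ?_
      · simpa using this
      · intro i hi
        have := hc (m - (i + 1)) (by omega)
        rw [show m - (i + 1) + 1 = m - i by omega] at this
        exact this.symm
      · have hrefl := Finset.sum_range_reflect
          (fun i => if r (c (i + 1)) < r (c i) then 0 else 1) m
        refine le_trans (le_of_eq ?_) (by omega :
          (∑ i ∈ Finset.range m, if r (c (i + 1)) < r (c i) then 0 else 1) ≤ k)
        rw [← hrefl]
        refine Finset.sum_congr rfl fun i hi => ?_
        have hi := Finset.mem_range.1 hi
        rw [show m - 1 - i + 1 = m - i by omega, show m - 1 - i = m - (i + 1) by omega]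
    · exact Finset.mem_biUnion.2 ⟨c 0, htouch 0 (Nat.zero_le _),
        Finset.mem_image.2 ⟨c m, mem_reach G r c m k hc h1, rfl⟩⟩
  refine (Finset.card_le_card hsub).trans
    (Finset.card_biUnion_le_card_mul _ _ _ fun x _ => Finset.card_image_le.trans ?_)
  exact card_reach_le G r x hΔ hup hdeg m k

lemma card_touched_le (G : SimpleGraph V) : (touched G).card ≤ 2 * G.edgeSet.ncard := by
  classical
  rw [← SimpleGraph.coe_edgeFinset, Set.ncard_coe_finset, ← G.sum_degrees_eq_twice_card_edges,
    Finset.card_eq_sum_ones]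
  refine (Finset.sum_le_sum (g := fun v => G.degree v) fun v hv => ?_).trans
    (Finset.sum_le_sum_of_subset (Finset.subset_univ _))
  simp only [touched, Finset.mem_filter, Finset.mem_univ, true_and] at hv
  exact Nat.one_le_iff_ne_zero.2 (Nat.pos_iff_ne_zero.1 ((G.degree_pos_iff_exists_adj v).2 hv))

end Walks

/-! ### Cycles as cyclic sequences. -/

section Cycles

variable {V : Type*} {L : ℕ}

lemma isContained_cycleGraph_iff (G : SimpleGraph V) :
    (SimpleGraph.cycleGraph (L + 3)).IsContained G ↔
      ∃ φ : Fin (L + 3) → V, Function.Injective φ ∧ ∀ i, G.Adj (φ i) (φ (i + 1)) := by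
  constructor
  · rintro ⟨f⟩
    refine ⟨f, f.injective, fun i => f.toHom.map_adj ?_⟩
    rw [SimpleGraph.cycleGraph_adj]
    right
    simp
  · rintro ⟨φ, hφ, h⟩
    refine ⟨⟨⟨φ, ?_⟩, hφ⟩⟩
    intro u v huv
    rw [SimpleGraph.cycleGraph_adj] at huv
    rcases huv with h1 | h1
    · have : u = v + 1 := by rw [← h1]; abel
      rw [this]
      exact (h v).symm
    · have : v = u + 1 := by rw [← h1]; abel
      rw [this]
      exact h u

lemma fin_add_two_ne (j : Fin (L + 3)) : j + 1 + 1 ≠ j := by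
  intro h
  have h2 : (1 + 1 : Fin (L + 3)) = 0 := by
    have : j + (1 + 1) = j + 0 := by rw [← add_assoc, h, add_zero]
    exact add_left_cancel this
  have := congrArg Fin.val h2
  simp [Fin.val_add, Nat.mod_eq_of_lt] at this

/-- Two indices could give the same edge in opposite directions only if `j + 2 = j`, which fails
because the cycle has at least three vertices. -/
lemma cycle_edge_injective {φ : Fin (L + 3) → V} (hφ : Function.Injective φ) :
    Function.Injective fun i => s(φ i, φ (i + 1)) := by
  intro i j h
  simp only [Sym2.eq_iff] at h
  rcases h with h | h
  · exact hφ h.1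
  · exfalso
    have h1 := hφ h.1
    have h2 := hφ h.2
    rw [h1] at h2
    exact fin_add_two_ne j h2

end Cycles

/-! ### Builder's graph, the closing edge, and sparsity of the light part. -/

section Builder

variable {n : ℕ} {L : ℕ}

lemma builderGraph_succ_adj (f : Rule n) (σ : EdgeOrder n) (s : ℕ) (v w : Fin n) :
    (builderGraph f σ (s + 1)).Adj v w ↔ (builderGraph f σ s).Adj v w ∨
      ∃ h : s < n.choose 2, (σ ⟨s, h⟩ : Sym2 (Fin n)) = s(v, w) ∧
        f s (σ ⟨s, h⟩) (builderGraph f σ s) := by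
  by_cases h : s < n.choose 2
  · by_cases hf : f s (σ ⟨s, h⟩) (builderGraph f σ s)
    · simp only [builderGraph, h, hf, dif_pos, if_true, SimpleGraph.sup_adj,
        SimpleGraph.fromEdgeSet_adj, Set.mem_singleton_iff, exists_true_left, and_true]
      constructor
      · rintro (h1 | ⟨h1, -⟩)
        · exact Or.inl h1
        · exact Or.inr h1.symm
      · rintro (h1 | h1)
        · exact Or.inl h1
        · refine Or.inr ⟨h1.symm, ?_⟩
          have := SimpleGraph.not_isDiag_of_mem_edgeSet _ (σ ⟨s, h⟩).2
          rw [h1] at this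
          simpa using this
    · simp [builderGraph, h, hf]
  · simp [builderGraph, h]

lemma builderGraph_mono (f : Rule n) (σ : EdgeOrder n) {s s' : ℕ} (h : s ≤ s') :
    builderGraph f σ s ≤ builderGraph f σ s' := by
  induction s', h using Nat.le_induction with
  | base => exact le_rfl
  | succ s' _ ih =>
    intro v w hvw
    exact (builderGraph_succ_adj f σ s' v w).2 (Or.inl (ih hvw))

lemma shown_of_adj {f : Rule n} {σ : EdgeOrder n} {s : ℕ} {v w : Fin n}
    (h : (builderGraph f σ s).Adj v w) : Shown σ s s(v, w) := by
  induction s with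
  | zero => simp [builderGraph] at h
  | succ s ih =>
    rcases (builderGraph_succ_adj f σ s v w).1 h with h | ⟨hs, he, -⟩
    · exact (ih h).mono (Nat.le_succ s)
    · exact ⟨⟨s, hs⟩, Nat.lt_succ_self s, he⟩

/-- When a cycle appears in Builder's graph, the edge presented last closes it. -/
theorem exists_closing {f : Rule n} {σ : EdgeOrder n} {t : ℕ}
    (h : (SimpleGraph.cycleGraph (L + 3)).IsContained (builderGraph f σ t)) :
    ∃ i : Fin (n.choose 2), (i : ℕ) < t ∧ ∃ φ : Fin (L + 3) → Fin n, Function.Injective φ ∧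
      (∀ x, (builderGraph f σ t).Adj (φ x) (φ (x + 1))) ∧
      (σ i : Sym2 (Fin n)) = s(φ (Fin.last _), φ 0) ∧
      ∀ x ≠ Fin.last _, (builderGraph f σ i).Adj (φ x) (φ (x + 1)) := by
  classical
  obtain ⟨φ, hφ, hadj⟩ := (isContained_cycleGraph_iff _).1 h
  -- The copy `φ` found at time `t` stays fixed and is followed back to the first time at which all
  -- its edges are present.
  have hex : ∃ s, ∀ x, (builderGraph f σ s).Adj (φ x) (φ (x + 1)) := ⟨t, hadj⟩
  obtain ⟨s, hs⟩ : ∃ s, Nat.find hex = s + 1 := by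
    refine Nat.exists_eq_succ_of_ne_zero fun h0 => ?_
    have := Nat.find_spec hex 0
    rw [h0] at this
    simp [builderGraph] at this
  have hst : s < t := by
    have := Nat.find_min' hex hadj
    omega
  have hspec := Nat.find_spec hex
  rw [hs] at hspec
  have hnot := Nat.find_min hex (m := s) (by omega)
  push Not at hnot
  obtain ⟨j, hj⟩ := hnot
  have hstep : ∀ x, (builderGraph f σ s).Adj (φ x) (φ (x + 1)) ∨
      ∃ h : s < n.choose 2, (σ ⟨s, h⟩ : Sym2 (Fin n)) = s(φ x, φ (x + 1)) := by
    intro x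
    rcases (builderGraph_succ_adj f σ s _ _).1 (hspec x) with h1 | ⟨h1, h2, -⟩
    · exact Or.inl h1
    · exact Or.inr ⟨h1, h2⟩
  obtain ⟨hsN, hσ⟩ := (hstep j).resolve_left hj
  have hlast : Fin.last (L + 2) + (j + 1) = j := by
    rw [add_comm j 1, ← add_assoc]
    simp
  -- The cycle is rotated so that the missing edge becomes the one from the last index back to 0.
  refine ⟨⟨s, hsN⟩, hst, fun x => φ (x + (j + 1)), ?_, ?_, ?_, ?_⟩
  · exact fun x y hxy => add_right_cancel (hφ hxy)
  · intro x
    have := hadj (x + (j + 1))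
    rwa [add_right_comm] at this
  · simp only [hlast, zero_add]
    exact hσ
  · intro x hx
    have h1 := hstep (x + (j + 1))
    have hcomm : x + (j + 1) + 1 = x + 1 + (j + 1) := add_right_comm _ _ _
    rw [hcomm] at h1
    refine h1.resolve_right ?_
    rintro ⟨h2, h3⟩
    rw [hσ] at h3
    have h4 := cycle_edge_injective hφ (a₁ := j) (a₂ := x + (j + 1))
      (by simpa only [hcomm] using h3)
    apply hx
    have : Fin.last (L + 2) + (j + 1) = x + (j + 1) := hlast.trans h4
    exact (add_right_cancel this).symm

/-- A cycle minus an edge, as a walk. -/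
lemma walk_of_cycle {V : Type*} {G : SimpleGraph V} {φ : Fin (L + 3) → V}
    (h : ∀ x ≠ Fin.last _, G.Adj (φ x) (φ (x + 1))) :
    ∃ c : ℕ → V, c 0 = φ 0 ∧ c (L + 2) = φ (Fin.last _) ∧ (∀ i, ∃ x, c i = φ x) ∧
      ∀ i < L + 2, G.Adj (c i) (c (i + 1)) := by
  refine ⟨fun i => φ (Fin.ofNat (L + 3) i), rfl, ?_, fun i => ⟨_, rfl⟩, ?_⟩
  · simp only
    congr 1
    ext
    simp [Fin.ofNat]
  · intro i hi
    have h1 : Fin.ofNat (L + 3) (i + 1) = Fin.ofNat (L + 3) i + 1 := by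
      ext
      simp [Fin.ofNat, Fin.val_add]
    simp only
    rw [h1]
    apply h
    intro h2
    have := congrArg Fin.val h2
    simp only [Fin.ofNat, Fin.val_last] at this
    rw [Nat.mod_eq_of_lt (by omega)] at this
    omega

open Classical in
/-- The number of presented edges at `v`. -/
noncomputable def shownDeg (σ : EdgeOrder n) (s : ℕ) (v : Fin n) : ℕ :=
  (Finset.univ.filter fun w => Shown σ s s(v, w)).card

lemma shownDeg_mono (σ : EdgeOrder n) {s s' : ℕ} (h : s ≤ s') (v : Fin n) :
    shownDeg σ s v ≤ shownDeg σ s' v := by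
  classical
  exact Finset.card_le_card (Finset.monotone_filter_right _ fun _ _ hw => hw.mono h)

open Classical in
/-- The number of presented edges with both ends in `S`. -/
noncomputable def shownIn (σ : EdgeOrder n) (s : ℕ) (S : Finset (Fin n)) : ℕ :=
  (S.sym2.filter fun e => Shown σ s e).card

lemma shownIn_mono (σ : EdgeOrder n) {s s' : ℕ} (h : s ≤ s') (S : Finset (Fin n)) :
    shownIn σ s S ≤ shownIn σ s' S := by
  classical
  exact Finset.card_le_card (Finset.monotone_filter_right _ fun _ _ hw => hw.mono h)

/-- Every nonempty set of at most `B` vertices spans fewer than twice as many presented edges as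
it has vertices. -/
def Sparse (σ : EdgeOrder n) (s B : ℕ) : Prop :=
  ∀ S : Finset (Fin n), S.Nonempty → S.card ≤ B → shownIn σ s S < 2 * S.card

/-- The edges of `G` both of whose ends have at most `Δ` presented edges. -/
def lightGraph (G : SimpleGraph (Fin n)) (σ : EdgeOrder n) (s Δ : ℕ) : SimpleGraph (Fin n) where
  Adj v w := G.Adj v w ∧ shownDeg σ s v ≤ Δ ∧ shownDeg σ s w ≤ Δ
  symm := ⟨fun _ _ h => ⟨h.1.symm, h.2.2, h.2.1⟩⟩
  loopless := ⟨fun v h => G.loopless.irrefl v h.1⟩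

lemma shownDeg_congr {σ σ' : EdgeOrder n} {s : ℕ} (h : Shown σ s = Shown σ' s) (v : Fin n) :
    shownDeg σ s v = shownDeg σ' s v := by
  unfold shownDeg
  congr! 2
  simp [h]

lemma sparse_congr {σ σ' : EdgeOrder n} {s : ℕ} (h : Shown σ s = Shown σ' s) (B : ℕ) :
    Sparse σ s B ↔ Sparse σ' s B := by
  have : ∀ S, shownIn σ s S = shownIn σ' s S := fun S => by
    unfold shownIn
    congr! 2
    simp [h]
  simp only [Sparse, this]

/-- Sparsity makes the average degree inside every set of non-isolated vertices less than 4, which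
is the degeneracy required by `card_joined_le`; restricting to light vertices supplies the degree
bound `Δ`. -/
lemma card_joined_lightGraph_le {f : Rule n} {σ : EdgeOrder n} {s b m k Δ : ℕ}
    (hb : (builderGraph f σ s).edgeSet.ncard ≤ b) (hm1 : 1 ≤ m) (hm : m ≤ 2 * k + 1)
    (hΔ : 1 ≤ Δ) (hS : Sparse σ s (2 * b)) :
    (joined (lightGraph (builderGraph f σ s) σ s Δ) m).card ≤ 2 * b * (4 ^ m * Δ ^ k) := by
  classical
  set G := lightGraph (builderGraph f σ s) σ s Δ with hG
  have htouch : (touched G).card ≤ 2 * b := by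
    refine le_trans (Finset.card_le_card ?_) ((card_touched_le (builderGraph f σ s)).trans
      (Nat.mul_le_mul_left 2 hb))
    intro v hv
    simp only [touched, Finset.mem_filter] at hv ⊢
    obtain ⟨hv, w, hw⟩ := hv
    exact ⟨hv, w, hw.1⟩
  refine (card_joined_le G hm1 hm hΔ ?_ ?_).trans (Nat.mul_le_mul_right _ htouch)
  · intro v
    by_cases hv : shownDeg σ s v ≤ Δ
    · refine le_trans (Finset.card_le_card ?_) hv
      exact Finset.monotone_filter_right _ fun w _ hw => shown_of_adj hw.1
    · rw [Finset.card_eq_zero.2 (Finset.filter_eq_empty_iff.2 fun w _ hw => hv hw.2.1)]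
      omega
  · intro S hSG hne
    by_contra! hcon
    have hlt := hS S hne ((Finset.card_le_card hSG).trans htouch)
    -- If every vertex of `S` had at least 4 neighbours in `S`, there would be `4 * S.card` ordered
    -- adjacent pairs, hence `2 * S.card` presented edges inside `S`.
    have h1 : S.card * 4 ≤ ((S ×ˢ S).filter fun z => G.Adj z.1 z.2).card := by
      rw [Finset.card_filter, Finset.sum_product, ← smul_eq_mul, ← Finset.sum_const]
      refine Finset.sum_le_sum fun v hv => ?_
      rw [← Finset.card_filter]
      exact hcon v hv
    have h2 := card_le_two_mul_card_image_mk ((S ×ˢ S).filter fun z => G.Adj z.1 z.2)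
    have h3 : (((S ×ˢ S).filter fun z => G.Adj z.1 z.2).image fun z => s(z.1, z.2)).card ≤
        shownIn σ s S := by
      refine Finset.card_le_card fun e he => ?_
      obtain ⟨⟨a, c⟩, hz, rfl⟩ := Finset.mem_image.1 he
      simp only [Finset.mem_filter, Finset.mem_product] at hz
      simp only [Finset.mem_filter, Finset.mk_mem_sym2_iff]
      exact ⟨hz.1, shown_of_adj hz.2.1⟩
    omega

end Builder

/-! ### Three upper bounds for the probability that a cycle is built. -/

section Lower

variable {n : ℕ} {L : ℕ}

lemma two_le_pairs (n : ℕ) (hn : 2 ≤ n) : (n : ℝ) ^ 2 / 4 ≤ n.choose 2 := by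
  rw [Nat.cast_choose_two]
  have : (2 : ℝ) ≤ n := by exact_mod_cast hn
  nlinarith

/-- First moment bound for cycles. -/
theorem prContains_cycle_le_pow (f : Rule n) {t : ℕ} (ht : t ≤ n.choose 2) :
    prContains (SimpleGraph.cycleGraph (L + 3)) f t ≤ (n * (t / n.choose 2 : ℝ)) ^ (L + 3) := by
  classical
  have h := pr_exists_le_card_mul (n := n)
    (Finset.univ.filter fun φ : Fin (L + 3) → Fin n => Function.Injective φ)
    (fun φ σ => ∀ e ∈ Finset.univ.image fun i => s(φ i, φ (i + 1)), Shown σ t e)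
    (c := ((t : ℝ) / n.choose 2) ^ (L + 3)) (fun φ hφ => by
      refine (pr_shown_le ht _).trans (le_of_eq ?_)
      rw [Finset.card_image_of_injective _ (cycle_edge_injective (by simpa using hφ))]
      simp)
  refine (pr_mono ?_).trans (h.trans ?_)
  · intro σ hσ
    obtain ⟨φ, hφ, hadj⟩ := (isContained_cycleGraph_iff _).1 hσ
    refine ⟨φ, by simpa using hφ, fun e he => ?_⟩
    obtain ⟨i, -, rfl⟩ := Finset.mem_image.1 he
    exact shown_of_adj (hadj i)
  · rw [mul_pow]
    gcongr
    have := Finset.card_filter_le (Finset.univ : Finset (Fin (L + 3) → Fin n))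
      (fun φ => Function.Injective φ)
    rw [Finset.card_univ, Fintype.card_fun, Fintype.card_fin, Fintype.card_fin] at this
    exact_mod_cast this

/-- With budget `b`, the edge that closes a cycle joins two of at most `2 * b` vertices. -/
theorem prContains_cycle_le_sq {t b : ℕ} (f : DetStrategy n t b) (ht : 2 * t ≤ n.choose 2) :
    prContains (SimpleGraph.cycleGraph (L + 3)) f.rule t ≤
      2 * t * (2 * b) ^ 2 / n.choose 2 := by
  classical
  refine le_trans (pr_mono fun σ hσ => ?_) (pr_hit_le ht
    (fun s σ => ((touched (builderGraph f.rule σ s)) ×ˢ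
      (touched (builderGraph f.rule σ s))).image fun z => s(z.1, z.2))
    (fun s => (hist_builderGraph f.rule s).comp fun G =>
      ((touched G) ×ˢ (touched G)).image fun z => s(z.1, z.2)) (by positivity) ?_)
  · obtain ⟨i, hi, φ, hφ, -, he, hadj⟩ := exists_closing hσ
    refine ⟨i, hi, ?_⟩
    rw [he]
    refine Finset.mem_image.2 ⟨(φ (Fin.last _), φ 0), ?_, rfl⟩
    obtain ⟨c, h0, hl, -, hc⟩ := walk_of_cycle hadj
    simp only [Finset.mem_product, touched, Finset.mem_filter, Finset.mem_univ, true_and]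
    rw [← h0, ← hl]
    exact ⟨⟨_, (hc (L + 1) (by omega)).symm⟩, ⟨_, hc 0 (by omega)⟩⟩
  · intro s hs σ
    have h1 : (touched (builderGraph f.rule σ s)).card ≤ 2 * b :=
      (card_touched_le _).trans (Nat.mul_le_mul_left 2 (f.budget σ s hs.le))
    have h2 := (Finset.card_image_le (s := (touched (builderGraph f.rule σ s)) ×ˢ
      (touched (builderGraph f.rule σ s))) (f := fun z => s(z.1, z.2)))
    rw [Finset.card_product, ← pow_two] at h2
    calc _ ≤ (((touched (builderGraph f.rule σ s)).card ^ 2 : ℕ) : ℝ) := by exact_mod_cast h2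
      _ ≤ _ := by
        push_cast
        gcongr
        exact_mod_cast h1

/-- Some cycle of presented edges has a vertex with more than `Δ` presented edges. -/
def HeavyCycle (L : ℕ) (σ : EdgeOrder n) (t Δ : ℕ) : Prop :=
  ∃ φ : Fin (L + 3) → Fin n, Function.Injective φ ∧ (∀ x, Shown σ t s(φ x, φ (x + 1))) ∧
    ∃ x, Δ < shownDeg σ t (φ x)

/-- Outside the two bad events all vertices of the cycle are light and Builder's graph is degenerate
when the cycle closes. The closing edge must then hit one of the few pairs joined by a light walk
with `L + 2` edges. -/
theorem prContains_cycle_le_light {t b k Δ : ℕ} (f : DetStrategy n t b) (ht : 2 * t ≤ n.choose 2)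
    (hL : L + 2 ≤ 2 * k + 1) (hΔ : 1 ≤ Δ) :
    prContains (SimpleGraph.cycleGraph (L + 3)) f.rule t ≤
      pr n (fun σ => HeavyCycle L σ t Δ) + pr n (fun σ => ¬ Sparse σ t (2 * b)) +
      2 * t * (2 * b * (4 ^ (L + 2) * Δ ^ k)) / n.choose 2 := by
  classical
  -- The set is declared empty on histories that are not sparse, so that its size bound holds for
  -- every order, as `pr_hit_le` demands.
  set A : ℕ → EdgeOrder n → Finset (Sym2 (Fin n)) := fun s σ =>
    if Sparse σ s (2 * b) then joined (lightGraph (builderGraph f.rule σ s) σ s Δ) (L + 2) else ∅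
    with hA
  have hhist : ∀ s, Hist s (A s) := by
    intro s σ σ' H
    have h1 := hist_builderGraph f.rule s σ σ' H
    have h2 := hist_shown s σ σ' H
    simp only at h1 h2
    simp only [hA, sparse_congr h2, lightGraph, shownDeg_congr h2, h1]
  have hhit := pr_hit_le ht A hhist (K := 2 * b * (4 ^ (L + 2) * Δ ^ k)) (by positivity) (by
    intro s hs σ
    by_cases hS : Sparse σ s (2 * b)
    · have := card_joined_lightGraph_le (f.budget σ s hs.le) (by omega : 1 ≤ L + 2) hL hΔ hS
      simp only [hA, hS, if_true]
      exact_mod_cast this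
    · simp only [hA, hS, if_false, Finset.card_empty, Nat.cast_zero]
      positivity)
  refine (pr_mono (F := fun σ => (HeavyCycle L σ t Δ ∨ ¬ Sparse σ t (2 * b)) ∨
    ∃ i : Fin (n.choose 2), (i : ℕ) < t ∧ (σ i : Sym2 (Fin n)) ∈ A i σ) ?_).trans
    ((pr_or_le _ _).trans (add_le_add (pr_or_le _ _) hhit))
  intro σ hσ
  by_contra! hcon
  obtain ⟨⟨hheavy, hsparse⟩, hno⟩ := hcon
  obtain ⟨i, hi, φ, hφ, hall, he, hadj⟩ := exists_closing hσ
  apply hno i hi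
  -- Both good events are imposed at time `t` and inherited by the earlier time `i`, because
  -- presented edges only accumulate.
  have hsp : Sparse σ i (2 * b) := fun S h1 h2 =>
    (shownIn_mono σ hi.le S).trans_lt (hsparse S h1 h2)
  have hlight : ∀ x, shownDeg σ i (φ x) ≤ Δ := by
    intro x
    by_contra! hx
    exact hheavy ⟨φ, hφ, fun x => shown_of_adj (hall x), x,
      hx.trans_le (shownDeg_mono σ hi.le _)⟩
  simp only [hA, hsp, if_true, joined, Finset.mem_filter, Finset.mem_univ, true_and]
  obtain ⟨c, h0, hl, hx, hc⟩ := walk_of_cycle hadj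
  refine ⟨c, ?_, fun j hj => ⟨hc j hj, ?_, ?_⟩⟩
  · rw [he, h0, hl]
    exact Sym2.eq_swap
  · obtain ⟨x, hx⟩ := hx j
    rw [hx]
    exact hlight x
  · obtain ⟨x, hx⟩ := hx (j + 1)
    rw [hx]
    exact hlight x

end Lower

/-! ### First moment bounds for heavy cycles and dense spots. -/

section Estimates

variable {n : ℕ} {L : ℕ}

lemma choose_le_exp_pow (M s : ℕ) (hs : 1 ≤ s) :
    (M.choose s : ℝ) ≤ (Real.exp 1 * M / s) ^ s := by
  have hs' : (0 : ℝ) < s := by exact_mod_cast hs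
  have h1 : (M.choose s : ℝ) ≤ (M : ℝ) ^ s / (s.factorial : ℝ) := Nat.choose_le_pow_div s M
  have h2 := Real.pow_div_factorial_le_exp (s : ℝ) hs'.le s
  have h3 : (Real.exp 1) ^ s = Real.exp s := by rw [← Real.exp_nat_mul, mul_one]
  have hf : (0 : ℝ) < s.factorial := by exact_mod_cast s.factorial_pos
  calc (M.choose s : ℝ) ≤ (M : ℝ) ^ s / s.factorial := h1
    _ = ((M : ℝ) / s) ^ s * ((s : ℝ) ^ s / s.factorial) := by
        rw [div_pow]
        field_simp
    _ ≤ ((M : ℝ) / s) ^ s * Real.exp s := by gcongr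
    _ = _ := by rw [← h3, ← mul_pow]; ring

lemma exp_one_cube_le : (Real.exp 1) ^ 3 ≤ 32 := by
  have h := Real.exp_one_lt_d9
  calc (Real.exp 1) ^ 3 ≤ 3 ^ 3 := by
        gcongr
        linarith
    _ ≤ 32 := by norm_num

/-- Union bound over a cycle, one of its vertices and `r` further neighbours. A degree above `r + 1`
leaves at least `r` presented edges after discarding those to the two neighbours on the cycle, so `L
+ 3 + r` distinct edges must have been presented. -/
theorem pr_heavyCycle_le {t : ℕ} (ht : t ≤ n.choose 2) (r : ℕ) :
    pr n (fun σ => HeavyCycle L σ t (r + 1)) ≤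
      (L + 3) * ((n : ℝ) ^ (L + 3) * n.choose r) * ((t : ℝ) / n.choose 2) ^ (L + 3 + r) := by
  classical
  set I : Finset ((Fin (L + 3) → Fin n) × Fin (L + 3) × Finset (Fin n)) :=
    (Finset.univ ×ˢ Finset.univ ×ˢ Finset.powersetCard r Finset.univ).filter fun z =>
      Function.Injective z.1 ∧ z.1 (z.2.1 + 1) ∉ z.2.2 ∧ z.1 (z.2.1 - 1) ∉ z.2.2 with hI
  have h := pr_exists_le_card_mul (n := n) I
    (fun z σ => ∀ e ∈ (Finset.univ.image fun i => s(z.1 i, z.1 (i + 1))) ∪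
      z.2.2.image fun w => s(z.1 z.2.1, w), Shown σ t e)
    (c := ((t : ℝ) / n.choose 2) ^ (L + 3 + r)) (fun z hz => by
      refine (pr_shown_le ht _).trans (le_of_eq ?_)
      obtain ⟨φ, x, R⟩ := z
      simp only [hI, Finset.mem_filter, Finset.mem_product, Finset.mem_univ, true_and,
        Finset.mem_powersetCard, Finset.subset_univ] at hz
      obtain ⟨hR, hφ, h1, h2⟩ := hz
      congr 1
      rw [Finset.card_union_of_disjoint, Finset.card_image_of_injective _ (cycle_edge_injective hφ),
        Finset.card_image_of_injective, hR]
      · simp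
      · intro a b hab
        exact Sym2.congr_right.1 hab
      · rw [Finset.disjoint_left]
        intro e he he'
        obtain ⟨i, -, rfl⟩ := Finset.mem_image.1 he
        obtain ⟨w, hw, hwe⟩ := Finset.mem_image.1 he'
        simp only [Sym2.eq_iff] at hwe
        rcases hwe with ⟨h3, rfl⟩ | ⟨h3, rfl⟩
        · rw [hφ h3] at h1
          exact h1 hw
        · rw [hφ h3, add_sub_cancel_right] at h2
          exact h2 hw)
  have hcard : (I.card : ℝ) ≤ (L + 3) * ((n : ℝ) ^ (L + 3) * n.choose r) := by
    have : I.card ≤ n ^ (L + 3) * ((L + 3) * n.choose r) := by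
      refine (Finset.card_filter_le _ _).trans (le_of_eq ?_)
      rw [Finset.card_product, Finset.card_product, Finset.card_powersetCard, Finset.card_univ,
        Finset.card_univ, Finset.card_univ, Fintype.card_fun, Fintype.card_fin, Fintype.card_fin]
    calc (I.card : ℝ) ≤ ((n ^ (L + 3) * ((L + 3) * n.choose r) : ℕ) : ℝ) := by exact_mod_cast this
      _ = _ := by push_cast; ring
  refine (pr_mono ?_).trans (h.trans (mul_le_mul_of_nonneg_right hcard (by positivity)))
  rintro σ ⟨φ, hφ, hsh, x, hx⟩
  set W : Finset (Fin n) := ((Finset.univ.filter fun w => Shown σ t s(φ x, w)).erase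
    (φ (x + 1))).erase (φ (x - 1)) with hW
  have hWc : r ≤ W.card := by
    have h1 := Finset.pred_card_le_card_erase
      (s := Finset.univ.filter fun w => Shown σ t s(φ x, w)) (a := φ (x + 1))
    have h2 := Finset.pred_card_le_card_erase
      (s := (Finset.univ.filter fun w => Shown σ t s(φ x, w)).erase (φ (x + 1))) (a := φ (x - 1))
    have h3 : r + 1 < (Finset.univ.filter fun w => Shown σ t s(φ x, w)).card := by
      refine hx.trans_le (le_of_eq ?_)
      unfold shownDeg
      congr!
    rw [← hW] at h2
    omega
  obtain ⟨R, hRW, hR⟩ := Finset.exists_subset_card_eq hWc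
  refine ⟨(φ, x, R), ?_, ?_⟩
  · simp only [hI, Finset.mem_filter, Finset.mem_product, Finset.mem_univ, true_and,
      Finset.mem_powersetCard, Finset.subset_univ]
    refine ⟨hR, hφ, fun h1 => ?_, fun h1 => ?_⟩
    · have := hRW h1
      simp [hW] at this
    · have := hRW h1
      simp [hW] at this
  · intro e he
    rcases Finset.mem_union.1 he with he | he
    · obtain ⟨i, -, rfl⟩ := Finset.mem_image.1 he
      exact hsh i
    · obtain ⟨w, hw, rfl⟩ := Finset.mem_image.1 he
      have := hRW hw
      simp only [hW, Finset.mem_erase, Finset.mem_filter] at this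
      exact this.2.2.2

/-- Heavy cycles are unlikely if `r` is much larger than the average degree. -/
theorem pr_heavyCycle_le_div {t r : ℕ} (ht : t ≤ n.choose 2) (hr : 0 < r) {M : ℝ} (hM : 8 ≤ M)
    (hrM : M * (n * ((t : ℝ) / n.choose 2)) ≤ r) :
    pr n (fun σ => HeavyCycle L σ t (r + 1)) ≤ (L + 3) * (L + 3).factorial / M := by
  set x : ℝ := n * ((t : ℝ) / n.choose 2) with hx
  have hx0 : 0 ≤ x := by positivity
  have hr' : (0 : ℝ) < r := by exact_mod_cast hr
  have hM0 : 0 < M := by linarith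
  refine (pr_heavyCycle_le ht r).trans ?_
  have h1 := choose_le_exp_pow n r hr
  -- This is the source of `8 ≤ M`: one factor e comes from the binomial coefficient and the other
  -- makes the power decay like `exp (-r)`.
  have he : Real.exp 1 ^ 2 ≤ 8 := by
    have h := Real.exp_one_lt_d9
    calc (Real.exp 1) ^ 2 ≤ 2.72 ^ 2 := by
          gcongr
          linarith
      _ ≤ 8 := by norm_num
  have h2 : (Real.exp 1 * x / r) ^ r ≤ Real.exp (-r) := by
    have : Real.exp 1 * x / r ≤ Real.exp (-1) := by
      rw [div_le_iff₀ hr', Real.exp_neg, ← div_eq_inv_mul, le_div_iff₀ (Real.exp_pos 1)]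
      calc Real.exp 1 * x * Real.exp 1 = Real.exp 1 ^ 2 * x := by ring
        _ ≤ M * x := by gcongr; linarith
        _ ≤ r := hrM
    calc _ ≤ (Real.exp (-1)) ^ r := by gcongr
      _ = _ := by rw [← Real.exp_nat_mul]; simp
  -- The expected number of cycles, of order `x ^ (L + 3)`, is at most `(r / M) ^ (L + 3)`, and `exp
  -- (-r)` absorbs the power of `r` at the cost of a factorial.
  have h3 : x ^ (L + 3) * Real.exp (-r) ≤ (L + 3).factorial / M := by
    have h4 := Real.pow_div_factorial_le_exp (r : ℝ) hr'.le (L + 3)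
    have hf : (0 : ℝ) < (L + 3).factorial := by exact_mod_cast (L + 3).factorial_pos
    rw [Real.exp_neg, ← div_eq_mul_inv, div_le_div_iff₀ (Real.exp_pos _) hM0]
    have h5 : (M * x) ^ (L + 3) ≤ (r : ℝ) ^ (L + 3) := by gcongr
    rw [div_le_iff₀ hf] at h4
    rw [mul_pow] at h5
    have h6 : M ≤ M ^ (L + 3) := le_self_pow₀ (by linarith) (by omega)
    have h7 : M * x ^ (L + 3) ≤ M ^ (L + 3) * x ^ (L + 3) := by gcongr
    linarith
  calc _ ≤ (L + 3) * ((n : ℝ) ^ (L + 3) * (Real.exp 1 * n / r) ^ r) *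
          ((t : ℝ) / n.choose 2) ^ (L + 3 + r) := by gcongr
    _ = (L + 3) * (x ^ (L + 3) * (Real.exp 1 * x / r) ^ r) := by
        rw [hx, pow_add, mul_pow, show Real.exp 1 * (n * ((t : ℝ) / n.choose 2)) / r =
          Real.exp 1 * n / r * ((t : ℝ) / n.choose 2) by ring, mul_pow]
        ring
    _ ≤ (L + 3) * (x ^ (L + 3) * Real.exp (-r)) := by gcongr
    _ ≤ (L + 3) * ((L + 3).factorial / M) := by gcongr
    _ = _ := by ring

/-- A union bound over sets of size s and over 2s of the pairs inside them gives at most (e³ n s p²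
/ 16) ^ s, where p is the edge density. As e³ ≤ 32, this is at most `β ^ s`, and the geometric
series adds up to at most `2 * β`. -/
theorem pr_not_sparse_le {t B : ℕ} (ht : t ≤ n.choose 2) {β : ℝ}
    (hβ : 2 * n * B * ((t : ℝ) / n.choose 2) ^ 2 ≤ β) (hβ2 : β ≤ 1 / 2) :
    pr n (fun σ => ¬ Sparse σ t B) ≤ 2 * β := by
  classical
  set p : ℝ := (t : ℝ) / n.choose 2 with hp
  have hβ0 : 0 ≤ β := le_trans (by positivity) hβ
  have hsize : ∀ s ∈ Finset.Icc 1 B,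
      pr n (fun σ => ∃ S ∈ Finset.powersetCard s (Finset.univ : Finset (Fin n)),
        2 * S.card ≤ shownIn σ t S) ≤ β ^ s := by
    intro s hs
    rw [Finset.mem_Icc] at hs
    have hs0 : (0 : ℝ) < s := by exact_mod_cast hs.1
    have hS : ∀ S ∈ Finset.powersetCard s (Finset.univ : Finset (Fin n)),
        pr n (fun σ => 2 * S.card ≤ shownIn σ t S) ≤
          ((s.choose 2).choose (2 * s) : ℕ) * p ^ (2 * s) := by
      intro S hS
      have hSc := (Finset.mem_powersetCard.1 hS).2
      have h := pr_exists_le_card_mul (n := n)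
        (Finset.powersetCard (2 * s) (S.offDiag.image fun z => s(z.1, z.2)))
        (fun T σ => ∀ e ∈ T, Shown σ t e) (c := p ^ (2 * s)) (fun T hT => by
          refine (pr_shown_le ht _).trans (le_of_eq ?_)
          rw [(Finset.mem_powersetCard.1 hT).2])
      rw [Finset.card_powersetCard, show (fun z : Fin n × Fin n => s(z.1, z.2)) = Sym2.mk.uncurry
        from rfl, Sym2.card_image_offDiag, hSc] at h
      refine (pr_mono ?_).trans h
      intro σ hσ
      rw [hSc] at hσ
      obtain ⟨T, hT, hTc⟩ := Finset.exists_subset_card_eq hσ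
      refine ⟨T, Finset.mem_powersetCard.2 ⟨?_, hTc⟩, fun e he => (Finset.mem_filter.1 (hT he)).2⟩
      intro e he
      obtain ⟨h1, h2⟩ := Finset.mem_filter.1 (hT he)
      induction e using Sym2.ind with
      | _ a b =>
        rw [Finset.mk_mem_sym2_iff] at h1
        have := h2.not_isDiag
        simp only [Sym2.mk_isDiag_iff] at this
        exact Finset.mem_image.2 ⟨(a, b), Finset.mem_offDiag.2 ⟨h1.1, h1.2, this⟩, rfl⟩
    refine (pr_exists_le_card_mul _ _ hS).trans ?_
    rw [Finset.card_powersetCard, Finset.card_univ, Fintype.card_fin]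
    have h1 := choose_le_exp_pow n s hs.1
    have h2 := choose_le_exp_pow (s.choose 2) (2 * s) (by omega)
    have h3 : Real.exp 1 * (s.choose 2 : ℕ) / ((2 * s : ℕ) : ℝ) ≤ Real.exp 1 * s / 4 := by
      rw [Nat.cast_choose_two]
      push_cast
      rw [div_le_div_iff₀ (by positivity) (by norm_num)]
      have : Real.exp 1 * (s * (s - 1) / 2) * 4 = Real.exp 1 * s * (2 * s) - Real.exp 1 * (2 * s) := by
        ring
      rw [this]
      have : 0 < Real.exp 1 * (2 * (s : ℝ)) := by positivity
      linarith
    calc (n.choose s : ℝ) * (((s.choose 2).choose (2 * s) : ℕ) * p ^ (2 * s))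
        ≤ (Real.exp 1 * n / s) ^ s * ((Real.exp 1 * s / 4) ^ (2 * s) * p ^ (2 * s)) := by
          gcongr
          exact h2.trans (by gcongr)
      _ = ((Real.exp 1) ^ 3 * (n * s * p ^ 2) / 16) ^ s := by
          rw [pow_mul, pow_mul, ← mul_pow, ← mul_pow]
          congr 1
          field_simp
          ring
      _ ≤ (32 * (n * B * p ^ 2) / 16) ^ s := by
          have hsB : (s : ℝ) ≤ B := by exact_mod_cast hs.2
          gcongr
          exact exp_one_cube_le
      _ ≤ β ^ s := by
          refine pow_le_pow_left₀ (by positivity) ?_ _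
          linarith
  have h := pr_exists_le (Finset.Icc 1 B) (fun (s : ℕ) (σ : EdgeOrder n) =>
    ∃ S ∈ Finset.powersetCard s (Finset.univ : Finset (Fin n)), 2 * S.card ≤ shownIn σ t S)
  refine (pr_mono ?_).trans (h.trans ((Finset.sum_le_sum hsize).trans ?_))
  · intro σ hσ
    unfold Sparse at hσ
    push Not at hσ
    obtain ⟨S, hne, hB, hS⟩ := hσ
    exact ⟨S.card, Finset.mem_Icc.2 ⟨Finset.card_pos.2 hne, hB⟩, S,
      Finset.mem_powersetCard.2 ⟨Finset.subset_univ _, rfl⟩, hS⟩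
  · calc ∑ s ∈ Finset.Icc 1 B, β ^ s = ∑ s ∈ Finset.range B, β ^ (s + 1) := by
          rw [Finset.range_eq_Ico, Finset.sum_Ico_add' (fun s => β ^ s) 0 B 1]
          rfl
      _ ≤ ∑ s ∈ Finset.range B, β * (1 / 2) ^ s := by
          refine Finset.sum_le_sum fun s _ => ?_
          rw [pow_succ']
          gcongr
      _ ≤ β * 2 := by
          rw [← Finset.mul_sum]
          gcongr
          exact sum_geometric_two_le B
      _ = _ := by ring

end Estimates

/-! ### Impossibility below the thresholds. -/

section LowerBound

variable {n : ℕ} {L k : ℕ}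

lemma mul_density_le (hn : 2 ≤ n) (t : ℕ) :
    n * ((t : ℝ) / n.choose 2) ≤ 4 * (t / n) := by
  have h := two_le_pairs n hn
  have hn' : (0 : ℝ) < n := by exact_mod_cast (by omega : 0 < n)
  have hN : (0 : ℝ) < n.choose 2 := lt_of_lt_of_le (by positivity) h
  rw [← mul_div_assoc, ← mul_div_assoc, div_le_div_iff₀ hN hn']
  have : (t : ℝ) * (n ^ 2 / 4) ≤ t * n.choose 2 := by gcongr
  nlinarith

lemma prContains_cycle_le_of_few_edges (hn : 2 ≤ n) (f : Rule n) {t : ℕ} (ht : t ≤ n.choose 2)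
    {c : ℝ} (hc : c ≤ 1 / 4) (htc : (t : ℝ) ≤ c * n) :
    prContains (SimpleGraph.cycleGraph (L + 3)) f t ≤ 4 * c := by
  have hn' : (0 : ℝ) < n := by exact_mod_cast (by omega : 0 < n)
  have h1 := mul_density_le hn t
  have h2 : (t : ℝ) / n ≤ c := by rwa [div_le_iff₀ hn']
  refine (prContains_cycle_le_pow f ht).trans ?_
  refine (pow_le_of_le_one (by positivity) (by linarith) (by omega)).trans (by linarith)

/-- A budget below `δ * n / √t` makes `t * b ^ 2 / n ^ 2` small, which is the order of the bound in
`prContains_cycle_le_sq`. -/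
lemma prContains_cycle_le_of_budget_sqrt (hn : 2 ≤ n) {t b : ℕ} (f : DetStrategy n t b)
    (hb : 1 ≤ b) {δ : ℝ} (hδ0 : 0 ≤ δ) (hδ : δ ≤ 1 / 4) (h : (b : ℝ) ≤ δ * (n / Real.sqrt t)) :
    prContains (SimpleGraph.cycleGraph (L + 3)) f.rule t ≤ 32 * δ := by
  have hn' : (0 : ℝ) < n := by exact_mod_cast (by omega : 0 < n)
  have hN := two_le_pairs n hn
  have hN0 : (0 : ℝ) < n.choose 2 := lt_of_lt_of_le (by positivity) hN
  have hb' : (1 : ℝ) ≤ b := by exact_mod_cast hb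
  -- For `t = 0` the quotient `n / √t` has the value 0, so the budget would have to vanish, contrary
  -- to `1 ≤ b`.
  have ht0 : 0 < t := by
    by_contra h0
    obtain rfl : t = 0 := by omega
    simp only [Nat.cast_zero, Real.sqrt_zero, div_zero, mul_zero] at h
    linarith
  have ht' : (0 : ℝ) < t := by exact_mod_cast ht0
  have hs := Real.sqrt_pos.2 ht'
  have hsq := Real.sq_sqrt ht'.le
  rw [mul_div_assoc', le_div_iff₀ hs] at h
  have h2 : (b : ℝ) ^ 2 * t ≤ δ ^ 2 * n ^ 2 := by
    calc (b : ℝ) ^ 2 * t = (b * Real.sqrt t) ^ 2 := by rw [mul_pow, hsq]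
      _ ≤ (δ * n) ^ 2 := by gcongr
      _ = _ := by ring
  have h2t : (t : ℝ) ≤ b ^ 2 * t := le_mul_of_one_le_left ht'.le (one_le_pow₀ hb')
  have hδ2 : δ ^ 2 ≤ 1 / 16 := by nlinarith
  -- A budget of at least one edge below the threshold forces `t ≤ n ^ 2 / 16`, so the condition of
  -- `pr_hit_le` comes for free.
  have h3 : 2 * t ≤ n.choose 2 := by
    have : (2 : ℝ) * t ≤ n.choose 2 := by nlinarith [sq_nonneg (n : ℝ)]
    exact_mod_cast this
  refine (prContains_cycle_le_sq f h3).trans ?_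
  rw [div_le_iff₀ hN0]
  calc 2 * (t : ℝ) * (2 * b) ^ 2 = 8 * (b ^ 2 * t) := by ring
    _ ≤ 8 * (δ ^ 2 * n ^ 2) := by gcongr
    _ = 32 * δ ^ 2 * (n ^ 2 / 4) := by ring
    _ ≤ 32 * δ * n.choose 2 := by
        gcongr
        nlinarith

/-- The three summands bound heavy cycles, failure of sparsity, and a hit on a light closing pair.
The degree cap is a constant multiple of the average degree `t / n`; the constant `M` keeps heavy
cycles unlikely even when `t` is only linear in `n`. -/
lemma prContains_cycle_le_of_budget_pow (hn : 2 ≤ n) (hk : 1 ≤ k) (hL : L + 2 ≤ 2 * k + 1)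
    {t b : ℕ} (f : DetStrategy n t b) (ht : 2 * t ≤ n.choose 2) {c M δ : ℝ} (hc : 0 < c)
    (hM : 8 ≤ M) (htc : c * n ≤ t) (hb : b * ((t : ℝ) / n) ^ (k + 1) ≤ δ * n)
    (hβ : 64 * δ / c ^ (k - 1) ≤ 1 / 2) :
    prContains (SimpleGraph.cycleGraph (L + 3)) f.rule t ≤
      (L + 3) * (L + 3).factorial / M + 2 * (64 * δ / c ^ (k - 1)) +
        16 * 4 ^ (L + 2) * (4 * M + 2 / c) ^ k * δ := by
  have hn' : (0 : ℝ) < n := by exact_mod_cast (by omega : 0 < n)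
  have hN := two_le_pairs n hn
  have hN0 : (0 : ℝ) < n.choose 2 := lt_of_lt_of_le (by positivity) hN
  have ht' : (0 : ℝ) < t := lt_of_lt_of_le (by positivity) htc
  set D : ℝ := (t : ℝ) / n with hD
  have hD0 : 0 < D := by positivity
  have hcD : c ≤ D := by rwa [hD, le_div_iff₀ hn']
  have hx := mul_density_le hn t
  rw [← hD] at hx
  set p : ℝ := (t : ℝ) / n.choose 2 with hp
  have hp0 : 0 < p := by positivity
  -- The cap is the rounded-up multiple `M` of `n * p`; the rounding and the extra 1 are paid for by
  -- `2 / c * D`, as `c ≤ D`.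
  have hr : 0 < ⌈M * (n * p)⌉₊ := Nat.ceil_pos.2 (by positivity)
  set r := ⌈M * (n * p)⌉₊ with hrdef
  have h1 := pr_heavyCycle_le_div (n := n) (L := L) (t := t) (by omega) hr hM (Nat.le_ceil _)
  have hΔ : ((r + 1 : ℕ) : ℝ) ≤ (4 * M + 2 / c) * D := by
    have h3 := (Nat.ceil_lt_add_one (by positivity : 0 ≤ M * (n * p))).le
    have h4 : M * (n * p) ≤ M * (4 * D) := by gcongr
    have h5 : 1 ≤ D / c := by rwa [one_le_div hc]
    push_cast
    calc (r : ℝ) + 1 ≤ M * (4 * D) + 2 * (D / c) := by linarith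
      _ = _ := by ring
  -- Sparsity needs `b * D ^ 2` small compared with `n`, while the hypothesis controls `b * D ^ (k +
  -- 1)`; for `k ≥ 1` and `c ≤ D` the latter suffices.
  have hpow : D ^ 2 * c ^ (k - 1) ≤ D ^ (k + 1) := by
    calc D ^ 2 * c ^ (k - 1) ≤ D ^ 2 * D ^ (k - 1) := by gcongr
      _ = D ^ (k + 1) := by rw [← pow_add]; congr 1; omega
  have hE2 : 2 * (n : ℝ) * ((2 * b : ℕ) : ℝ) * p ^ 2 ≤ 64 * δ / c ^ (k - 1) := by
    rw [le_div_iff₀ (by positivity)]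
    have h3 : (n * p) ^ 2 ≤ (4 * D) ^ 2 := by gcongr
    have h4 : (b : ℝ) * (D ^ 2 * c ^ (k - 1)) ≤ δ * n := le_trans (by gcongr) hb
    have h5 : 4 * b * (n * p) ^ 2 * c ^ (k - 1) ≤ 64 * δ * n := by
      calc 4 * b * (n * p) ^ 2 * c ^ (k - 1) ≤ 4 * b * (4 * D) ^ 2 * c ^ (k - 1) := by gcongr
        _ = 64 * (b * (D ^ 2 * c ^ (k - 1))) := by ring
        _ ≤ 64 * (δ * n) := by gcongr
        _ = _ := by ring
    push_cast
    have h6 : n * (2 * n * (2 * b) * p ^ 2 * c ^ (k - 1)) ≤ n * (64 * δ) := by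
      calc _ = 4 * b * (n * p) ^ 2 * c ^ (k - 1) := by ring
        _ ≤ 64 * δ * n := h5
        _ = _ := by ring
    exact le_of_mul_le_mul_left h6 hn'
  have h2 := pr_not_sparse_le (n := n) (by omega : t ≤ n.choose 2) hE2 hβ
  have h := prContains_cycle_le_light f ht hL (by omega : 1 ≤ r + 1)
  refine h.trans (add_le_add (add_le_add h1 h2) ?_)
  calc 2 * (t : ℝ) * (2 * b * (4 ^ (L + 2) * ((r + 1 : ℕ) : ℝ) ^ k)) / n.choose 2
      = 4 * 4 ^ (L + 2) * ((r + 1 : ℕ) : ℝ) ^ k * b * (n * p) / n := by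
        rw [hp]
        field_simp
        ring
    _ ≤ 4 * 4 ^ (L + 2) * ((4 * M + 2 / c) * D) ^ k * b * (4 * D) / n := by gcongr
    _ = 16 * 4 ^ (L + 2) * (4 * M + 2 / c) ^ k * (b * D ^ (k + 1)) / n := by
        rw [mul_pow]
        ring
    _ ≤ 16 * 4 ^ (L + 2) * (4 * M + 2 / c) ^ k * (δ * n) / n := by gcongr
    _ = _ := by field_simp

lemma eventually_mul_le (A : ℝ) {e : ℝ} (he : 0 < e) : ∀ᶠ δ in 𝓝[>] (0 : ℝ), A * δ ≤ e := by
  have h : Tendsto (fun δ : ℝ => A * δ) (𝓝[>] 0) (𝓝 0) := by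
    have : Tendsto (fun δ : ℝ => A * δ) (𝓝 0) (𝓝 (A * 0)) := by
      exact (continuous_const.mul continuous_id).tendsto 0
    rw [mul_zero] at this
    exact this.mono_left nhdsWithin_le_nhds
  exact (h.eventually (gt_mem_nhds he)).mono fun _ h => h.le

/-- Below the thresholds, cycles are unlikely. -/
theorem prContains_cycle_small (hk : 1 ≤ k) (hL : L + 2 ≤ 2 * k + 1) (η : ℝ) (hη : 0 < η) :
    ∃ δ : ℝ, 0 < δ ∧ ∃ n₀ : ℕ, ∀ n ≥ n₀, ∀ t b : ℕ, t ≤ n.choose 2 →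
      ((t : ℝ) ≤ δ * n ∨ (b : ℝ) ≤ δ * bStar k n t) →
      ∀ f : DetStrategy n t b, prContains (SimpleGraph.cycleGraph (L + 3)) f.rule t ≤ η := by
  -- The constant `c` separates two regimes: up to `c * n` edges the first moment bound suffices,
  -- and beyond it `t / n` is bounded below, as the degeneracy bound requires.
  obtain ⟨c, hc0, hc1, hc2⟩ : ∃ c : ℝ, 0 < c ∧ c ≤ 1 / 4 ∧ 4 * c ≤ η :=
    ⟨min (1 / 4) (η / 4), by positivity, min_le_left _ _, by
      have := min_le_right (1 / 4 : ℝ) (η / 4); linarith⟩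
  obtain ⟨M, hM8, hM⟩ : ∃ M : ℝ, 8 ≤ M ∧ (L + 3) * (L + 3).factorial / M ≤ η / 3 := by
    refine ⟨max 8 ((L + 3) * (L + 3).factorial / (η / 3)), le_max_left _ _, ?_⟩
    rw [div_le_comm₀ (lt_of_lt_of_le (by norm_num : (0 : ℝ) < 8) (le_max_left _ _)) (by positivity)]
    exact le_max_right _ _
  have hev : ∀ᶠ δ in 𝓝[>] (0 : ℝ), 0 < δ ∧ 1 * δ ≤ c ∧ 32 * δ ≤ η ∧ 1 * δ ≤ 1 / 4 ∧
      8 ^ (k + 1) * δ ≤ 1 / 2 ∧ (64 / c ^ (k - 1)) * δ ≤ 1 / 2 ∧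
      (128 / c ^ (k - 1)) * δ ≤ η / 3 ∧
      (16 * 4 ^ (L + 2) * (4 * M + 2 / c) ^ k) * δ ≤ η / 3 :=
    (eventually_mem_nhdsWithin.mono fun _ h => h).and ((eventually_mul_le _ hc0).and
      ((eventually_mul_le _ hη).and ((eventually_mul_le _ (by norm_num)).and
      ((eventually_mul_le _ (by norm_num)).and ((eventually_mul_le _ (by norm_num)).and
      ((eventually_mul_le _ (by positivity)).and (eventually_mul_le _ (by positivity))))))))
  obtain ⟨δ, hδ0, hδc, hδη, hδ4, hδ8, hδβ, hδβ', hδK⟩ := hev.exists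
  rw [one_mul] at hδc hδ4
  refine ⟨δ, hδ0, 2, fun n hn t b ht hor f => ?_⟩
  have hn' : (2 : ℝ) ≤ n := by exact_mod_cast hn
  have hn0 : (0 : ℝ) < n := by linarith
  rcases le_or_gt (t : ℝ) (c * n) with htc | htc
  · exact (prContains_cycle_le_of_few_edges hn f.rule ht hc1 htc).trans hc2
  have ht' : (0 : ℝ) < t := lt_trans (by positivity) htc
  rcases hor with hor | hor
  · have : δ * n ≤ c * n := by gcongr
    linarith
  rcases Nat.eq_zero_or_pos b with hb | hb
  · rw [prContains, pr_eq_zero]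
    · exact hη.le
    · intro σ hσ
      obtain ⟨φ, -, hφ⟩ := (isContained_cycleGraph_iff _).1 hσ
      have h1 := (f.budget σ t le_rfl).trans hb.le
      rw [Nat.le_zero, Set.ncard_eq_zero] at h1
      have h2 := (SimpleGraph.mem_edgeSet _).2 (hφ 0)
      rw [h1] at h2
      exact h2
  unfold bStar at hor
  rcases le_total ((n : ℝ) / Real.sqrt t) ((n : ℝ) ^ (k + 2) / (t : ℝ) ^ (k + 1)) with hle | hle
  · rw [max_eq_left hle] at hor
    have hb1 : (1 : ℝ) ≤ b := by exact_mod_cast hb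
    have hbt : b * (t : ℝ) ^ (k + 1) ≤ δ * (n : ℝ) ^ (k + 2) := by
      rwa [mul_div_assoc', le_div_iff₀ (by positivity)] at hor
    -- Otherwise `t` exceeds `n ^ 2 / 8`, and then the threshold `n ^ (k + 2) / t ^ (k + 1)` is at
    -- most `8 ^ (k + 1)`; the choice of `δ` leaves no room for even a single edge.
    have h2t : 2 * t ≤ n.choose 2 := by
      by_contra! hlt
      have h1 : ((n.choose 2 : ℕ) : ℝ) < 2 * t := by exact_mod_cast hlt
      have h2 := two_le_pairs n hn
      have h3 : (n : ℝ) ^ 2 / 8 ≤ t := by linarith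
      have h4 : ((n : ℝ) ^ 2 / 8) ^ (k + 1) ≤ δ * (n : ℝ) ^ (k + 2) := by
        calc _ ≤ (t : ℝ) ^ (k + 1) := by gcongr
          _ ≤ b * (t : ℝ) ^ (k + 1) := le_mul_of_one_le_left (by positivity) hb1
          _ ≤ _ := hbt
      rw [div_pow, div_le_iff₀ (by positivity), ← pow_mul] at h4
      have h5 : (n : ℝ) ^ (k + 2) * 1 ≤ (n : ℝ) ^ (2 * (k + 1)) := by
        rw [mul_one]
        exact pow_le_pow_right₀ (by linarith) (by omega)
      have h6 : (0 : ℝ) < (n : ℝ) ^ (k + 2) := by positivity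
      nlinarith
    refine (prContains_cycle_le_of_budget_pow hn hk hL f h2t hc0 hM8 htc.le (δ := δ) ?_ ?_).trans ?_
    · rw [div_pow, mul_div_assoc', div_le_iff₀ (by positivity)]
      calc _ ≤ _ := hbt
        _ = _ := by ring
    · rwa [← div_mul_eq_mul_div]
    · have : 2 * (64 * δ / c ^ (k - 1)) = (128 / c ^ (k - 1)) * δ := by ring
      linarith
  · rw [max_eq_right hle] at hor
    exact (prContains_cycle_le_of_budget_sqrt hn f hb hδ0.le hδ4 hor).trans hδη

end LowerBound

/-! ### Growing a layered forest: plans and their invariants. -/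

/-- The data of Builder's strategy for short cycles. Starting from the roots `R`, a forest is grown
in `h + 1` stages of `τ` time steps each: in stage `j` the vertices of `A j` that were reached
receive up to `d j` new neighbours in `W j`. The number of those vertices is at most `c j`.
After that, an edge that closes a cycle of length `L + 3` is purchased. -/
structure Plan (n : ℕ) where
  L : ℕ
  h : ℕ
  τ : ℕ
  R : Finset (Fin n)
  A : ℕ → Finset (Fin n)
  W : ℕ → Finset (Fin n)
  d : ℕ → ℕ
  c : ℕ → ℕ
  disjoint_W : ∀ i j, i ≠ j → Disjoint (W i) (W j)
  -- A vertex that can be a parent in stage `i` is never a fresh child in that or a later stage, so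
  -- by the beginning of its stage it is settled whether it is reached.
  disjoint_A : ∀ i j, i ≤ j → Disjoint (A i) (W j)
  R_subset : R ⊆ A 0
  -- The summand `A 0` is there for even cycles, where the roots grow again in stage 1.
  A_succ_subset : ∀ j, A (j + 1) ⊆ A 0 ∪ W j
  W_subset : ∀ j, W j ⊆ A (j + 1)
  card_R_le : R.card ≤ c 0
  c_succ : ∀ j, (R ∩ A (j + 1)).card + d j * c j ≤ c (j + 1)

/-- `G` contains a cycle of length `L + 3`. -/
abbrev HasCycle {V : Type*} (L : ℕ) (G : SimpleGraph V) : Prop :=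
  (SimpleGraph.cycleGraph (L + 3)).IsContained G

namespace Plan

variable {n : ℕ} (P : Plan n)

/-- The vertex `v` was reached: it is a root or is not isolated. -/
def Act (G : SimpleGraph (Fin n)) (v : Fin n) : Prop :=
  v ∈ P.R ∨ ∃ u, G.Adj v u

open Classical in
/-- The neighbours of `v` in `W j`. -/
noncomputable def children (G : SimpleGraph (Fin n)) (j : ℕ) (v : Fin n) : Finset (Fin n) :=
  (P.W j).filter fun u => G.Adj v u

/-- In stage `j`, Builder purchases an edge that joins a vertex of `A j` that was reached, and has
fewer than `d j` children, with an isolated vertex of `W j`. -/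
def GrowPair (j : ℕ) (G : SimpleGraph (Fin n)) (v w : Fin n) : Prop :=
  v ∈ P.A j ∧ w ∈ P.W j ∧ P.Act G v ∧ (∀ u, ¬ G.Adj w u) ∧ (P.children G j v).card < P.d j

/-- The rule of the growth stage `j`. -/
def GrowRule (j : ℕ) (e : Sym2 (Fin n)) (G : SimpleGraph (Fin n)) : Prop :=
  ∃ v w, e = s(v, w) ∧ P.GrowPair j G v w

open Classical in
/-- Builder's rule. -/
noncomputable def rule : Rule n := fun i e G =>
  if i < (P.h + 1) * P.τ then P.GrowRule (i / P.τ) e G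
  else ¬ HasCycle P.L G ∧ HasCycle P.L (G ⊔ SimpleGraph.fromEdgeSet {e})

open Classical in
/-- The vertices of the sets `W i` that are not isolated. -/
noncomputable def reachedChildren (G : SimpleGraph (Fin n)) : Finset (Fin n) :=
  Finset.univ.filter fun w => (∃ i, w ∈ P.W i) ∧ ∃ u, G.Adj w u

/-- The properties of Builder's graph during stage `j`. -/
structure Inv (j : ℕ) (G : SimpleGraph (Fin n)) : Prop where
  layered : ∀ a b, G.Adj a b → ∃ i ≤ j, (a ∈ P.A i ∧ b ∈ P.W i) ∨ (b ∈ P.A i ∧ a ∈ P.W i)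
  parent_unique : ∀ i w v v', w ∈ P.W i → v ∈ P.A i → v' ∈ P.A i → G.Adj v w → G.Adj v' w → v = v'
  children_le : ∀ i v, v ∈ P.A i → (P.children G i v).card ≤ P.d i
  root : ∀ v u, v ∈ P.A 0 → G.Adj v u → v ∈ P.R
  exists_parent : ∀ i w u, w ∈ P.W i → G.Adj w u → ∃ v ∈ P.A i, G.Adj v w
  card_edges : G.edgeSet.ncard ≤ (P.reachedChildren G).card

variable {P}

lemma Inv.mono {j j' : ℕ} (h : j ≤ j') {G : SimpleGraph (Fin n)} (hG : P.Inv j G) :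
    P.Inv j' G :=
  { hG with
    layered := fun a b hab => by
      obtain ⟨i, hi, h'⟩ := hG.layered a b hab
      exact ⟨i, hi.trans h, h'⟩ }

lemma inv_bot (P : Plan n) (j : ℕ) : P.Inv j ⊥ where
  layered := by simp
  parent_unique := by simp
  children_le := by simp [children]
  root := by simp
  exists_parent := by simp
  card_edges := by simp

lemma notMem_W_of_mem_A {i j : ℕ} (h : i ≤ j) {v : Fin n} (hv : v ∈ P.A i) : v ∉ P.W j :=
  Finset.disjoint_left.1 (P.disjoint_A i j h) hv

lemma eq_of_mem_W {i j : ℕ} {v : Fin n} (hi : v ∈ P.W i) (hj : v ∈ P.W j) : i = j := by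
  by_contra h
  exact Finset.disjoint_left.1 (P.disjoint_W i j h) hi hj

/-- An edge of stage `j` does not go from `A i` to `W i` for `i ≠ j`, in either direction. -/
lemma edge_stage {i j : ℕ} {v w a b : Fin n} (hv : v ∈ P.A j) (hw : w ∈ P.W j)
    (ha : a ∈ P.A i) (hb : b ∈ P.W i) (h : s(v, w) = s(a, b)) : i = j ∧ a = v ∧ b = w := by
  rcases Sym2.eq_iff.1 h with ⟨rfl, rfl⟩ | ⟨rfl, rfl⟩
  · exact ⟨eq_of_mem_W hb hw, rfl, rfl⟩
  · exfalso
    rcases le_total i j with hij | hij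
    · exact notMem_W_of_mem_A hij ha hw
    · exact notMem_W_of_mem_A hij hv hb

lemma Inv.step {j : ℕ} {G G' : SimpleGraph (Fin n)} (hG : P.Inv j G) {v w : Fin n}
    (hg : P.GrowPair j G v w)
    (hadj : ∀ a b, G'.Adj a b ↔ G.Adj a b ∨ s(v, w) = s(a, b)) : P.Inv j G' := by
  classical
  obtain ⟨hvA, hwW, hact, hiso, hlt⟩ := hg
  have hvw : G'.Adj v w := (hadj v w).2 (Or.inr rfl)
  constructor
  · intro a b hab
    rcases (hadj a b).1 hab with h | h
    · exact hG.layered a b h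
    · rcases Sym2.eq_iff.1 h with ⟨rfl, rfl⟩ | ⟨rfl, rfl⟩
      · exact ⟨j, le_rfl, Or.inl ⟨hvA, hwW⟩⟩
      · exact ⟨j, le_rfl, Or.inr ⟨hvA, hwW⟩⟩
  · intro i x a a' hx ha ha' h h'
    rcases (hadj _ _).1 h with h | h <;> rcases (hadj _ _).1 h' with h' | h'
    · exact hG.parent_unique i x a a' hx ha ha' h h'
    · obtain ⟨rfl, rfl, rfl⟩ := edge_stage hvA hwW ha' hx h'
      exact absurd h.symm (hiso a)
    · obtain ⟨rfl, rfl, rfl⟩ := edge_stage hvA hwW ha hx h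
      exact absurd h'.symm (hiso a')
    · rw [(edge_stage hvA hwW ha hx h).2.1, (edge_stage hvA hwW ha' hx h').2.1]
  · intro i a ha
    by_cases h : i = j ∧ a = v
    · obtain ⟨rfl, rfl⟩ := h
      have : P.children G' i a ⊆ insert w (P.children G i a) := by
        intro x hx
        simp only [children, Finset.mem_filter, Finset.mem_insert] at hx ⊢
        rcases (hadj _ _).1 hx.2 with h | h
        · exact Or.inr ⟨hx.1, h⟩
        · exact Or.inl (edge_stage hvA hwW ha hx.1 h).2.2
      have := (Finset.card_le_card this).trans (Finset.card_insert_le _ _)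
      omega
    · refine (Finset.card_le_card ?_).trans (hG.children_le i a ha)
      intro x hx
      simp only [children, Finset.mem_filter] at hx ⊢
      refine ⟨hx.1, ((hadj _ _).1 hx.2).resolve_right fun h' => ?_⟩
      have := edge_stage hvA hwW ha hx.1 h'
      exact h ⟨this.1, this.2.1⟩
  · intro a u ha h
    rcases (hadj _ _).1 h with h | h
    · exact hG.root a u ha h
    · rcases Sym2.eq_iff.1 h with ⟨rfl, rfl⟩ | ⟨rfl, rfl⟩
      · rcases hact with h1 | ⟨u, h1⟩
        · exact h1
        · exact hG.root _ u ha h1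
      · exact absurd hwW (notMem_W_of_mem_A (Nat.zero_le _) ha)
  · intro i x u hx h
    have hold : ∀ u, G.Adj x u → ∃ a ∈ P.A i, G'.Adj a x := fun u hu => by
      obtain ⟨a, ha, hax⟩ := hG.exists_parent i x u hx hu
      exact ⟨a, ha, (hadj _ _).2 (Or.inl hax)⟩
    rcases (hadj _ _).1 h with h | h
    · exact hold u h
    · rcases Sym2.eq_iff.1 h with ⟨rfl, rfl⟩ | ⟨rfl, rfl⟩
      · rcases hact with h1 | ⟨u, h1⟩
        · exact absurd hx (notMem_W_of_mem_A (Nat.zero_le _) (P.R_subset h1))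
        · exact hold u h1
      · rw [eq_of_mem_W hx hwW]
        exact ⟨_, hvA, hvw⟩
  · have h1 : G'.edgeSet ⊆ insert s(v, w) G.edgeSet := by
      intro e he
      induction e using Sym2.ind with
      | _ a b =>
        rcases (hadj a b).1 he with h | h
        · exact Or.inr h
        · exact Or.inl h.symm
    -- The new edge is charged to its child `w`, which was isolated before; this keeps the number of
    -- edges at most the number of reached children.
    have h2 : insert w (P.reachedChildren G) ⊆ P.reachedChildren G' := by
      intro x hx
      simp only [reachedChildren, Finset.mem_insert, Finset.mem_filter, Finset.mem_univ,
        true_and] at hx ⊢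
      rcases hx with rfl | ⟨hx, u, hu⟩
      · exact ⟨⟨j, hwW⟩, v, hvw.symm⟩
      · exact ⟨hx, u, (hadj _ _).2 (Or.inl hu)⟩
    have h3 : w ∉ P.reachedChildren G := by
      simp only [reachedChildren, Finset.mem_filter, Finset.mem_univ, true_and, not_and,
        not_exists]
      exact fun _ u => hiso u
    calc G'.edgeSet.ncard ≤ (insert s(v, w) G.edgeSet).ncard :=
          Set.ncard_le_ncard h1 (Set.toFinite _)
      _ ≤ G.edgeSet.ncard + 1 := Set.ncard_insert_le _ _
      _ ≤ (P.reachedChildren G).card + 1 := Nat.add_le_add_right hG.card_edges 1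
      _ = (insert w (P.reachedChildren G)).card := (Finset.card_insert_of_notMem h3).symm
      _ ≤ _ := Finset.card_le_card h2

lemma rule_grow {s j : ℕ} (h1 : j * P.τ ≤ s) (h2 : s < (j + 1) * P.τ) (hj : j ≤ P.h)
    (e : Sym2 (Fin n)) (G : SimpleGraph (Fin n)) : P.rule s e G ↔ P.GrowRule j e G := by
  have hlt : s < (P.h + 1) * P.τ := h2.trans_le (Nat.mul_le_mul_right _ (by omega))
  have hdiv : s / P.τ = j := Nat.div_eq_of_lt_le h1 h2
  simp [rule, hlt, hdiv]

/-- A step of stage `j`. -/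
lemma step_cases (σ : EdgeOrder n) {s j : ℕ} (h1 : j * P.τ ≤ s) (h2 : s < (j + 1) * P.τ)
    (hj : j ≤ P.h) : builderGraph P.rule σ (s + 1) = builderGraph P.rule σ s ∨
      ∃ v w, P.GrowPair j (builderGraph P.rule σ s) v w ∧
        ∀ a b, (builderGraph P.rule σ (s + 1)).Adj a b ↔
          (builderGraph P.rule σ s).Adj a b ∨ s(v, w) = s(a, b) := by
  by_cases hb : ∃ h : s < n.choose 2,
      P.rule s (σ ⟨s, h⟩ : Sym2 (Fin n)) (builderGraph P.rule σ s)
  · obtain ⟨h, hr⟩ := hb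
    right
    obtain ⟨v, w, he, hg⟩ := (rule_grow h1 h2 hj _ _).1 hr
    refine ⟨v, w, hg, fun a b => ?_⟩
    rw [builderGraph_succ_adj]
    refine or_congr_right ⟨fun ⟨_, h', _⟩ => he ▸ h', fun h' => ⟨h, he.trans h', hr⟩⟩
  · left
    ext a b
    rw [builderGraph_succ_adj]
    refine or_iff_left ?_
    rintro ⟨h, -, hr⟩
    exact hb ⟨h, hr⟩

lemma inv_builderGraph (σ : EdgeOrder n) {s j : ℕ} (h2 : s ≤ (j + 1) * P.τ)
    (hj : j ≤ P.h) : P.Inv j (builderGraph P.rule σ s) := by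
  induction s generalizing j with
  | zero => exact inv_bot P j
  | succ s ih =>
    have hτ : 0 < P.τ := Nat.pos_of_ne_zero fun h0 => by simp [h0] at h2
    have h3 : s < (s / P.τ + 1) * P.τ := by
      rw [mul_comm]
      exact Nat.lt_mul_div_succ s hτ
    have h4 : s / P.τ ≤ j := Nat.lt_succ_iff.1 ((Nat.div_lt_iff_lt_mul hτ).2 h2)
    -- The stage in force at step `s` is `s / P.τ`; the invariant is propagated there and then
    -- weakened to `j`.
    have hi := ih h3.le (h4.trans hj)
    refine Inv.mono h4 ?_
    rcases step_cases σ (Nat.div_mul_le_self s P.τ) h3 (h4.trans hj) with h | ⟨v, w, hg, h⟩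
    · rwa [h]
    · exact hi.step hg h

end Plan

/-! ### Budget and success of the growth stages. -/

namespace Plan

variable {n : ℕ} {P : Plan n}

open Classical in
/-- The vertices of `S` that are not isolated. -/
noncomputable def touchedIn (G : SimpleGraph (Fin n)) (S : Finset (Fin n)) : Finset (Fin n) :=
  S.filter fun v => ∃ u, G.Adj v u

lemma Inv.isolated {i j : ℕ} {G : SimpleGraph (Fin n)} (hG : P.Inv j G) (hij : j < i) {w : Fin n}
    (hw : w ∈ P.W i) (u : Fin n) : ¬ G.Adj w u := by
  intro h
  obtain ⟨l, hl, ⟨h1, -⟩ | ⟨-, h1⟩⟩ := hG.layered w u h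
  · exact notMem_W_of_mem_A (by omega) h1 hw
  · exact absurd (eq_of_mem_W hw h1) (by omega)

/-- Every reached vertex of `W j` has a parent in `A j`, and each parent has at most `P.d j`
children. -/
lemma Inv.card_touchedIn_W_le {l j : ℕ} {G : SimpleGraph (Fin n)} (hG : P.Inv l G)
    (h : (touchedIn G (P.A j)).card ≤ P.c j) :
    (touchedIn G (P.W j)).card ≤ P.d j * P.c j := by
  classical
  have hsub : touchedIn G (P.W j) ⊆ (touchedIn G (P.A j)).biUnion fun v => P.children G j v := by
    intro w hw
    simp only [touchedIn, Finset.mem_filter] at hw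
    obtain ⟨hw, u, hu⟩ := hw
    obtain ⟨v, hv, hvw⟩ := hG.exists_parent j w u hw hu
    refine Finset.mem_biUnion.2 ⟨v, ?_, ?_⟩
    · simp only [touchedIn, Finset.mem_filter]
      exact ⟨hv, w, hvw⟩
    · simp only [children, Finset.mem_filter]
      exact ⟨hw, hvw⟩
  refine (Finset.card_le_card hsub).trans
    ((Finset.card_biUnion_le_card_mul _ _ (P.d j) fun v hv => ?_).trans ?_)
  · simp only [touchedIn, Finset.mem_filter] at hv
    exact hG.children_le j v hv.1
  · rw [mul_comm]
    exact Nat.mul_le_mul_left _ h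

lemma Inv.card_touchedIn_A_le {l : ℕ} {G : SimpleGraph (Fin n)} (hG : P.Inv l G) (j : ℕ) :
    (touchedIn G (P.A j)).card ≤ P.c j := by
  classical
  induction j with
  | zero =>
    refine (Finset.card_le_card ?_).trans P.card_R_le
    intro v hv
    simp only [touchedIn, Finset.mem_filter] at hv
    obtain ⟨hv, u, hu⟩ := hv
    exact hG.root v u hv hu
  | succ j ih =>
    have hsub : touchedIn G (P.A (j + 1)) ⊆ (P.R ∩ P.A (j + 1)) ∪ touchedIn G (P.W j) := by
      intro v hv
      simp only [touchedIn, Finset.mem_filter, Finset.mem_union, Finset.mem_inter] at hv ⊢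
      obtain ⟨hv, u, hu⟩ := hv
      rcases Finset.mem_union.1 (P.A_succ_subset j hv) with h | h
      · exact Or.inl ⟨hG.root v u h hu, hv⟩
      · exact Or.inr ⟨h, u, hu⟩
    refine (Finset.card_le_card hsub).trans ((Finset.card_union_le _ _).trans ?_)
    exact (Nat.add_le_add_left (hG.card_touchedIn_W_le ih) _).trans (P.c_succ j)

lemma Inv.card_edges_le {G : SimpleGraph (Fin n)} (hG : P.Inv P.h G) :
    G.edgeSet.ncard ≤ ∑ j ∈ Finset.range (P.h + 1), P.d j * P.c j := by
  classical
  have hsub : P.reachedChildren G ⊆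
      (Finset.range (P.h + 1)).biUnion fun j => touchedIn G (P.W j) := by
    intro w hw
    simp only [reachedChildren, Finset.mem_filter, Finset.mem_univ, true_and] at hw
    obtain ⟨⟨i, hi⟩, u, hu⟩ := hw
    refine Finset.mem_biUnion.2 ⟨i, ?_, ?_⟩
    · rw [Finset.mem_range]
      by_contra h
      exact hG.isolated (by omega) hi u hu
    · simp only [touchedIn, Finset.mem_filter]
      exact ⟨hi, u, hu⟩
  refine hG.card_edges.trans ((Finset.card_le_card hsub).trans
    (Finset.card_biUnion_le.trans (Finset.sum_le_sum fun j _ => ?_)))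
  exact hG.card_touchedIn_W_le (hG.card_touchedIn_A_le j)

/-- After the growth stages, Builder's graph does not change before it contains a cycle. -/
lemma closing_cases (σ : EdgeOrder n) {s : ℕ} (hs : (P.h + 1) * P.τ ≤ s) :
    builderGraph P.rule σ s = builderGraph P.rule σ ((P.h + 1) * P.τ) ∨
      HasCycle P.L (builderGraph P.rule σ s) ∧ (builderGraph P.rule σ s).edgeSet.ncard ≤
        (builderGraph P.rule σ ((P.h + 1) * P.τ)).edgeSet.ncard + 1 := by
  induction s, hs using Nat.le_induction with
  | base => exact Or.inl rfl
  | succ s hs ih =>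
    by_cases hb : ∃ h : s < n.choose 2,
        P.rule s (σ ⟨s, h⟩ : Sym2 (Fin n)) (builderGraph P.rule σ s)
    · obtain ⟨h, hr⟩ := hb
      have hstep : builderGraph P.rule σ (s + 1) = builderGraph P.rule σ s ⊔
          SimpleGraph.fromEdgeSet {(σ ⟨s, h⟩ : Sym2 (Fin n))} := by
        simp [builderGraph, h, hr]
      simp only [rule, not_lt.2 hs, if_false] at hr
      have heq := ih.resolve_right fun h' => hr.1 h'.1
      right
      rw [← heq, hstep]
      refine ⟨hr.2, ?_⟩
      refine le_trans (Set.ncard_le_ncard (t := insert (σ ⟨s, h⟩ : Sym2 (Fin n))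
        (builderGraph P.rule σ s).edgeSet) ?_ (Set.toFinite _)) (Set.ncard_insert_le _ _)
      rw [SimpleGraph.edgeSet_sup, SimpleGraph.edgeSet_fromEdgeSet]
      rintro e (he | he)
      · exact Or.inr he
      · exact Or.inl he.1
    · have hstep : builderGraph P.rule σ (s + 1) = builderGraph P.rule σ s := by
        ext a b
        rw [builderGraph_succ_adj]
        refine or_iff_left ?_
        rintro ⟨h, -, hr⟩
        exact hb ⟨h, hr⟩
      rwa [hstep]

variable (P) in
/-- The strategy of a plan. -/
noncomputable def strategy (t b : ℕ)
    (hb : ∑ j ∈ Finset.range (P.h + 1), P.d j * P.c j + 1 ≤ b) : DetStrategy n t b where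
  rule := P.rule
  budget := by
    intro σ s _
    have h0 := fun s (h : s ≤ (P.h + 1) * P.τ) =>
      -- The growth stages cost at most the sum of the `P.d j * P.c j`; afterwards at most one
      -- closing edge is bought, whence the extra 1 in the budget.
      (inv_builderGraph σ (j := P.h) h le_rfl).card_edges_le
    rcases le_total s ((P.h + 1) * P.τ) with h | h
    · have := h0 s h
      omega
    · have := h0 _ le_rfl
      rcases closing_cases σ h with h' | ⟨-, h'⟩
      · rw [h']
        omega
      · omega

lemma Act.mono {G G' : SimpleGraph (Fin n)} (h : G ≤ G') {v : Fin n} (hv : P.Act G v) :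
    P.Act G' v := hv.imp_right fun ⟨u, hu⟩ => ⟨u, h hu⟩

/-- Outside `W j`, a vertex can gain an edge in stage `j` only as a parent, and parents must have
been reached before. -/
lemma act_stage (σ : EdgeOrder n) {j : ℕ} (hj : j ≤ P.h) {v : Fin n} (hv : v ∉ P.W j) {s : ℕ}
    (h1 : j * P.τ ≤ s) (h2 : s ≤ (j + 1) * P.τ) (h : P.Act (builderGraph P.rule σ s) v) :
    P.Act (builderGraph P.rule σ (j * P.τ)) v := by
  induction s, h1 using Nat.le_induction with
  | base => exact h
  | succ s h1 ih =>
    refine ih (by omega) ?_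
    rcases step_cases σ h1 (by omega) hj with h' | ⟨a, w, hg, h'⟩
    · rwa [h'] at h
    · rcases h with h | ⟨u, hu⟩
      · exact Or.inl h
      · rcases (h' _ _).1 hu with h | h
        · exact Or.inr ⟨u, h⟩
        · rcases Sym2.eq_iff.1 h with ⟨rfl, rfl⟩ | ⟨rfl, rfl⟩
          · exact hg.2.2.1
          · exact absurd hg.2.1 hv

/-- By `disjoint_A`, a vertex of `A j` cannot become reached in stage `j` or later, so every finally
reached vertex had the whole of stage `j` to collect its children. -/
lemma act_back (σ : EdgeOrder n) {j : ℕ} {v : Fin n} (hv : v ∈ P.A j) (m : ℕ)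
    (hm : j + m ≤ P.h + 1) (h : P.Act (builderGraph P.rule σ ((j + m) * P.τ)) v) :
    P.Act (builderGraph P.rule σ (j * P.τ)) v := by
  induction m with
  | zero => simpa using h
  | succ m ih =>
    refine ih (by omega) (act_stage σ (by omega) (notMem_W_of_mem_A (by omega) hv) ?_ le_rfl h)
    exact Nat.mul_le_mul_right _ (by omega)

variable (P) in
/-- In stage `j`, the vertex `v` did not receive all its children. -/
def Fail (σ : EdgeOrder n) (j : ℕ) (v : Fin n) : Prop :=
  P.Act (builderGraph P.rule σ (j * P.τ)) v ∧
    (P.children (builderGraph P.rule σ ((j + 1) * P.τ)) j v).card < P.d j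

lemma children_mono {G G' : SimpleGraph (Fin n)} (h : G ≤ G') (j : ℕ) (v : Fin n) :
    P.children G j v ⊆ P.children G' j v := by
  intro w hw
  simp only [children, Finset.mem_filter] at hw ⊢
  exact ⟨hw.1, h hw.2⟩

lemma le_card_children (σ : EdgeOrder n) (hS : ∀ j ≤ P.h, ∀ v ∈ P.A j, ¬ P.Fail σ j v) {j : ℕ}
    (hj : j ≤ P.h) {v : Fin n} (hv : v ∈ P.A j)
    (h : P.Act (builderGraph P.rule σ ((P.h + 1) * P.τ)) v) :
    P.d j ≤ (P.children (builderGraph P.rule σ ((P.h + 1) * P.τ)) j v).card := by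
  have h1 := act_back σ hv (P.h + 1 - j) (by omega) (by rwa [Nat.add_sub_of_le (by omega)])
  by_contra! hlt
  refine hS j hj v hv ⟨h1, lt_of_le_of_lt (Finset.card_le_card ?_) hlt⟩
  exact children_mono (builderGraph_mono _ _ (Nat.mul_le_mul_right _ (by omega))) j v

open Classical in
/-- The pairs of `v` and an isolated vertex of `W j`. -/
noncomputable def targets (P : Plan n) (j : ℕ) (v : Fin n) (G : SimpleGraph (Fin n)) :
    Finset (Sym2 (Fin n)) :=
  ((P.W j).filter fun w => ∀ u, ¬ G.Adj w u).image fun w => s(v, w)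

/-- While `v` is short of children, every presented target edge is bought and produces a new child.
Hence a failing vertex has seen fewer than `P.d j` hits, which is what `pr_few_hits_le` makes
unlikely. -/
lemma hits_le_card_children (σ : EdgeOrder n) {j : ℕ} (hj : j ≤ P.h) {v : Fin n} (hv : v ∈ P.A j)
    (hact : P.Act (builderGraph P.rule σ (j * P.τ)) v) {s : ℕ} (h1 : j * P.τ ≤ s)
    (h2 : s ≤ (j + 1) * P.τ)
    (h : (P.children (builderGraph P.rule σ s) j v).card < P.d j) :
    hits (fun s σ => P.targets j v (builderGraph P.rule σ s)) σ (j * P.τ) s ≤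
      (P.children (builderGraph P.rule σ s) j v).card := by
  classical
  induction s, h1 using Nat.le_induction with
  | base =>
    have : ∀ s ≤ j * P.τ,
        hits (fun s σ => P.targets j v (builderGraph P.rule σ s)) σ (j * P.τ) s = 0 := by
      intro s hs
      induction s with
      | zero => rfl
      | succ s ih =>
        rw [hits, ih (by omega), if_neg]
        rintro ⟨-, h, -⟩
        omega
    rw [this _ le_rfl]
    exact Nat.zero_le _
  | succ s h1 ih =>
    have hmono := children_mono (P := P) (builderGraph_mono P.rule σ (Nat.le_succ s)) j v
    have hlt := (Finset.card_le_card hmono).trans_lt h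
    have ih := ih (by omega) hlt
    rw [hits]
    split_ifs with hhit
    · obtain ⟨hN, -, hmem⟩ := hhit
      obtain ⟨w, hw, he⟩ := Finset.mem_image.1 hmem
      rw [Finset.mem_filter] at hw
      have hr : P.rule s (σ ⟨s, hN⟩ : Sym2 (Fin n)) (builderGraph P.rule σ s) :=
        (rule_grow h1 (by omega) hj _ _).2 ⟨v, w, he.symm, hv, hw.1,
          hact.mono (builderGraph_mono _ _ h1), hw.2, hlt⟩
      have hnew : (builderGraph P.rule σ (s + 1)).Adj v w :=
        (builderGraph_succ_adj _ _ _ _ _).2 (Or.inr ⟨hN, he.symm, hr⟩)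
      refine (Nat.add_le_add_right ih 1).trans ?_
      refine Finset.card_lt_card (Finset.ssubset_iff_of_subset hmono |>.2 ⟨w, ?_, ?_⟩)
      · simp only [children, Finset.mem_filter]
        exact ⟨hw.1, hnew⟩
      · simp only [children, Finset.mem_filter, not_and]
        exact fun _ h' => hw.2 v h'.symm
    · exact ih.trans (Finset.card_le_card hmono)

/-- A given vertex is unlikely to fail in stage `j`, while it has few presented edges. -/
theorem pr_fail_le {j m : ℕ} (hj : j ≤ P.h) {v : Fin n} (hv : v ∈ P.A j) {q : ℝ} (hq1 : q ≤ 1)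
    (hq : q * n.choose 2 + (P.d j * P.c j : ℕ) + m ≤ (P.W j).card)
    (hτ : (j + 1) * P.τ ≤ n.choose 2) :
    pr n (fun σ => P.Fail σ j v ∧ shownDeg σ ((j + 1) * P.τ) v ≤ m) ≤
      2 ^ P.d j * Real.exp (-(q * P.τ / 2)) := by
  classical
  set A : ℕ → EdgeOrder n → Finset (Sym2 (Fin n)) := fun s σ =>
    P.targets j v (builderGraph P.rule σ s) with hA
  -- The event of failing so far, with few presented edges at `v`. It is declared true before the
  -- stage starts, which keeps it determined by the history and decreasing in time.
  set Good : ℕ → EdgeOrder n → Prop := fun s σ => s < j * P.τ ∨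
    (P.Act (builderGraph P.rule σ (j * P.τ)) v ∧
      (P.children (builderGraph P.rule σ s) j v).card < P.d j ∧
      shownDeg σ s v ≤ m ∧ s ≤ (j + 1) * P.τ) with hGood
  have hhist : ∀ s, Hist s (Good s) := by
    intro s
    rcases Nat.lt_or_ge s (j * P.τ) with h | h
    · intro σ σ' _
      simp [hGood, h]
    · intro σ σ' H
      have h1 := hist_builderGraph P.rule s σ σ' H
      have h2 := (hist_builderGraph P.rule (j * P.τ)).mono h σ σ' H
      have h3 := hist_shown s σ σ' H
      simp only at h1 h2 h3
      simp only [hGood, h1, h2, shownDeg_congr h3]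
  have h := pr_few_hits_le (n := n) (A := A) (Good := Good)
    (fun s => (hist_builderGraph P.rule s).comp (P.targets j v)) hhist (by
      rintro s σ (h | ⟨h1, h2, h3, h4⟩)
      · exact Or.inl (by omega)
      · refine Or.inr ⟨h1, ?_, (shownDeg_mono σ (Nat.le_succ s) v).trans h3, by omega⟩
        exact (Finset.card_le_card (children_mono (builderGraph_mono P.rule σ (Nat.le_succ s))
          j v)).trans_lt h2) hq1 (s₀ := j * P.τ) (by
      rintro s σ hs (h | ⟨h1, h2, h3, h4⟩)
      · omega
      set G := builderGraph P.rule σ s with hG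
      have hinv : P.Inv j G := inv_builderGraph σ h4 hj
      set S := (P.W j).filter fun w => (∀ u, ¬ G.Adj w u) ∧ ¬ Shown σ s s(v, w) with hS
      -- A vertex of `W j` is lost as a target only if it was already reached or if its pair with
      -- `v` was already presented.
      have hcard : (P.W j).card ≤ S.card + (P.d j * P.c j + m) := by
        have hsub : P.W j ⊆ S ∪ (touchedIn G (P.W j) ∪
            Finset.univ.filter fun w => Shown σ s s(v, w)) := by
          intro w hw
          simp only [hS, touchedIn, Finset.mem_union, Finset.mem_filter, hw, true_and,
            Finset.mem_univ]
          by_cases h5 : ∃ u, G.Adj w u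
          · exact Or.inr (Or.inl h5)
          · by_cases h6 : Shown σ s s(v, w)
            · exact Or.inr (Or.inr h6)
            · exact Or.inl ⟨not_exists.1 h5, h6⟩
        refine (Finset.card_le_card hsub).trans ((Finset.card_union_le _ _).trans
          (Nat.add_le_add_left ((Finset.card_union_le _ _).trans (Nat.add_le_add
          (hinv.card_touchedIn_W_le (hinv.card_touchedIn_A_le j)) ?_)) _))
        refine le_trans (le_of_eq ?_) h3
        unfold shownDeg
        congr!
      have hleft : S.card ≤ numLeft σ s (A s σ) := by
        rw [← Finset.card_image_of_injective S (f := fun w => s(v, w))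
          (fun a b hab => Sym2.congr_right.1 hab)]
        refine card_le_numLeft σ s _ _ ?_ ?_ ?_
        · refine Finset.image_subset_image fun w hw => ?_
          simp only [hS, Finset.mem_filter] at hw ⊢
          exact ⟨hw.1, hw.2.1⟩
        · intro e he
          obtain ⟨w, hw, rfl⟩ := Finset.mem_image.1 he
          simp only [hS, Finset.mem_filter] at hw
          rw [Sym2.mk_isDiag_iff]
          rintro rfl
          exact notMem_W_of_mem_A le_rfl hv hw.1
        · intro e he
          obtain ⟨w, hw, rfl⟩ := Finset.mem_image.1 he
          simp only [hS, Finset.mem_filter] at hw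
          exact hw.2.2
      have h5 : ((P.W j).card : ℝ) ≤ S.card + ((P.d j * P.c j : ℕ) + m) := by exact_mod_cast hcard
      have h6 : (S.card : ℝ) ≤ numLeft σ s (A s σ) := by exact_mod_cast hleft
      linarith) (τ := P.τ) (by rw [← Nat.succ_mul]; exact hτ) (P.d j)
  refine (pr_mono ?_).trans h
  rintro σ ⟨⟨h1, h2⟩, h3⟩
  have he : j * P.τ + P.τ = (j + 1) * P.τ := by ring
  rw [he]
  exact ⟨Or.inr ⟨h1, h2, h3, le_rfl⟩,
    (hits_le_card_children σ hj hv h1 (Nat.mul_le_mul_right _ (by omega)) le_rfl h2).trans h2.le⟩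

end Plan

/-! ### Maximum degree of the presented graph. -/

/-- No vertex has many presented edges. -/
theorem pr_exists_shownDeg_le {n T m : ℕ} (hT : T ≤ n.choose 2) :
    pr n (fun σ => ∃ v, m < shownDeg σ T v) ≤
      n * 2 ^ n * ((T : ℝ) / n.choose 2) ^ (m + 1) := by
  classical
  have h := pr_exists_le_card_mul (n := n)
    ((Finset.univ : Finset (Fin n)) ×ˢ Finset.powersetCard (m + 1) (Finset.univ : Finset (Fin n)))
    (fun z σ => ∀ e ∈ z.2.image fun w => s(z.1, w), Shown σ T e)
    (c := ((T : ℝ) / n.choose 2) ^ (m + 1)) (fun z hz => by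
      refine (pr_shown_le hT _).trans (le_of_eq ?_)
      rw [Finset.card_image_of_injective _ (fun a b hab => Sym2.congr_right.1 hab)]
      rw [Finset.mem_product, Finset.mem_powersetCard] at hz
      rw [hz.2.2])
  refine (pr_mono ?_).trans (h.trans (mul_le_mul_of_nonneg_right ?_ (by positivity)))
  · rintro σ ⟨v, hv⟩
    obtain ⟨S, hS, hSc⟩ := Finset.exists_subset_card_eq (Nat.succ_le_of_lt hv)
    refine ⟨(v, S), Finset.mem_product.2 ⟨Finset.mem_univ _,
      Finset.mem_powersetCard.2 ⟨Finset.subset_univ _, hSc⟩⟩, fun e he => ?_⟩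
    obtain ⟨w, hw, rfl⟩ := Finset.mem_image.1 he
    exact (Finset.mem_filter.1 (hS hw)).2
  · rw [Finset.card_product, Finset.card_powersetCard, Finset.card_univ, Fintype.card_fin]
    have := Nat.choose_le_two_pow n (m + 1)
    push_cast
    gcongr
    exact_mod_cast this

/-! ### Cycles assembled from two disjoint arms. -/

section Arms

variable {V : Type*} {G : SimpleGraph V}

lemma hasCycle_of_seq {L : ℕ} (ψ : ℕ → V) (hinj : ∀ i < L + 3, ∀ j < L + 3, ψ i = ψ j → i = j)
    (hadj : ∀ i < L + 2, G.Adj (ψ i) (ψ (i + 1))) (hlast : G.Adj (ψ (L + 2)) (ψ 0)) :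
    HasCycle L G := by
  refine (isContained_cycleGraph_iff G).2 ⟨fun i => ψ i, fun i j h => ?_, fun i => ?_⟩
  · exact Fin.ext (hinj i i.2 j j.2 h)
  · beta_reduce
    rw [Fin.val_add_one]
    split_ifs with h
    · subst h
      exact hlast
    · refine hadj i ?_
      have : (i : ℕ) ≠ L + 2 := fun h' => h (Fin.ext h')
      omega

/-- Two disjoint paths `c` and `c'` with `h` edges, followed by a vertex `x`. -/
def armSeq (c c' : ℕ → V) (x : V) (h i : ℕ) : V :=
  if i ≤ h then c i else if i ≤ 2 * h + 1 then c' (2 * h + 1 - i) else x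

variable {c c' : ℕ → V} {h : ℕ}

lemma armSeq_inj (x : V) (h1 : ∀ i ≤ h, ∀ j ≤ h, c i = c j → i = j)
    (h2 : ∀ i ≤ h, ∀ j ≤ h, c' i = c' j → i = j) (h3 : ∀ i ≤ h, ∀ j ≤ h, c i ≠ c' j) :
    ∀ i ≤ 2 * h + 1, ∀ j ≤ 2 * h + 1, armSeq c c' x h i = armSeq c c' x h j → i = j := by
  intro i hi j hj hij
  unfold armSeq at hij
  split_ifs at hij with a b b
  · exact h1 i a j b hij
  · exact absurd hij (h3 i a _ (by omega))
  · exact absurd hij.symm (h3 j b _ (by omega))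
  · have := h2 _ (by omega) _ (by omega) hij
    omega

lemma armSeq_adj (x : V) (h1 : ∀ i < h, G.Adj (c i) (c (i + 1)))
    (h2 : ∀ i < h, G.Adj (c' i) (c' (i + 1))) (h3 : G.Adj (c h) (c' h)) :
    ∀ i < 2 * h + 1, G.Adj (armSeq c c' x h i) (armSeq c c' x h (i + 1)) := by
  intro i hi
  unfold armSeq
  rcases Nat.lt_trichotomy i h with hlt | rfl | hgt
  · rw [if_pos (by omega), if_pos (by omega)]
    exact h1 i hlt
  · rw [if_pos le_rfl, if_neg (by omega), if_pos (by omega),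
      show 2 * i + 1 - (i + 1) = i by omega]
    exact h3
  · rw [if_neg (by omega), if_pos (by omega), if_neg (by omega), if_pos (by omega)]
    have := h2 (2 * h + 1 - (i + 1)) (by omega)
    rw [show 2 * h + 1 - (i + 1) + 1 = 2 * h + 1 - i by omega] at this
    exact this.symm

lemma hasCycle_of_arms_even {L : ℕ} (hL : L + 1 = 2 * h)
    (i1 : ∀ i ≤ h, ∀ j ≤ h, c i = c j → i = j)
    (i2 : ∀ i ≤ h, ∀ j ≤ h, c' i = c' j → i = j) (i3 : ∀ i ≤ h, ∀ j ≤ h, c i ≠ c' j)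
    (h1 : ∀ i < h, G.Adj (c i) (c (i + 1))) (h2 : ∀ i < h, G.Adj (c' i) (c' (i + 1)))
    (h3 : G.Adj (c h) (c' h)) (h0 : G.Adj (c' 0) (c 0)) : HasCycle L G := by
  -- The cycle has `2 * h + 2` vertices, so the final entry of `armSeq` is never visited and `c 0`
  -- is only a filler.
  refine hasCycle_of_seq (armSeq c c' (c 0) h) ?_ ?_ ?_
  · intro i hi j hj
    exact armSeq_inj _ i1 i2 i3 i (by omega) j (by omega)
  · intro i hi
    exact armSeq_adj _ h1 h2 h3 i (by omega)
  · rw [show L + 2 = 2 * h + 1 by omega]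
    simpa [armSeq, show ¬ (2 * h + 1 ≤ h) by omega] using h0

lemma hasCycle_of_arms_odd {x : V}
    (i1 : ∀ i ≤ h, ∀ j ≤ h, c i = c j → i = j)
    (i2 : ∀ i ≤ h, ∀ j ≤ h, c' i = c' j → i = j) (i3 : ∀ i ≤ h, ∀ j ≤ h, c i ≠ c' j)
    (i4 : ∀ i ≤ h, c i ≠ x) (i5 : ∀ i ≤ h, c' i ≠ x)
    (h1 : ∀ i < h, G.Adj (c i) (c (i + 1))) (h2 : ∀ i < h, G.Adj (c' i) (c' (i + 1)))
    (h3 : G.Adj (c h) (c' h)) (h0 : G.Adj x (c 0)) (h0' : G.Adj x (c' 0)) :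
    HasCycle (2 * h) G := by
  have hx : armSeq c c' x h (2 * h + 2) = x := by
    rw [armSeq, if_neg (by omega), if_neg (by omega)]
  have hne : ∀ i ≤ 2 * h + 1, armSeq c c' x h i ≠ x := by
    intro i hi
    unfold armSeq
    split_ifs with a
    · exact i4 i a
    · exact i5 _ (by omega)
  refine hasCycle_of_seq (armSeq c c' x h) ?_ ?_ ?_
  · intro i hi j hj hij
    rcases Nat.lt_or_ge i (2 * h + 2) with a | a <;> rcases Nat.lt_or_ge j (2 * h + 2) with b | b
    · exact armSeq_inj _ i1 i2 i3 i (by omega) j (by omega) hij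
    · obtain rfl : j = 2 * h + 2 := by omega
      exact absurd (hij.trans hx) (hne i (by omega))
    · obtain rfl : i = 2 * h + 2 := by omega
      exact absurd (hij.symm.trans hx) (hne j (by omega))
    · omega
  · intro i hi
    rcases Nat.lt_or_ge i (2 * h + 1) with a | a
    · exact armSeq_adj _ h1 h2 h3 i a
    · obtain rfl : i = 2 * h + 1 := by omega
      rw [hx]
      simpa [armSeq, show ¬ (2 * h + 1 ≤ h) by omega] using h0'.symm
  · rw [hx]
    simpa [armSeq] using h0

end Arms

/-! ### Trees below the vertices of `A 1` and the number of closing pairs. -/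

namespace Plan

variable {n : ℕ} (P : Plan n)

/-- The descendants of `u` in `W i`. -/
noncomputable def desc (G : SimpleGraph (Fin n)) (u : Fin n) : ℕ → Finset (Fin n)
  | 0 => {u}
  | i + 1 => (desc G u i).biUnion fun v => P.children G (i + 1) v

open Classical in
/-- The pairs of vertices of `W h` that close a cycle. -/
noncomputable def closingPairs (G : SimpleGraph (Fin n)) : Finset (Sym2 (Fin n)) :=
  Finset.univ.filter fun e => e ∈ (P.W P.h).sym2 ∧ ¬ e.IsDiag ∧
    HasCycle P.L (G ⊔ SimpleGraph.fromEdgeSet {e})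

variable {P} {G : SimpleGraph (Fin n)} {u u' w : Fin n}

lemma mem_children {j : ℕ} {v w : Fin n} :
    w ∈ P.children G j v ↔ w ∈ P.W j ∧ G.Adj v w := by
  simp [children]

lemma desc_succ_subset (i : ℕ) : P.desc G u (i + 1) ⊆ P.W (i + 1) := by
  intro w hw
  obtain ⟨v, -, hv⟩ := Finset.mem_biUnion.1 hw
  exact (mem_children.1 hv).1

lemma mem_A_of_mem_desc (hu : u ∈ P.A 1) {i : ℕ} (hw : w ∈ P.desc G u i) : w ∈ P.A (i + 1) := by
  cases i with
  | zero =>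
    rw [desc, Finset.mem_singleton] at hw
    rwa [hw]
  | succ i => exact P.W_subset _ (desc_succ_subset i hw)

lemma act_of_mem_desc (hu : P.Act G u) {i : ℕ} (hw : w ∈ P.desc G u i) : P.Act G w := by
  cases i with
  | zero =>
    rw [desc, Finset.mem_singleton] at hw
    rwa [hw]
  | succ i =>
    obtain ⟨v, -, hv⟩ := Finset.mem_biUnion.1 hw
    exact Or.inr ⟨v, (mem_children.1 hv).2.symm⟩

/-- The layers `W i` are pairwise disjoint, and a vertex of `A 1` lies in none of those with
positive index. -/
lemma level_unique (hu : u ∈ P.A 1) (hu' : u' ∈ P.A 1) {i j : ℕ} (h : w ∈ P.desc G u i)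
    (h' : w ∈ P.desc G u' j) : i = j := by
  cases i with
  | zero =>
    cases j with
    | zero => rfl
    | succ j =>
      rw [desc, Finset.mem_singleton] at h
      exact absurd (desc_succ_subset j h') (notMem_W_of_mem_A (by omega) (h ▸ hu))
  | succ i =>
    cases j with
    | zero =>
      rw [desc, Finset.mem_singleton] at h'
      exact absurd (desc_succ_subset i h) (notMem_W_of_mem_A (by omega) (h' ▸ hu'))
    | succ j => exact eq_of_mem_W (desc_succ_subset i h) (desc_succ_subset j h')

/-- Uniqueness of parents lets two lines of descent be traced back in step, so trees below different
vertices of `A 1` are disjoint. -/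
lemma root_unique {l : ℕ} (hG : P.Inv l G) (hu : u ∈ P.A 1) (hu' : u' ∈ P.A 1) {i : ℕ}
    (h : w ∈ P.desc G u i) (h' : w ∈ P.desc G u' i) : u = u' := by
  induction i generalizing w with
  | zero =>
    rw [desc, Finset.mem_singleton] at h h'
    rw [← h, h']
  | succ i ih =>
    have hw := desc_succ_subset i h
    obtain ⟨v, hv, hvw⟩ := Finset.mem_biUnion.1 h
    obtain ⟨v', hv', hvw'⟩ := Finset.mem_biUnion.1 h'
    have := hG.parent_unique (i + 1) w v v' hw (mem_A_of_mem_desc hu hv)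
      (mem_A_of_mem_desc hu' hv') (mem_children.1 hvw).2 (mem_children.1 hvw').2
    subst this
    exact ih hv hv'

lemma exists_chain {i : ℕ} (h : w ∈ P.desc G u i) :
    ∃ c : ℕ → Fin n, c 0 = u ∧ c i = w ∧ (∀ j < i, G.Adj (c j) (c (j + 1))) ∧
      ∀ j ≤ i, c j ∈ P.desc G u j := by
  induction i generalizing w with
  | zero =>
    rw [desc, Finset.mem_singleton] at h
    refine ⟨fun _ => u, rfl, h.symm, by simp, fun j hj => ?_⟩
    obtain rfl : j = 0 := by omega
    simp [desc]
  | succ i ih =>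
    obtain ⟨v, hv, hvw⟩ := Finset.mem_biUnion.1 h
    obtain ⟨c, h0, hi, hadj, hmem⟩ := ih hv
    refine ⟨fun j => if j ≤ i then c j else w, by simpa using h0, by simp, ?_, ?_⟩
    · intro j hj
      rcases Nat.lt_or_ge j i with h1 | h1
      · simp only [h1.le, if_true, Nat.succ_le_of_lt h1]
        exact hadj j h1
      · obtain rfl : j = i := by omega
        simp only [le_refl, if_true, show ¬ (j + 1 ≤ j) by omega, if_false, hi]
        exact (mem_children.1 hvw).2
    · intro j hj
      by_cases h1 : j ≤ i
      · simp only [h1, if_true]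
        exact hmem j h1
      · obtain rfl : j = i + 1 := by omega
        simp only [h1, if_false]
        exact h

variable {l d : ℕ} (hG : P.Inv l G)
  (hfull : ∀ j ≤ P.h, ∀ v ∈ P.A j, P.Act G v → P.d j ≤ (P.children G j v).card)

include hG hfull in
lemma pow_le_card_desc (hd : ∀ j, 1 ≤ j → j ≤ P.h → P.d j = d) (hu : u ∈ P.A 1)
    (hact : P.Act G u) {i : ℕ} (hi : i ≤ P.h) : d ^ i ≤ (P.desc G u i).card := by
  classical
  induction i with
  | zero => simp [desc]
  | succ i ih =>
    rw [desc, Finset.card_biUnion, pow_succ]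
    · calc d ^ i * d ≤ (P.desc G u i).card * d := Nat.mul_le_mul_right _ (ih (by omega))
        _ = ∑ _v ∈ P.desc G u i, d := by rw [Finset.sum_const, smul_eq_mul]
        _ ≤ _ := by
          refine Finset.sum_le_sum fun v hv => ?_
          rw [← hd (i + 1) (by omega) hi]
          exact hfull (i + 1) hi v (mem_A_of_mem_desc hu hv) (act_of_mem_desc hact hv)
    · intro v hv v' hv' hne
      rw [Function.onFun, Finset.disjoint_left]
      intro x hx hx'
      exact hne (hG.parent_unique (i + 1) x v v' (mem_children.1 hx).1 (mem_A_of_mem_desc hu hv)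
        (mem_A_of_mem_desc hu hv') (mem_children.1 hx).2 (mem_children.1 hx').2)

include hG hfull in
/-- Each pair of trees contributes the pairs of their leaves. -/
lemma card_closingPairs_ge (hd : ∀ j, 1 ≤ j → j ≤ P.h → P.d j = d)
    (Q : Finset (Fin n × Fin n))
    (hQ : ∀ z ∈ Q, z.1 ≠ z.2 ∧ (z.1 ∈ P.A 1 ∧ P.Act G z.1) ∧ (z.2 ∈ P.A 1 ∧ P.Act G z.2))
    (hW : ∀ z ∈ Q, P.desc G z.1 P.h ⊆ P.W P.h ∧ P.desc G z.2 P.h ⊆ P.W P.h)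
    (hcyc : ∀ z ∈ Q, ∀ a ∈ P.desc G z.1 P.h, ∀ b ∈ P.desc G z.2 P.h,
      HasCycle P.L (G ⊔ SimpleGraph.fromEdgeSet {s(a, b)})) :
    Q.card * (d ^ P.h * d ^ P.h) ≤ 2 * (P.closingPairs G).card := by
  classical
  set S := Q.biUnion fun z => P.desc G z.1 P.h ×ˢ P.desc G z.2 P.h with hS
  have h1 : Q.card * (d ^ P.h * d ^ P.h) ≤ S.card := by
    rw [hS, Finset.card_biUnion]
    · rw [← smul_eq_mul, ← Finset.sum_const]
      refine Finset.sum_le_sum fun z hz => ?_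
      obtain ⟨-, h1, h2⟩ := hQ z hz
      rw [Finset.card_product]
      exact Nat.mul_le_mul (pow_le_card_desc hG hfull hd h1.1 h1.2 le_rfl)
        (pow_le_card_desc hG hfull hd h2.1 h2.2 le_rfl)
    · intro z hz z' hz' hne
      rw [Function.onFun, Finset.disjoint_left]
      rintro ⟨a, b⟩ h h'
      rw [Finset.mem_product] at h h'
      exact hne (Prod.ext (root_unique hG (hQ z hz).2.1.1 (hQ z' hz').2.1.1 h.1 h'.1)
        (root_unique hG (hQ z hz).2.2.1 (hQ z' hz').2.2.1 h.2 h'.2))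
  -- Disjoint trees make all ordered pairs of leaves distinct; passing to unordered pairs costs the
  -- factor 2.
  refine h1.trans ((card_le_two_mul_card_image_mk S).trans (Nat.mul_le_mul_left 2 ?_))
  refine Finset.card_le_card fun e he => ?_
  obtain ⟨⟨a, b⟩, hab, rfl⟩ := Finset.mem_image.1 he
  obtain ⟨z, hz, hab⟩ := Finset.mem_biUnion.1 hab
  rw [Finset.mem_product] at hab
  simp only [closingPairs, Finset.mem_filter, Finset.mem_univ, true_and, Finset.mk_mem_sym2_iff]
  refine ⟨⟨(hW z hz).1 hab.1, (hW z hz).2 hab.2⟩, ?_, hcyc z hz a hab.1 b hab.2⟩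
  rw [Sym2.mk_isDiag_iff]
  intro heq
  have h2 : a ∈ P.desc G z.2 P.h := heq ▸ hab.2
  exact (hQ z hz).1 (root_unique hG (hQ z hz).2.1.1 (hQ z hz).2.2.1 hab.1 h2)

/-- The two arms that lead from a pair of half-roots to a pair of leaves. -/
lemma exists_arms (hG : P.Inv l G) (hu : u ∈ P.A 1) (hu' : u' ∈ P.A 1) (hne : u ≠ u') {h : ℕ}
    {a b : Fin n} (ha : a ∈ P.desc G u h) (hb : b ∈ P.desc G u' h) :
    ∃ c c' : ℕ → Fin n, c 0 = u ∧ c' 0 = u' ∧ c h = a ∧ c' h = b ∧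
      (∀ j < h, G.Adj (c j) (c (j + 1))) ∧ (∀ j < h, G.Adj (c' j) (c' (j + 1))) ∧
      (∀ j ≤ h, c j ∈ P.desc G u j) ∧ (∀ j ≤ h, c' j ∈ P.desc G u' j) ∧
      (∀ i ≤ h, ∀ j ≤ h, c i = c j → i = j) ∧ (∀ i ≤ h, ∀ j ≤ h, c' i = c' j → i = j) ∧
      (∀ i ≤ h, ∀ j ≤ h, c i ≠ c' j) := by
  obtain ⟨c, h0, h1, h2, h3⟩ := exists_chain ha
  obtain ⟨c', h0', h1', h2', h3'⟩ := exists_chain hb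
  refine ⟨c, c', h0, h0', h1, h1', h2, h2', h3, h3', ?_, ?_, ?_⟩
  · intro i hi j hj hij
    exact level_unique hu hu (h3 i hi) (hij ▸ h3 j hj)
  · intro i hi j hj hij
    exact level_unique hu' hu' (h3' i hi) (hij ▸ h3' j hj)
  · intro i hi j hj hij
    have e1 : c i ∈ P.desc G u' j := hij ▸ h3' j hj
    obtain rfl := level_unique hu hu' (h3 i hi) e1
    exact hne (root_unique hG hu hu' (h3 i hi) e1)

include hG hfull in
/-- The case of odd cycles. -/
theorem card_closingPairs_odd (hL : P.L = 2 * P.h) (hA : P.A 1 = P.W 0) (hd : ∀ j ≤ P.h, P.d j = d) :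
    P.R.card * (d * d - d) * (d ^ P.h * d ^ P.h) ≤ 2 * (P.closingPairs G).card := by
  classical
  -- Ordered pairs of distinct children of a common root: the root and the two arms below them form
  -- a path with `2 * h + 3` vertices.
  set Q := P.R.biUnion fun x => (P.children G 0 x).offDiag with hQdef
  have hmemQ : ∀ z ∈ Q, ∃ x ∈ P.R, (z.1 ∈ P.W 0 ∧ G.Adj x z.1) ∧ (z.2 ∈ P.W 0 ∧ G.Adj x z.2) ∧
      z.1 ≠ z.2 := by
    intro z hz
    obtain ⟨x, hx, hz⟩ := Finset.mem_biUnion.1 hz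
    rw [Finset.mem_offDiag, mem_children, mem_children] at hz
    exact ⟨x, hx, hz⟩
  have hQ : P.R.card * (d * d - d) ≤ Q.card := by
    rw [hQdef, Finset.card_biUnion, ← smul_eq_mul, ← Finset.sum_const]
    · refine Finset.sum_le_sum fun x hx => ?_
      have h := hfull 0 (Nat.zero_le _) x (P.R_subset hx) (Or.inl hx)
      rw [hd 0 (Nat.zero_le _)] at h
      rw [Finset.offDiag_card, ← Nat.mul_sub_one, ← Nat.mul_sub_one]
      exact Nat.mul_le_mul h (by omega)
    · intro x hx x' hx' hne
      rw [Function.onFun, Finset.disjoint_left]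
      rintro ⟨a, b⟩ h h'
      rw [Finset.mem_offDiag, mem_children] at h h'
      exact hne (hG.parent_unique 0 a x x' h.1.1 (P.R_subset hx) (P.R_subset hx') h.1.2 h'.1.2)
  refine (Nat.mul_le_mul_right _ hQ).trans
    (card_closingPairs_ge hG hfull (fun j _ => hd j) Q ?_ ?_ ?_)
  · intro z hz
    obtain ⟨x, -, h1, h2, h3⟩ := hmemQ z hz
    rw [hA]
    exact ⟨h3, ⟨h1.1, Or.inr ⟨x, h1.2.symm⟩⟩, ⟨h2.1, Or.inr ⟨x, h2.2.symm⟩⟩⟩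
  · intro z hz
    obtain ⟨x, -, h1, h2, h3⟩ := hmemQ z hz
    rcases Nat.eq_zero_or_pos P.h with h0 | h0
    · rw [h0, desc, desc]
      exact ⟨Finset.singleton_subset_iff.2 h1.1, Finset.singleton_subset_iff.2 h2.1⟩
    · obtain ⟨h, hh⟩ : ∃ h, P.h = h + 1 := ⟨P.h - 1, by omega⟩
      rw [hh]
      exact ⟨desc_succ_subset h, desc_succ_subset h⟩
  · intro z hz a ha b hb
    obtain ⟨x, hx, h1, h2, h3⟩ := hmemQ z hz
    have e1 : z.1 ∈ P.A 1 := hA ▸ h1.1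
    have e2 : z.2 ∈ P.A 1 := hA ▸ h2.1
    obtain ⟨c, c', c0, c0', ch, ch', cadj, cadj', cm, cm', i1, i2, i3⟩ :=
      exists_arms hG e1 e2 h3 ha hb
    have hle : G ≤ G ⊔ SimpleGraph.fromEdgeSet {s(a, b)} := le_sup_left
    have hxne : ∀ u ∈ P.A 1, ∀ j, x ∉ P.desc G u j := by
      intro u hu j hj
      have hxA := P.R_subset hx
      cases j with
      | zero =>
        rw [desc, Finset.mem_singleton] at hj
        exact notMem_W_of_mem_A le_rfl hxA (hA ▸ hj ▸ hu)
      | succ j => exact notMem_W_of_mem_A (Nat.zero_le _) hxA (desc_succ_subset j hj)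
    rw [hL]
    refine hasCycle_of_arms_odd (x := x) i1 i2 i3
      (fun i hi h => hxne _ e1 i (h ▸ cm i hi)) (fun i hi h => hxne _ e2 i (h ▸ cm' i hi))
      (fun i hi => hle (cadj i hi)) (fun i hi => hle (cadj' i hi)) ?_ ?_ ?_
    · rw [SimpleGraph.sup_adj]
      refine Or.inr ((SimpleGraph.fromEdgeSet_adj _).2 ⟨by rw [ch, ch']; rfl, ?_⟩)
      exact i3 _ le_rfl _ le_rfl
    · rw [c0]
      exact hle h1.2
    · rw [c0']
      exact hle h2.2

include hG hfull in
/-- The case of even cycles. -/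
theorem card_closingPairs_even (hL : P.L + 1 = 2 * P.h) (hA : P.A 0 ⊆ P.A 1)
    (hd0 : 1 ≤ P.d 0) (hd : ∀ j, 1 ≤ j → j ≤ P.h → P.d j = d) :
    P.R.card * (d ^ P.h * d ^ P.h) ≤ 2 * (P.closingPairs G).card := by
  classical
  -- Each root is paired with a child from stage 0. Their joining edge and the two arms form a path
  -- with `2 * h + 2` vertices.
  set Q := P.R.biUnion fun x => {x} ×ˢ P.children G 0 x with hQdef
  have hmemQ : ∀ z ∈ Q, z.1 ∈ P.R ∧ z.2 ∈ P.W 0 ∧ G.Adj z.1 z.2 := by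
    intro z hz
    obtain ⟨x, hx, hz⟩ := Finset.mem_biUnion.1 hz
    rw [Finset.mem_product, Finset.mem_singleton, mem_children] at hz
    obtain ⟨rfl, hz⟩ := hz
    exact ⟨hx, hz⟩
  have hQ : P.R.card * 1 ≤ Q.card := by
    rw [hQdef, Finset.card_biUnion, ← smul_eq_mul, ← Finset.sum_const]
    · refine Finset.sum_le_sum fun x hx => ?_
      have h := hfull 0 (Nat.zero_le _) x (P.R_subset hx) (Or.inl hx)
      rw [Finset.card_product, Finset.card_singleton]
      omega
    · intro x hx x' hx' hne
      rw [Function.onFun, Finset.disjoint_left]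
      rintro ⟨a, b⟩ h h'
      rw [Finset.mem_product, Finset.mem_singleton] at h h'
      exact hne (h.1.symm.trans h'.1)
  rw [mul_one] at hQ
  refine (Nat.mul_le_mul_right _ hQ).trans (card_closingPairs_ge hG hfull hd Q ?_ ?_ ?_)
  · intro z hz
    obtain ⟨h1, h2, h3⟩ := hmemQ z hz
    exact ⟨h3.ne, ⟨hA (P.R_subset h1), Or.inl h1⟩, ⟨P.W_subset 0 h2, Or.inr ⟨_, h3.symm⟩⟩⟩
  · intro z hz
    obtain ⟨h, hh⟩ : ∃ h, P.h = h + 1 := ⟨P.h - 1, by omega⟩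
    rw [hh]
    exact ⟨desc_succ_subset h, desc_succ_subset h⟩
  · intro z hz a ha b hb
    obtain ⟨h1, h2, h3⟩ := hmemQ z hz
    obtain ⟨c, c', c0, c0', ch, ch', cadj, cadj', cm, cm', i1, i2, i3⟩ :=
      exists_arms hG (hA (P.R_subset h1)) (P.W_subset 0 h2) h3.ne ha hb
    have hle : G ≤ G ⊔ SimpleGraph.fromEdgeSet {s(a, b)} := le_sup_left
    refine hasCycle_of_arms_even hL i1 i2 i3
      (fun i hi => hle (cadj i hi)) (fun i hi => hle (cadj' i hi)) ?_ ?_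
    · rw [SimpleGraph.sup_adj]
      refine Or.inr ((SimpleGraph.fromEdgeSet_adj _).2 ⟨by rw [ch, ch']; rfl, ?_⟩)
      exact i3 _ le_rfl _ le_rfl
    · rw [c0, c0']
      exact hle h3.symm

end Plan

/-! ### Exchangeability of edges that the strategy ignores. -/

section Exposure

variable {n : ℕ}

open Classical in
/-- If a set of edges of `I` does not depend on the order in which the edges of `I` appear, then
it is unlikely that half of it is presented early. -/
theorem pr_half_shown_le (I : Finset (⊤ : SimpleGraph (Fin n)).edgeSet)
    (F : EdgeOrder n → Finset (Sym2 (Fin n)))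
    (hFI : ∀ σ, ∀ e ∈ F σ, ∃ e' ∈ I, (e' : Sym2 (Fin n)) = e)
    (hF : ∀ e ∈ I, ∀ e' ∈ I, ∀ σ, F (swapEdges e e' σ) = F σ) {s : ℕ} (hs : s ≤ n.choose 2) :
    pr n (fun σ => 0 < (F σ).card ∧ (F σ).card ≤ 2 * ((F σ).filter fun e => Shown σ s e).card) ≤
      2 * s / I.card := by
  rcases I.eq_empty_or_nonempty with rfl | hI
  · rw [pr_eq_zero]
    · simp
    · rintro σ ⟨h, -⟩
      obtain ⟨e, he⟩ := Finset.card_pos.1 h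
      obtain ⟨e', he', -⟩ := hFI σ e he
      simp at he'
  have hI0 : (0 : ℝ) < I.card := by exact_mod_cast Finset.card_pos.2 hI
  -- With these weights, the sum of `g e (F σ) * sh σ e` over `I` is the fraction of `F σ` presented
  -- by time `s`.
  set g : (⊤ : SimpleGraph (Fin n)).edgeSet → Finset (Sym2 (Fin n)) → ℝ :=
    fun e S => (if (e : Sym2 (Fin n)) ∈ S then 1 else 0) / S.card with hg
  have hg0 : ∀ e S, 0 ≤ g e S := fun e S => by simp only [hg]; positivity
  set sh : EdgeOrder n → (⊤ : SimpleGraph (Fin n)).edgeSet → ℝ :=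
    fun σ e => if Shown σ s (e : Sym2 (Fin n)) then 1 else 0 with hsh
  have hsh0 : ∀ σ e, 0 ≤ sh σ e := fun σ e => by simp only [hsh]; positivity
  have hswap : ∀ e ∈ I, ∀ e' ∈ I, avg n (fun σ => g e (F σ) * sh σ e) =
      avg n (fun σ => g e (F σ) * sh σ e') := by
    intro e he e' he'
    rw [← avg_comp_equiv (swapEdges e e')]
    refine avg_congr fun σ => ?_
    simp only [hF e he e' he', hsh, shown_swapEdges, Equiv.swap_apply_left]
  -- By exchangeability, whether `e` is presented may be replaced by whether `e'` is, for every `e'`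
  -- in `I`. Summing over `e'` counts at most `s` presented edges, so the expected fraction is at
  -- most `s / I.card`; Markov's inequality at 1/2 concludes.
  have hX : I.card * avg n (fun σ => ∑ e ∈ I, g e (F σ) * sh σ e) ≤ s := by
    calc I.card * avg n (fun σ => ∑ e ∈ I, g e (F σ) * sh σ e)
        = ∑ e ∈ I, ∑ e' ∈ I, avg n (fun σ => g e (F σ) * sh σ e') := by
          rw [avg_finset_sum, Finset.mul_sum]
          refine Finset.sum_congr rfl fun e he => ?_
          rw [← nsmul_eq_mul, ← Finset.sum_const]
          exact Finset.sum_congr rfl fun e' he' => hswap e he e' he'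
      _ = avg n (fun σ => (∑ e ∈ I, g e (F σ)) * ∑ e' ∈ I, sh σ e') := by
          simp_rw [← avg_finset_sum, Finset.sum_mul, Finset.mul_sum]
      _ ≤ avg n (fun _ => 1 * (s : ℝ)) := by
          refine avg_mono fun σ => ?_
          refine mul_le_mul ?_ ?_ (Finset.sum_nonneg fun e _ => hsh0 σ e) zero_le_one
          · simp only [hg]
            rw [← Finset.sum_div, Finset.sum_boole]
            refine div_le_one_of_le₀ ?_ (by positivity)
            have hle : (I.filter fun e : (⊤ : SimpleGraph (Fin n)).edgeSet =>
                (e : Sym2 (Fin n)) ∈ F σ).card ≤ (F σ).card :=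
              Finset.card_le_card_of_injOn
                (fun e : (⊤ : SimpleGraph (Fin n)).edgeSet => (e : Sym2 (Fin n)))
                (fun e he => (Finset.mem_filter.1 he).2) (fun a _ b _ h => Subtype.ext h)
            exact_mod_cast hle
          · rw [← sum_shown σ hs]
            exact Finset.sum_le_sum_of_subset_of_nonneg (Finset.subset_univ _)
              fun e _ _ => hsh0 σ e
      _ = s := by rw [avg_const, one_mul]
  have hm := markov (n := n) (c := 1 / 2)
    (E := fun σ => 0 < (F σ).card ∧
      (F σ).card ≤ 2 * ((F σ).filter fun e => Shown σ s e).card)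
    (f := fun σ => ∑ e ∈ I, g e (F σ) * sh σ e) (by norm_num)
    (fun σ => Finset.sum_nonneg fun e _ => mul_nonneg (hg0 e _) (hsh0 σ e)) (by
      rintro σ ⟨h1, h2⟩
      have h1' : (0 : ℝ) < (F σ).card := by exact_mod_cast h1
      have h3 : ∑ e ∈ I, g e (F σ) * sh σ e =
          (I.filter fun e : (⊤ : SimpleGraph (Fin n)).edgeSet =>
            (e : Sym2 (Fin n)) ∈ F σ ∧ Shown σ s e).card / (F σ).card := by
        rw [← Finset.sum_boole, Finset.sum_div]
        refine Finset.sum_congr rfl fun e _ => ?_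
        simp only [hg, hsh]
        by_cases a : (e : Sym2 (Fin n)) ∈ F σ <;> by_cases b : Shown σ s (e : Sym2 (Fin n)) <;>
          simp [a, b]
      have h4 : ((F σ).filter fun e => Shown σ s e).card ≤
          (I.filter fun e : (⊤ : SimpleGraph (Fin n)).edgeSet =>
            (e : Sym2 (Fin n)) ∈ F σ ∧ Shown σ s e).card := by
        refine le_trans (Finset.card_le_card fun e he => ?_)
          (Finset.card_image_le
            (f := fun e : (⊤ : SimpleGraph (Fin n)).edgeSet => (e : Sym2 (Fin n))))
        rw [Finset.mem_filter] at he
        obtain ⟨e', he', rfl⟩ := hFI σ e he.1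
        exact Finset.mem_image.2 ⟨e', Finset.mem_filter.2 ⟨he', he⟩, rfl⟩
      rw [h3, le_div_iff₀ h1']
      have h5 : ((F σ).card : ℝ) ≤ 2 * ((I.filter fun e : (⊤ : SimpleGraph (Fin n)).edgeSet =>
            (e : Sym2 (Fin n)) ∈ F σ ∧ Shown σ s e).card : ℝ) := by
        exact_mod_cast h2.trans (Nat.mul_le_mul_left 2 h4)
      linarith)
  refine hm.trans ?_
  rw [le_div_iff₀ hI0]
  linarith

lemma hits_eq_zero_iff (A : ℕ → EdgeOrder n → Finset (Sym2 (Fin n))) (σ : EdgeOrder n)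
    (s₀ s : ℕ) : hits A σ s₀ s = 0 ↔
      ∀ i : Fin (n.choose 2), s₀ ≤ i → (i : ℕ) < s → (σ i : Sym2 (Fin n)) ∉ A i σ := by
  classical
  induction s with
  | zero => simp [hits]
  | succ s ih =>
    rw [hits, Nat.add_eq_zero_iff, ih]
    constructor
    · rintro ⟨h1, h2⟩ i hi his hmem
      rcases Nat.lt_or_ge i s with h | h
      · exact h1 i hi h hmem
      · have : (i : ℕ) = s := by omega
        subst this
        rw [if_pos ⟨i.2, hi, hmem⟩] at h2
        omega
    · intro h
      refine ⟨fun i hi his => h i hi (by omega), if_neg ?_⟩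
      rintro ⟨hs, h1, h2⟩
      exact h ⟨s, hs⟩ h1 (Nat.lt_succ_self s) h2

end Exposure

/-! ### Closing the cycle and the success probability of a plan. -/

namespace Plan

variable {n : ℕ} {P : Plan n}

/-- Every edge bought while growing has an end in some `A j` with `j ≤ P.h`, and such a set is
disjoint from `P.W P.h`. -/
lemma not_rule_inner {s : ℕ} (hs : s < (P.h + 1) * P.τ) {e : Sym2 (Fin n)}
    (he : e ∈ (P.W P.h).sym2) (G : SimpleGraph (Fin n)) : ¬ P.rule s e G := by
  have hτ : 0 < P.τ := Nat.pos_of_ne_zero fun h0 => by simp [h0] at hs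
  have hj : s / P.τ ≤ P.h := Nat.lt_succ_iff.1 ((Nat.div_lt_iff_lt_mul hτ).2 hs)
  simp only [rule, hs, if_true]
  rintro ⟨v, w, rfl, hv, -⟩
  rw [Finset.mk_mem_sym2_iff] at he
  exact notMem_W_of_mem_A hj hv he.1

/-- Pairs inside the last layer are never bought while growing, so exchanging two of them in the
order goes unnoticed. This is the symmetry behind `pr_exposed_le`. -/
lemma builderGraph_swapEdges {e e' : (⊤ : SimpleGraph (Fin n)).edgeSet}
    (he : (e : Sym2 (Fin n)) ∈ (P.W P.h).sym2) (he' : (e' : Sym2 (Fin n)) ∈ (P.W P.h).sym2)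
    (σ : EdgeOrder n) {s : ℕ} (hs : s ≤ (P.h + 1) * P.τ) :
    builderGraph P.rule (swapEdges e e' σ) s = builderGraph P.rule σ s := by
  induction s with
  | zero => rfl
  | succ s ih =>
    have ih := ih (by omega)
    ext a b
    rw [builderGraph_succ_adj, builderGraph_succ_adj, ih]
    refine or_congr_right (exists_congr fun hN => ?_)
    rw [swapEdges_apply]
    by_cases h : σ ⟨s, hN⟩ = e ∨ σ ⟨s, hN⟩ = e'
    · have h1 : ((σ ⟨s, hN⟩ : (⊤ : SimpleGraph (Fin n)).edgeSet) : Sym2 (Fin n)) ∈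
          (P.W P.h).sym2 := by
        rcases h with h | h <;> rw [h] <;> assumption
      have h2 : ((Equiv.swap e e' (σ ⟨s, hN⟩) : (⊤ : SimpleGraph (Fin n)).edgeSet) :
          Sym2 (Fin n)) ∈ (P.W P.h).sym2 := by
        rcases h with h | h <;> rw [h]
        · rwa [Equiv.swap_apply_left]
        · rwa [Equiv.swap_apply_right]
      exact iff_of_false (fun h' => not_rule_inner (by omega) h2 _ h'.2)
        (fun h' => not_rule_inner (by omega) h1 _ h'.2)
    · push Not at h
      rw [Equiv.swap_apply_of_ne_of_ne h.1 h.2]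

open Classical in
variable (P) in
/-- It is unlikely that many closing pairs were presented during the growth stages. -/
theorem pr_exposed_le (hs : (P.h + 1) * P.τ ≤ n.choose 2) :
    pr n (fun σ => 0 < (P.closingPairs (builderGraph P.rule σ ((P.h + 1) * P.τ))).card ∧
      (P.closingPairs (builderGraph P.rule σ ((P.h + 1) * P.τ))).card ≤
        2 * ((P.closingPairs (builderGraph P.rule σ ((P.h + 1) * P.τ))).filter
          fun e => Shown σ ((P.h + 1) * P.τ) e).card) ≤
      2 * ((P.h + 1) * P.τ : ℕ) / ((P.W P.h).card.choose 2 : ℕ) := by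
  set I : Finset (⊤ : SimpleGraph (Fin n)).edgeSet :=
    Finset.univ.filter fun e => (e : Sym2 (Fin n)) ∈ (P.W P.h).sym2 with hI
  have hcard : (P.W P.h).card.choose 2 = I.card := by
    rw [← Sym2.card_image_offDiag, ← Finset.card_image_of_injective I Subtype.val_injective]
    congr 1
    ext e
    induction e using Sym2.ind with
    | _ a b =>
      simp only [Finset.mem_image, Finset.mem_offDiag, Prod.exists, Function.uncurry_apply_pair,
        Sym2.eq_iff, hI, Finset.mem_filter, Finset.mem_univ, true_and, Subtype.exists,
        exists_and_right, exists_eq_right, Finset.mk_mem_sym2_iff, SimpleGraph.mem_edgeSet,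
        SimpleGraph.top_adj, exists_prop]
      constructor
      · rintro ⟨x, y, ⟨hx, hy, hne⟩, ⟨rfl, rfl⟩ | ⟨rfl, rfl⟩⟩
        · exact ⟨hne, hx, hy⟩
        · exact ⟨hne.symm, hy, hx⟩
      · rintro ⟨hne, ha, hb⟩
        exact ⟨a, b, ⟨ha, hb, hne⟩, Or.inl ⟨rfl, rfl⟩⟩
  rw [hcard]
  refine pr_half_shown_le I (fun σ => P.closingPairs (builderGraph P.rule σ ((P.h + 1) * P.τ)))
    ?_ ?_ hs
  · intro σ e he
    simp only [closingPairs, Finset.mem_filter, Finset.mem_univ, true_and] at he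
    refine ⟨⟨e, by simpa [SimpleGraph.edgeSet_top] using he.2.1⟩, ?_, rfl⟩
    simpa [hI] using he.1
  · intro e he e' he' σ
    simp only [hI, Finset.mem_filter, Finset.mem_univ, true_and] at he he'
    rw [builderGraph_swapEdges he he' σ le_rfl]

/-- If a closing pair is presented after the growth stages, Builder has a cycle. -/
lemma hasCycle_of_hit (σ : EdgeOrder n) (i : Fin (n.choose 2)) (h1 : (P.h + 1) * P.τ ≤ i)
    (h2 : (σ i : Sym2 (Fin n)) ∈ P.closingPairs (builderGraph P.rule σ ((P.h + 1) * P.τ))) :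
    HasCycle P.L (builderGraph P.rule σ (i + 1)) := by
  simp only [closingPairs, Finset.mem_filter, Finset.mem_univ, true_and] at h2
  by_cases hc : HasCycle P.L (builderGraph P.rule σ i)
  · exact SimpleGraph.IsContained.mono_right hc (builderGraph_mono P.rule σ (Nat.le_succ i))
  · have heq := (closing_cases σ h1).resolve_right fun h' => hc h'.1
    rw [← heq] at h2
    have hr : P.rule i (σ i : Sym2 (Fin n)) (builderGraph P.rule σ i) := by
      simp only [rule, not_lt.2 h1, if_false]
      exact ⟨hc, h2.2.2⟩
    have hstep : builderGraph P.rule σ (i + 1) = builderGraph P.rule σ i ⊔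
        SimpleGraph.fromEdgeSet {(σ i : Sym2 (Fin n))} := by
      simp [builderGraph, hr]
    rw [hstep]
    exact h2.2.2

open Classical in
/-- If there are many closing pairs, one of them is likely to be presented in the last stage. -/
theorem pr_not_closed_le {f₀ : ℝ} (hf₀ : f₀ ≤ 2 * n.choose 2) (hN : 0 < n.choose 2)
    (hs : (P.h + 1) * P.τ + P.τ ≤ n.choose 2) :
    pr n (fun σ => (f₀ ≤ (P.closingPairs (builderGraph P.rule σ ((P.h + 1) * P.τ))).card ∧
        2 * ((P.closingPairs (builderGraph P.rule σ ((P.h + 1) * P.τ))).filter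
          fun e => Shown σ ((P.h + 1) * P.τ) e).card <
        (P.closingPairs (builderGraph P.rule σ ((P.h + 1) * P.τ))).card) ∧
      ¬ HasCycle P.L (builderGraph P.rule σ ((P.h + 1) * P.τ + P.τ))) ≤
      Real.exp (-(f₀ * P.τ / (4 * n.choose 2))) := by
  have hN' : (0 : ℝ) < n.choose 2 := by exact_mod_cast hN
  set s₀ := (P.h + 1) * P.τ with hs₀
  set F : EdgeOrder n → Finset (Sym2 (Fin n)) := fun σ =>
    P.closingPairs (builderGraph P.rule σ s₀) with hF
  have hFh : Hist s₀ F := (hist_builderGraph P.rule s₀).comp P.closingPairs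
  set A : ℕ → EdgeOrder n → Finset (Sym2 (Fin n)) := fun s σ => if s < s₀ then ∅ else F σ with hA
  have hAh : ∀ s, Hist s (A s) := by
    intro s
    rcases Nat.lt_or_ge s s₀ with h | h
    · intro σ σ' _
      simp [hA, h]
    · intro σ σ' H
      simp only [hA, not_lt.2 h, if_false]
      exact hFh.mono h σ σ' H
  set Base : EdgeOrder n → Prop := fun σ => f₀ ≤ (F σ).card ∧
    2 * ((F σ).filter fun e => Shown σ s₀ e).card < (F σ).card with hBase
  have hBh : Hist s₀ Base := hFh.comp₂ (hist_shown s₀) fun S p => f₀ ≤ (S.card : ℝ) ∧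
    2 * (S.filter fun e => p e).card < S.card
  -- No closing pair has appeared since the growth ended. As more than half of them had not appeared
  -- before, at least `f₀ / 2` are still to come, which gives the hitting rate `f₀ / (2 * n.choose
  -- 2)`.
  set Good : ℕ → EdgeOrder n → Prop := fun s σ => s < s₀ ∨ (Base σ ∧ hits A σ s₀ s = 0) with hGood
  have hGh : ∀ s, Hist s (Good s) := by
    intro s
    rcases Nat.lt_or_ge s s₀ with h | h
    · intro σ σ' _
      simp [hGood, h]
    · intro σ σ' H
      have h1 := hBh.mono h σ σ' H
      have h2 := hist_hits hAh s₀ s σ σ' H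
      simp only at h2
      simp only [hGood, h1, h2]
  have h := pr_few_hits_le hAh hGh (by
      rintro s σ (h | ⟨h1, h2⟩)
      · exact Or.inl (by omega)
      · rw [hits] at h2
        exact Or.inr ⟨h1, by omega⟩) (q := f₀ / (2 * n.choose 2))
      (by rw [div_le_one (by positivity)]; exact hf₀) (s₀ := s₀) (by
      rintro s σ hss (h | ⟨⟨h1, h2⟩, h3⟩)
      · omega
      rw [hits_eq_zero_iff] at h3
      have hAs : A s σ = F σ := by simp [hA, not_lt.2 hss]
      set S := (F σ).filter fun e => ¬ Shown σ s₀ e with hS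
      have hcard : ((F σ).filter fun e => Shown σ s₀ e).card + S.card = (F σ).card :=
        Finset.card_filter_add_card_filter_not _
      have hleft : S.card ≤ numLeft σ s (A s σ) := by
        rw [hAs]
        refine card_le_numLeft σ s _ _ (Finset.filter_subset _ _) ?_ ?_
        · intro e he
          have := (Finset.mem_filter.1 he).1
          simp only [hF, closingPairs, Finset.mem_filter] at this
          exact this.2.2.1
        · intro e he hsh
          rw [hS, Finset.mem_filter] at he
          obtain ⟨i, hi, rfl⟩ := hsh
          have hi0 : s₀ ≤ i := by
            by_contra hlt
            exact he.2 ⟨i, by omega, rfl⟩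
          refine h3 i hi0 hi ?_
          simp only [hA, not_lt.2 hi0, if_false]
          exact he.1
      have h4 : ((F σ).card : ℝ) ≤ 2 * numLeft σ s (A s σ) := by
        exact_mod_cast (by omega : (F σ).card ≤ 2 * numLeft σ s (A s σ))
      have h5 : f₀ / (2 * n.choose 2) * n.choose 2 = f₀ / 2 := by field_simp
      rw [h5]
      linarith) (τ := P.τ) hs 0
  refine (pr_mono ?_).trans (h.trans (le_of_eq ?_))
  · rintro σ ⟨h1, h2⟩
    have h3 : hits A σ s₀ (s₀ + P.τ) = 0 := by
      rw [hits_eq_zero_iff]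
      intro i hi his hmem
      simp only [hA, not_lt.2 hi, if_false] at hmem
      exact h2 (SimpleGraph.IsContained.mono_right (hasCycle_of_hit σ i hi hmem)
        (builderGraph_mono P.rule σ (by omega)))
    exact ⟨Or.inr ⟨h1, h3⟩, h3.le⟩
  · rw [pow_zero, one_mul]
    congr 1
    field_simp
    ring

/-- The success probability of the strategy of a plan. -/
theorem prContains_ge {t d m : ℕ} {q f₀ : ℝ} (ht : t ≤ n.choose 2)
    (hτ : (P.h + 2) * P.τ ≤ t) (hN : 0 < n.choose 2) (hq1 : q ≤ 1) (hd : ∀ j ≤ P.h, P.d j ≤ d)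
    (hq : ∀ j ≤ P.h, q * n.choose 2 + (P.d j * P.c j : ℕ) + m ≤ (P.W j).card)
    (hf₀ : 0 < f₀) (hf₁ : f₀ ≤ 2 * n.choose 2)
    (hF : ∀ G, P.Inv P.h G →
      (∀ j ≤ P.h, ∀ v ∈ P.A j, P.Act G v → P.d j ≤ (P.children G j v).card) →
      f₀ ≤ (P.closingPairs G).card) :
    1 - ((P.h + 1) * (n * (2 ^ d * Real.exp (-(q * P.τ / 2)))) +
      n * 2 ^ n * (((P.h + 1) * P.τ : ℕ) / n.choose 2 : ℝ) ^ (m + 1) +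
      2 * ((P.h + 1) * P.τ : ℕ) / ((P.W P.h).card.choose 2 : ℕ) +
      Real.exp (-(f₀ * P.τ / (4 * n.choose 2)))) ≤
    prContains (SimpleGraph.cycleGraph (P.L + 3)) P.rule t := by
  classical
  set s₀ := (P.h + 1) * P.τ with hs₀
  have hs₁ : s₀ + P.τ ≤ t := by
    have : (P.h + 2) * P.τ = s₀ + P.τ := by rw [hs₀]; ring
    omega
  have h1 : pr n (fun σ => ∃ j ∈ Finset.range (P.h + 1), ∃ v ∈ P.A j,
      P.Fail σ j v ∧ shownDeg σ ((j + 1) * P.τ) v ≤ m) ≤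
      (P.h + 1) * (n * (2 ^ d * Real.exp (-(q * P.τ / 2)))) := by
    have := pr_exists_le_card_mul (Finset.range (P.h + 1)) (fun j (σ : EdgeOrder n) =>
      ∃ v ∈ P.A j, P.Fail σ j v ∧ shownDeg σ ((j + 1) * P.τ) v ≤ m)
      (c := n * (2 ^ d * Real.exp (-(q * P.τ / 2)))) (by
        intro j hj
        have hj : j ≤ P.h := by simpa [Nat.lt_succ_iff] using hj
        have hjτ : (j + 1) * P.τ ≤ s₀ := Nat.mul_le_mul_right _ (by omega)
        have hv := pr_exists_le_card_mul (P.A j) (fun v (σ : EdgeOrder n) =>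
          P.Fail σ j v ∧ shownDeg σ ((j + 1) * P.τ) v ≤ m)
          (c := 2 ^ d * Real.exp (-(q * P.τ / 2))) (fun v hv => by
            refine (pr_fail_le hj hv hq1 (hq j hj) (by omega)).trans ?_
            gcongr
            · norm_num
            · exact hd j hj)
        refine hv.trans ?_
        gcongr
        simpa using Finset.card_le_univ (P.A j))
    simpa using this
  have h2 := pr_exists_shownDeg_le (n := n) (T := s₀) (m := m) (by omega)
  have h3 := pr_exposed_le P (by omega)
  have h4 := pr_not_closed_le (P := P) hf₁ hN (by omega)
  rw [← hs₀] at h3 h4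
  rw [prContains, pr_compl]
  refine sub_le_sub_left ?_ 1
  refine (pr_mono ?_).trans ((pr_or_le _ _).trans (add_le_add ((pr_or_le _ _).trans
    (add_le_add ((pr_or_le _ _).trans (add_le_add h1 h2)) h3)) h4))
  -- Outside the four bad events (a failing vertex of moderate degree, a vertex of large degree,
  -- closing pairs exposed early, no closing pair hit later) the cycle is present after the last
  -- stage.
  intro σ hσ
  by_contra! hcon
  obtain ⟨⟨⟨e1, e2⟩, e3⟩, e4⟩ := hcon
  have hS : ∀ j ≤ P.h, ∀ v ∈ P.A j, ¬ P.Fail σ j v := by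
    intro j hj v hv hf
    have hjτ : (j + 1) * P.τ ≤ s₀ := Nat.mul_le_mul_right _ (by omega)
    have := e1 j (Finset.mem_range.2 (by omega)) v hv hf
    have h5 := e2 v
    have h6 := shownDeg_mono σ hjτ v
    omega
  have hcl := hF _ (inv_builderGraph σ le_rfl le_rfl) fun j hj v hv =>
    le_card_children σ hS hj hv
  have hpos : 0 < (P.closingPairs (builderGraph P.rule σ s₀)).card := by
    have := hf₀.trans_le hcl
    exact_mod_cast this
  refine hσ (SimpleGraph.IsContained.mono_right (e4 ⟨hcl, e3 hpos⟩)
    (builderGraph_mono P.rule σ hs₁))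

end Plan

/-! ### Concrete plans for odd and even cycles. -/

section Blocks

variable {n : ℕ}

/-- The `i`-th block of `w` consecutive vertices. -/
def block (n w i : ℕ) : Finset (Fin n) :=
  Finset.univ.filter fun v => i * w ≤ v ∧ (v : ℕ) < (i + 1) * w

lemma disjoint_block {w i j : ℕ} (h : i ≠ j) : Disjoint (block n w i) (block n w j) := by
  wlog hij : i < j generalizing i j
  · exact (this h.symm (by omega)).symm
  rw [Finset.disjoint_left]
  intro v hv hv'
  simp only [block, Finset.mem_filter, Finset.mem_univ, true_and] at hv hv'
  have : (i + 1) * w ≤ j * w := Nat.mul_le_mul_right _ hij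
  omega

lemma card_block {w i : ℕ} (h : (i + 1) * w ≤ n) : (block n w i).card = w := by
  have hw : (i + 1) * w = i * w + w := by ring
  have : (block n w i).map Fin.valEmbedding = Finset.Ico (i * w) ((i + 1) * w) := by
    ext x
    simp only [block, Finset.mem_map, Finset.mem_filter, Finset.mem_univ, true_and,
      Fin.valEmbedding_apply, Finset.mem_Ico]
    constructor
    · rintro ⟨v, hv, rfl⟩
      exact hv
    · intro hx
      exact ⟨⟨x, by omega⟩, hx, rfl⟩
  rw [← Finset.card_map Fin.valEmbedding, this, Nat.card_Ico]
  omega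

/-- The plan for cycles of length `2 * h + 3`. -/
def oddPlan (w τ h d : ℕ) (R : Finset (Fin n)) (hR : R ⊆ block n w 0) : Plan n where
  L := 2 * h
  h := h
  τ := τ
  R := R
  A := fun j => block n w j
  W := fun j => block n w (j + 1)
  d := fun _ => d
  c := fun j => R.card * d ^ j
  disjoint_W := fun i j h => disjoint_block (by omega)
  disjoint_A := fun i j h => disjoint_block (by omega)
  R_subset := hR
  A_succ_subset := fun j => Finset.subset_union_right
  W_subset := fun j => subset_rfl
  card_R_le := by simp
  c_succ := fun j => by
    have : R ∩ block n w (j + 1) = ∅ :=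
      Finset.disjoint_iff_inter_eq_empty.1
        (Finset.disjoint_of_subset_left hR (disjoint_block (by omega)))
    rw [this, Finset.card_empty, pow_succ]
    exact le_of_eq (by ring)

/-- The plan for cycles of length `2 * h + 2`. -/
def evenPlan (w τ h d : ℕ) (R : Finset (Fin n)) (hR : R ⊆ block n w 0) : Plan n where
  L := 2 * h - 1
  h := h
  τ := τ
  R := R
  A := fun j => if j = 1 then block n w 0 ∪ block n w 1 else block n w j
  W := fun j => block n w (j + 1)
  d := fun j => if j = 0 then 1 else d
  -- From stage 1 on, the roots and their partners both carry a tree, whence the factor 2; the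
  -- exponent lags by one because stage 0 gives a single child.
  c := fun j => if j = 0 then R.card else 2 * R.card * d ^ (j - 1)
  disjoint_W := fun i j h => disjoint_block (by omega)
  disjoint_A := fun i j h => by
    split_ifs with h1
    · exact Finset.disjoint_union_left.2 ⟨disjoint_block (by omega), disjoint_block (by omega)⟩
    · exact disjoint_block (by omega)
  R_subset := by simpa using hR
  A_succ_subset := fun j => by
    by_cases h : j = 0
    · simp [h]
    · simp [h]
  W_subset := fun j => by
    by_cases h : j = 0
    · simp [h]
    · simp [h]
  card_R_le := by simp
  c_succ := fun j => by
    cases j with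
    | zero =>
      have := Finset.card_le_card (Finset.inter_subset_left (s₁ := R)
        (s₂ := block n w 0 ∪ block n w 1))
      simp only [zero_add, if_true, one_ne_zero, if_false, one_mul, Nat.sub_self, pow_zero,
        mul_one]
      omega
    | succ j =>
      have : R ∩ block n w (j + 1 + 1) = ∅ :=
        Finset.disjoint_iff_inter_eq_empty.1
          (Finset.disjoint_of_subset_left hR (disjoint_block (by omega)))
      simp only [show ¬ (j + 1 + 1 = 1) by omega, if_false, this, Finset.card_empty,
        Nat.add_eq_zero_iff, one_ne_zero, and_false, Nat.add_sub_cancel, pow_succ]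
      exact le_of_eq (by ring)

lemma sum_pow_succ_le {d : ℕ} (hd : 2 ≤ d) (k : ℕ) :
    ∑ j ∈ Finset.range k, d ^ (j + 1) ≤ 2 * d ^ k := by
  induction k with
  | zero => simp
  | succ k ih =>
    rw [Finset.sum_range_succ]
    have : 2 * d ^ k ≤ d ^ (k + 1) := by
      rw [pow_succ, mul_comm]
      exact Nat.mul_le_mul_left _ hd
    omega

/-- The total error in the bound for the success probability. -/
noncomputable def planError (k n w τ m r d : ℕ) (q : ℝ) : ℝ :=
  (k + 1) * (n * (2 ^ d * Real.exp (-(q * τ / 2)))) +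
    n * 2 ^ n * (((k + 1) * τ : ℕ) / n.choose 2 : ℝ) ^ (m + 1) +
    2 * ((k + 1) * τ : ℕ) / (w.choose 2 : ℕ) +
    Real.exp (-(r * (d : ℝ) ^ (2 * k) / 4 * τ / (4 * n.choose 2)))

/-- The hypotheses are common to both parities, so they allow for the more expensive even plan: its
cost is at most `r + 4 * (r * d ^ k)` plus the closing edge, and it has one more stage. -/
lemma exists_strategy_odd {k t b w τ m r d : ℕ} {q : ℝ} (hk : 1 ≤ k) (ht : t ≤ n.choose 2)
    (hN : 0 < n.choose 2) (hw : (k + 2) * w ≤ n) (hτ : (k + 2) * τ ≤ t) (hr1 : 1 ≤ r)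
    (hrw : r ≤ w) (hd : 2 ≤ d) (hb : 5 * (r * d ^ k) + 1 ≤ b) (hq1 : q ≤ 1)
    (hq : q * n.choose 2 + (2 * (r * d ^ k) : ℕ) + m ≤ w)
    (hf : r * (d : ℝ) ^ (2 * k) / 4 ≤ 2 * n.choose 2) :
    ∃ f : DetStrategy n t b, 1 - planError k n w τ m r d q ≤
      prContains (SimpleGraph.cycleGraph (2 * k + 1)) f.rule t := by
  obtain ⟨h, rfl⟩ : ∃ h, k = h + 1 := ⟨k - 1, by omega⟩
  have hblock : ∀ i ≤ h + 2, (block n w i).card = w := fun i hi =>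
    card_block ((Nat.mul_le_mul_right w (by omega : i + 1 ≤ h + 1 + 2)).trans hw)
  obtain ⟨R, hR, hRc⟩ := Finset.exists_subset_card_eq ((hblock 0 (by omega)).symm ▸ hrw)
  set P := oddPlan w τ h d R hR with hP
  have hcd : ∀ j ≤ h, d * (R.card * d ^ j) ≤ 2 * (r * d ^ (h + 1)) := by
    intro j hj
    rw [hRc]
    calc d * (r * d ^ j) = r * d ^ (j + 1) := by ring
      _ ≤ r * d ^ (h + 1) := by
        gcongr
        · omega
      _ ≤ _ := by omega
  have hbudget : ∑ j ∈ Finset.range (P.h + 1), P.d j * P.c j + 1 ≤ b := by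
    refine le_trans ?_ hb
    have h1 : ∑ j ∈ Finset.range (P.h + 1), P.d j * P.c j =
        r * ∑ j ∈ Finset.range (h + 1), d ^ (j + 1) := by
      rw [Finset.mul_sum]
      refine Finset.sum_congr rfl fun j _ => ?_
      change d * (R.card * d ^ j) = r * d ^ (j + 1)
      rw [hRc]
      ring
    have h2 := Nat.mul_le_mul_left r (sum_pow_succ_le hd (h + 1))
    rw [h1]
    have h3 : r * (2 * d ^ (h + 1)) = 2 * (r * d ^ (h + 1)) := by ring
    omega
  have hf₀ : (0 : ℝ) < r * (d : ℝ) ^ (2 * (h + 1)) / 4 := by positivity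
  have hge := P.prContains_ge (t := t) (d := d) (m := m) (q := q) ht
    (le_trans (Nat.mul_le_mul_right τ (by omega : h + 2 ≤ h + 1 + 2)) hτ) hN hq1
    (fun _ _ => le_rfl) (fun j hj => by
      have h1 : ((P.d j * P.c j : ℕ) : ℝ) ≤ (2 * (r * d ^ (h + 1)) : ℕ) := by
        exact_mod_cast hcd j hj
      have h2 : (P.W j).card = w := hblock (j + 1) (by
        have : j ≤ h := hj
        omega)
      rw [h2]
      linarith) hf₀ hf (fun G hG hfull => by
      have h1 := Plan.card_closingPairs_odd (d := d) hG hfull rfl rfl (fun _ _ => rfl)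
      -- Two leaves must lie below different children of the root; for `d ≥ 2` this keeps at least
      -- half of the pairs of children.
      have h2 : d ^ 2 ≤ 2 * (d * d - d) := by
        have : 2 * d ≤ d * d := Nat.mul_le_mul_right d hd
        rw [pow_two]
        omega
      have h3 : r * d ^ (2 * (h + 1)) ≤ 4 * (P.closingPairs G).card := by
        calc r * d ^ (2 * (h + 1)) = r * d ^ 2 * (d ^ h * d ^ h) := by ring
          _ ≤ r * (2 * (d * d - d)) * (d ^ h * d ^ h) := by gcongr
          _ = 2 * (P.R.card * (d * d - d) * (d ^ P.h * d ^ P.h)) := by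
            rw [show P.R.card = r from hRc, show P.h = h from rfl]
            ring
          _ ≤ 2 * (2 * (P.closingPairs G).card) := Nat.mul_le_mul_left 2 h1
          _ = _ := by ring
      have h4 : (r : ℝ) * (d : ℝ) ^ (2 * (h + 1)) ≤ 4 * (P.closingPairs G).card := by
        exact_mod_cast h3
      linarith)
  refine ⟨P.strategy t b hbudget, ?_⟩
  have hW : (P.W P.h).card = w := hblock (h + 1) (by omega)
  rw [hW] at hge
  refine le_trans (sub_le_sub_left ?_ 1) hge
  -- The odd plan has only `h + 1 = k` growth stages, while `planError` allows for `k + 1`.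
  have hhτ : ((P.h + 1) * P.τ : ℕ) ≤ (h + 1 + 1) * τ := Nat.mul_le_mul_right τ (by omega : h + 1 ≤ h + 1 + 1)
  have hh : (P.h : ℝ) + 1 ≤ ((h + 1 : ℕ) : ℝ) + 1 := by
    exact_mod_cast (by omega : h + 1 ≤ h + 1 + 1)
  unfold planError
  change (P.h + 1) * (n * (2 ^ d * Real.exp (-(q * τ / 2)))) + _ + _ + _ ≤ _
  gcongr
  · exact le_rfl

lemma exists_strategy_even {k t b w τ m r d : ℕ} {q : ℝ} (hk : 1 ≤ k) (ht : t ≤ n.choose 2)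
    (hN : 0 < n.choose 2) (hw : (k + 2) * w ≤ n) (hτ : (k + 2) * τ ≤ t) (hr1 : 1 ≤ r)
    (hrw : r ≤ w) (hd : 2 ≤ d) (hb : 5 * (r * d ^ k) + 1 ≤ b) (hq1 : q ≤ 1)
    (hq : q * n.choose 2 + (2 * (r * d ^ k) : ℕ) + m ≤ w)
    (hf : r * (d : ℝ) ^ (2 * k) / 4 ≤ 2 * n.choose 2) :
    ∃ f : DetStrategy n t b, 1 - planError k n w τ m r d q ≤
      prContains (SimpleGraph.cycleGraph (2 * k + 2)) f.rule t := by
  have hblock : ∀ i ≤ k + 1, (block n w i).card = w := fun i hi =>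
    card_block ((Nat.mul_le_mul_right w (by omega : i + 1 ≤ k + 2)).trans hw)
  obtain ⟨R, hR, hRc⟩ := Finset.exists_subset_card_eq ((hblock 0 (by omega)).symm ▸ hrw)
  set P := evenPlan w τ k d R hR with hP
  have hcd0 : P.d 0 * P.c 0 = r := by
    change 1 * R.card = r
    rw [hRc, one_mul]
  have hcd1 : ∀ j, P.d (j + 1) * P.c (j + 1) = 2 * r * d ^ (j + 1) := by
    intro j
    change d * (2 * R.card * d ^ j) = _
    rw [hRc]
    ring
  have hcd : ∀ j ≤ k, P.d j * P.c j ≤ 2 * (r * d ^ k) := by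
    intro j hj
    cases j with
    | zero =>
      rw [hcd0]
      have : 1 ≤ d ^ k := Nat.one_le_pow _ _ (by omega)
      nlinarith
    | succ j =>
      rw [hcd1, mul_assoc]
      gcongr
      omega
  have hbudget : ∑ j ∈ Finset.range (P.h + 1), P.d j * P.c j + 1 ≤ b := by
    refine le_trans ?_ hb
    rw [Finset.sum_range_succ', hcd0]
    simp_rw [hcd1]
    rw [← Finset.mul_sum]
    have h2 := Nat.mul_le_mul_left (2 * r) (sum_pow_succ_le hd P.h)
    have h3 : 2 * r * (2 * d ^ P.h) = 4 * (r * d ^ k) := by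
      change 2 * r * (2 * d ^ k) = _
      ring
    have h4 : r * 1 ≤ r * d ^ k := Nat.mul_le_mul_left r (Nat.one_le_pow _ _ (by omega))
    omega
  have hf₀ : (0 : ℝ) < r * (d : ℝ) ^ (2 * k) / 4 := by positivity
  have hdd : ∀ j ≤ P.h, P.d j ≤ d := by
    intro j _
    change (if j = 0 then 1 else d) ≤ d
    split_ifs <;> omega
  have hge := P.prContains_ge (t := t) (d := d) (m := m) (q := q) ht hτ hN hq1 hdd
    (fun j hj => by
      have h1 : ((P.d j * P.c j : ℕ) : ℝ) ≤ (2 * (r * d ^ k) : ℕ) := by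
        exact_mod_cast hcd j hj
      have h2 : (P.W j).card = w := hblock (j + 1) (by
        have : j ≤ k := hj
        omega)
      rw [h2]
      linarith) hf₀ hf (fun G hG hfull => by
      have h1 := Plan.card_closingPairs_even (d := d) hG hfull
        (show 2 * k - 1 + 1 = 2 * k by omega)
        (show block n w 0 ⊆ block n w 0 ∪ block n w 1 from Finset.subset_union_left) le_rfl
        (fun j hj _ => if_neg (by omega))
      have h3 : r * d ^ (2 * k) ≤ 2 * (P.closingPairs G).card := by
        calc r * d ^ (2 * k) = P.R.card * (d ^ P.h * d ^ P.h) := by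
              rw [show P.R.card = r from hRc, show P.h = k from rfl]
              ring
          _ ≤ _ := h1
      have h4 : (r : ℝ) * (d : ℝ) ^ (2 * k) ≤ 2 * (P.closingPairs G).card := by
        exact_mod_cast h3
      have h5 : (0 : ℝ) ≤ (P.closingPairs G).card := by positivity
      linarith)
  refine ⟨P.strategy t b hbudget, ?_⟩
  have hW : (P.W P.h).card = w := hblock (k + 1) le_rfl
  rw [hW] at hge
  have hL : P.L + 3 = 2 * k + 2 := show 2 * k - 1 + 3 = 2 * k + 2 by omega
  rw [← hL]
  exact hge

end Blocks

/-! ### Number of trees against branching number. -/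

section Selection

/-- The choice of the number `r` of trees and of their branching number `d`. -/
lemma exists_branching (k d₀ b : ℕ) (hd₀ : 2 ≤ d₀) (hb : 2 ^ k ≤ b) :
    ∃ r d : ℕ, 1 ≤ r ∧ 2 ≤ d ∧ d ≤ d₀ ∧ r * d ^ k ≤ b ∧
      (b * d₀ ^ k ≤ 2 * (r * d ^ (2 * k)) ∨ b ^ 2 ≤ 4 ^ k * (r * d ^ (2 * k))) := by
  rcases le_or_gt (d₀ ^ k) b with h | h
  · have hpos : 0 < d₀ ^ k := by positivity
    have h1 : 1 ≤ b / d₀ ^ k := (Nat.one_le_div_iff hpos).2 h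
    refine ⟨b / d₀ ^ k, d₀, h1, hd₀, le_rfl, Nat.div_mul_le_self _ _, Or.inl ?_⟩
    have h2 : b ≤ 2 * (b / d₀ ^ k * d₀ ^ k) := by
      -- Full branching is affordable: the rounding in `b / d₀ ^ k` costs at most a factor 2, as the
      -- quotient is at least 1.
      have h3 := Nat.div_add_mod b (d₀ ^ k)
      have h4 := Nat.mod_lt b hpos
      have h5 : d₀ ^ k * 1 ≤ d₀ ^ k * (b / d₀ ^ k) := Nat.mul_le_mul_left _ h1
      rw [mul_comm (b / d₀ ^ k)]
      omega
    calc b * d₀ ^ k ≤ 2 * (b / d₀ ^ k * d₀ ^ k) * d₀ ^ k := Nat.mul_le_mul_right _ h2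
      _ = 2 * (b / d₀ ^ k * d₀ ^ (2 * k)) := by ring
  -- Full branching is too expensive even for one tree, so a single tree with the largest affordable
  -- `d` is grown. Since `b < (d + 1) ^ k ≤ (2 * d) ^ k`, the pairs of leaves number of order `b ^
  -- 2`.
  · set d := Nat.findGreatest (fun d => d ^ k ≤ b) d₀ with hd
    have h2d : 2 ≤ d := Nat.le_findGreatest hd₀ hb
    have hdd : d ≤ d₀ := Nat.findGreatest_le _
    have hdk : d ^ k ≤ b := Nat.findGreatest_spec (P := fun d => d ^ k ≤ b) hd₀ hb
    have hne : d ≠ d₀ := fun h' => by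
      rw [h'] at hdk
      omega
    have hlt : b < (d + 1) ^ k := by
      have := Nat.findGreatest_is_greatest (P := fun d => d ^ k ≤ b) (n := d₀) (k := d + 1)
        (by omega) (by omega)
      omega
    refine ⟨1, d, le_rfl, h2d, hdd, by omega, Or.inr ?_⟩
    have h3 : b ≤ (2 * d) ^ k := hlt.le.trans (Nat.pow_le_pow_left (by omega) k)
    calc b ^ 2 ≤ ((2 * d) ^ k) ^ 2 := Nat.pow_le_pow_left h3 2
      _ = 4 ^ k * (1 * d ^ (2 * k)) := by
        rw [one_mul, ← pow_mul, mul_pow, mul_comm k 2, pow_mul 2 2 k]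
        norm_num

end Selection

/-! ### The four error terms. -/

section Errors

variable {n : ℕ}

lemma pairs_le (n : ℕ) : (n.choose 2 : ℝ) ≤ (n : ℝ) ^ 2 / 2 := by
  rw [Nat.cast_choose_two]
  have : (0 : ℝ) ≤ n := by positivity
  nlinarith

/-- With D = τ / n, the Chernoff exponent is at least D / (8κ), while `2 ^ d` costs at most half of
it. The remaining exp(-D / (16κ)) is at most n⁻² because D is a large multiple of log n, and this
beats the union bound over the vertices. -/
lemma growth_error_le {k κ w τ d : ℕ} {η : ℝ} (hη : 0 < η) (hκ : 0 < κ) (hn : 2 ≤ n)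
    (hw : (n : ℝ) ≤ 2 * κ * w) (hd : (d : ℝ) ≤ τ / n / (16 * κ))
    (hD : 32 * κ * Real.log n ≤ (τ : ℝ) / n) (hnη : 4 * (k + 1) / η ≤ n) :
    (k + 1) * (n * (2 ^ d * Real.exp (-(w / (4 * n.choose 2) * τ / 2)))) ≤ η / 4 := by
  have hn0 : (0 : ℝ) < n := by exact_mod_cast (by omega : 0 < n)
  have hκ0 : (0 : ℝ) < κ := by exact_mod_cast hκ
  have hN0 : (0 : ℝ) < n.choose 2 := lt_of_lt_of_le (by positivity) (two_le_pairs n hn)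
  have hN := pairs_le n
  set D : ℝ := (τ : ℝ) / n with hDdef
  have h1 : D / (8 * κ) ≤ w / (4 * n.choose 2) * τ / 2 := by
    have hτ : (τ : ℝ) = D * n := by rw [hDdef]; field_simp
    have hD0 : 0 ≤ D := by positivity
    clear_value D
    have e : (w : ℝ) / (4 * n.choose 2) * τ / 2 = w * (D * n) / (8 * n.choose 2) := by
      rw [hτ]
      field_simp
      ring
    rw [e, div_le_div_iff₀ (by positivity) (by positivity)]
    calc D * (8 * n.choose 2) ≤ D * (8 * (n ^ 2 / 2)) := by gcongr
      _ = 4 * (D * n) * n := by ring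
      _ ≤ 4 * (D * n) * (2 * κ * w) := by gcongr
      _ = w * (D * n) * (8 * κ) := by ring
  have h2 : (2 : ℝ) ^ d ≤ Real.exp (D / (16 * κ)) := by
    have h2e : (2 : ℝ) ≤ Real.exp 1 := by
      have := Real.add_one_le_exp (1 : ℝ)
      linarith
    calc (2 : ℝ) ^ d ≤ (Real.exp 1) ^ d := by gcongr
      _ = Real.exp d := by rw [← Real.exp_nat_mul, mul_one]
      _ ≤ _ := Real.exp_le_exp.2 hd
  have h3 : 2 * Real.log n ≤ D / (16 * κ) := by
    rw [le_div_iff₀ (by positivity)]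
    linarith
  have h4 : (2 : ℝ) ^ d * Real.exp (-(w / (4 * n.choose 2) * τ / 2)) ≤ 1 / (n : ℝ) ^ 2 := by
    calc _ ≤ Real.exp (D / (16 * κ)) * Real.exp (-(D / (8 * κ))) := by gcongr
      _ = Real.exp (-(D / (16 * κ))) := by
        rw [← Real.exp_add]
        congr 1
        field_simp
        ring
      _ ≤ Real.exp (-(2 * Real.log n)) := by gcongr
      _ = 1 / (n : ℝ) ^ 2 := by
        rw [Real.exp_neg, two_mul, Real.exp_add, Real.exp_log hn0, pow_two, one_div]
  calc _ ≤ (k + 1) * (n * (1 / (n : ℝ) ^ 2)) := by gcongr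
    _ = (k + 1) / n := by field_simp
    _ ≤ η / 4 := by
      rw [div_le_iff₀ hn0]
      rw [div_le_iff₀ hη] at hnη
      linarith

/-- The degree cap `m` is linear in `n`, so a sufficiently small density makes `x ^ (m + 1)` at most
`4 ^ (-n)`, which outweighs the crude factor `2 ^ n`. -/
lemma degree_error_le {κ m : ℕ} {ε x η : ℝ} (hε : ε ≤ (1 / 4) ^ (4 * κ)) (hx0 : 0 ≤ x)
    (hx : x ≤ ε) (hm : n ≤ 4 * κ * (m + 1)) (hnη : (n : ℝ) * (1 / 2) ^ n ≤ η / 4) :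
    n * 2 ^ n * x ^ (m + 1) ≤ η / 4 := by
  refine le_trans ?_ hnη
  calc (n : ℝ) * 2 ^ n * x ^ (m + 1) ≤ n * 2 ^ n * ((1 / 4) ^ (4 * κ)) ^ (m + 1) := by
        gcongr
        exact hx.trans hε
    _ = n * 2 ^ n * (1 / 4) ^ (4 * κ * (m + 1)) := by rw [← pow_mul]
    _ ≤ n * 2 ^ n * (1 / 4) ^ n := by
        have : ((1 : ℝ) / 4) ^ (4 * κ * (m + 1)) ≤ (1 / 4) ^ n :=
          pow_le_pow_of_le_one (by norm_num) (by norm_num) hm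
        gcongr
    _ = n * (1 / 2) ^ n := by
        rw [mul_assoc, ← mul_pow]
        norm_num

lemma exposure_error_le {κ w s : ℕ} {ε η : ℝ} (hκ : 0 < κ) (hn : 2 ≤ n) (hε0 : 0 ≤ ε)
    (hε : 16 * (κ : ℝ) ^ 2 * ε ≤ η / 4) (hw2 : 2 ≤ w) (hw : (n : ℝ) ≤ 2 * κ * w)
    (hs : (s : ℝ) ≤ ε * n.choose 2) : 2 * (s : ℝ) / (w.choose 2 : ℕ) ≤ η / 4 := by
  refine le_trans ?_ hε
  have hw0 : (0 : ℝ) < w := by exact_mod_cast (by omega : 0 < w)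
  have h1 := two_le_pairs w hw2
  have h0 : (0 : ℝ) < w.choose 2 := lt_of_lt_of_le (by positivity) h1
  rw [div_le_iff₀ h0]
  have h2 := pairs_le n
  have h3 : (n : ℝ) ^ 2 ≤ (2 * κ * w) ^ 2 := by gcongr
  calc 2 * (s : ℝ) ≤ 2 * (ε * (n ^ 2 / 2)) := by
        have : ε * n.choose 2 ≤ ε * ((n : ℝ) ^ 2 / 2) := by gcongr
        linarith
    _ = ε * n ^ 2 := by ring
    _ ≤ ε * (2 * κ * w) ^ 2 := by gcongr
    _ = 16 * κ ^ 2 * ε * (w ^ 2 / 4) := by ring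
    _ ≤ _ := by gcongr

lemma closing_error_le {τ : ℕ} {x η : ℝ} (hη : 0 < η) (hn : 2 ≤ n)
    (hx : 32 / η * n ≤ x * (τ / n)) :
    Real.exp (-(x / 4 * τ / (4 * n.choose 2))) ≤ η / 4 := by
  have hn0 : (0 : ℝ) < n := by exact_mod_cast (by omega : 0 < n)
  have hN0 : (0 : ℝ) < n.choose 2 := lt_of_lt_of_le (by positivity) (two_le_pairs n hn)
  have hN := pairs_le n
  set y := x / 4 * τ / (4 * n.choose 2) with hy
  have h1 : 4 / η ≤ y := by
    rw [hy, le_div_iff₀ (by positivity)]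
    have h2 : 32 / η * n * n ≤ x * τ := by
      calc 32 / η * n * n ≤ x * (τ / n) * n := by gcongr
        _ = x * τ := by field_simp
    calc 4 / η * (4 * n.choose 2) ≤ 4 / η * (4 * (n ^ 2 / 2)) := by gcongr
      _ = (32 / η * n * n) / 4 := by ring
      _ ≤ (x * τ) / 4 := by gcongr
      _ = _ := by ring
  have hy0 : 0 < y := lt_of_lt_of_le (by positivity) h1
  have h3 : y ≤ Real.exp y := by
    have := Real.add_one_le_exp y
    linarith
  rw [Real.exp_neg]
  calc (Real.exp y)⁻¹ ≤ (4 / η)⁻¹ := by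
        gcongr
        exact h1.trans h3
    _ = η / 4 := by rw [inv_div]

end Errors

/-! ### Choice of the parameters above the thresholds. -/

section Parameters

/-- Four cases: the usable budget `b₁` is limited by `b` or by the block size, and the branching by
`d₀` or by `b₁`. When `b` is the limit, `h1` and `h2` encode the two terms of the threshold; when
the block size is, `D` above a constant is enough. -/
lemma branching_large {k b₁ d₀ X : ℕ} {n b D κ Y : ℝ} (hn : 1 ≤ n) (hκ : 0 < κ)
    (hY : 0 ≤ Y) (hb0 : 0 ≤ b) (hb₁ : b / 10 ≤ b₁ ∨ n / (32 * κ) ≤ b₁)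
    (hd₀ : D / (32 * κ) ≤ d₀) (hD1 : 1 ≤ D)
    (hX : b₁ * d₀ ^ k ≤ 2 * X ∨ b₁ ^ 2 ≤ 4 ^ k * X)
    (h1 : 20 * Y * (32 * κ) ^ k * n ≤ b * D ^ (k + 1)) (h2 : 100 * 4 ^ k * Y * n ≤ b ^ 2 * D)
    (h3 : 64 * κ * Y * (32 * κ) ^ k ≤ D) (h4 : 1024 * κ ^ 2 * 4 ^ k * Y ≤ D) :
    Y * n ≤ X * D := by
  have hD0 : 0 < D := by linarith
  have hn0 : 0 < n := by linarith
  rcases hX with hX | hX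
  · have hX' : (b₁ : ℝ) * (d₀ : ℝ) ^ k ≤ 2 * X := by exact_mod_cast hX
    have h5 : (b₁ : ℝ) * (D / (32 * κ)) ^ k ≤ 2 * X := le_trans (by gcongr) hX'
    have hP : 0 < (32 * κ) ^ k := by positivity
    rw [div_pow, ← mul_div_assoc, div_le_iff₀ hP] at h5
    have key : 2 * (Y * n) * (32 * κ) ^ k ≤ b₁ * D ^ k * D := by
      rcases hb₁ with h | h
      · calc 2 * (Y * n) * (32 * κ) ^ k = (20 * Y * (32 * κ) ^ k * n) / 10 := by ring
          _ ≤ b * D ^ (k + 1) / 10 := by gcongr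
          _ = b / 10 * D ^ k * D := by ring
          _ ≤ _ := by gcongr
      · calc 2 * (Y * n) * (32 * κ) ^ k = n / (32 * κ) * 1 * (64 * κ * Y * (32 * κ) ^ k) := by
              field_simp
              ring
          _ ≤ b₁ * D ^ k * D := by
              have : 1 ≤ D ^ k := one_le_pow₀ hD1
              gcongr
    have h6 : 2 * (Y * n) * (32 * κ) ^ k ≤ 2 * (X * D) * (32 * κ) ^ k := by
      calc _ ≤ b₁ * D ^ k * D := key
        _ ≤ 2 * X * (32 * κ) ^ k * D := by gcongr
        _ = _ := by ring
    have := le_of_mul_le_mul_right h6 hP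
    linarith
  · have hX' : (b₁ : ℝ) ^ 2 ≤ 4 ^ k * X := by exact_mod_cast hX
    have hP : (0 : ℝ) < 4 ^ k := by positivity
    have key : 4 ^ k * (Y * n) ≤ (b₁ : ℝ) ^ 2 * D := by
      rcases hb₁ with h | h
      · calc 4 ^ k * (Y * n) = (100 * 4 ^ k * Y * n) / 100 := by ring
          _ ≤ b ^ 2 * D / 100 := by gcongr
          _ = (b / 10) ^ 2 * D := by ring
          _ ≤ _ := by gcongr
      · calc 4 ^ k * (Y * n) ≤ 4 ^ k * (Y * n) * n := le_mul_of_one_le_right (by positivity) hn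
          _ = (n / (32 * κ)) ^ 2 * (1024 * κ ^ 2 * 4 ^ k * Y) := by
              field_simp
              ring
          _ ≤ _ := by gcongr
    refine le_of_mul_le_mul_left (key.trans ?_) hP
    rw [← mul_assoc]
    gcongr

lemma budget_growth {k : ℕ} {n t b D α K : ℝ} (hn : 0 < n) (ht : 0 < t) (hα : 0 ≤ α)
    (hb0 : 0 ≤ b) (hb : K * (n ^ (k + 2) / t ^ (k + 1)) ≤ b) (hD : α * t / n ≤ D) :
    K * α ^ (k + 1) * n ≤ b * D ^ (k + 1) := by
  calc K * α ^ (k + 1) * n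
      = K * (n ^ (k + 2) / t ^ (k + 1)) * (α * t / n) ^ (k + 1) := by
        rw [div_pow, mul_pow]
        field_simp
        ring
    _ ≤ _ := by gcongr

lemma budget_square {n t b D α K : ℝ} (hn : 0 < n) (ht : 0 < t) (hα : 0 ≤ α)
    (hK : 0 ≤ K) (hb : K * (n / √t) ≤ b) (hD : α * t / n ≤ D) :
    K ^ 2 * α * n ≤ b ^ 2 * D := by
  calc K ^ 2 * α * n = (K * (n / √t)) ^ 2 * (α * t / n) := by
        rw [mul_pow, div_pow, Real.sq_sqrt ht.le]
        field_simp
    _ ≤ _ := by gcongr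

/-- The stages may use only a fraction `ε` of all pairs, so that degrees and early exposure stay
under control. Since `t` is at most the number of pairs, this truncation costs only a constant
factor in `t`. -/
lemma exists_rounds {n t κ : ℕ} {ε : ℝ} (hκ : 0 < κ) (hε : 0 < ε) (hε1 : ε ≤ 1)
    (ht : t ≤ n.choose 2) (hκt : κ ≤ t) (hκN : (κ : ℝ) ≤ ε * n.choose 2) :
    ∃ τ : ℕ, κ * τ ≤ t ∧ ((κ * τ : ℕ) : ℝ) ≤ ε * n.choose 2 ∧ ε / (4 * κ) * t ≤ τ := by
  set T := min t ⌊ε * n.choose 2⌋₊ with hT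
  have hκ0 : (0 : ℝ) < κ := by exact_mod_cast hκ
  have hκ1 : (1 : ℝ) ≤ κ := by exact_mod_cast hκ
  have hκT : κ ≤ T := le_min hκt (Nat.le_floor hκN)
  have hfl : (⌊ε * n.choose 2⌋₊ : ℝ) ≤ ε * n.choose 2 := Nat.floor_le (by positivity)
  have hT2 : ε / 2 * t ≤ T := by
    have htN : (t : ℝ) ≤ n.choose 2 := by exact_mod_cast ht
    rw [hT, Nat.cast_min, le_min_iff]
    refine ⟨?_, ?_⟩
    · have : (0 : ℝ) ≤ t := by positivity
      nlinarith
    · have h1 := Nat.lt_floor_add_one (ε * n.choose 2)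
      have h2 : 1 ≤ ⌊ε * n.choose 2⌋₊ := Nat.le_floor (by simpa using hκ1.trans hκN)
      have h3 : (1 : ℝ) ≤ ⌊ε * n.choose 2⌋₊ := by exact_mod_cast h2
      have h4 : ε * t ≤ ε * n.choose 2 := by gcongr
      linarith
  have hmul : κ * (T / κ) ≤ T := Nat.mul_div_le T κ
  refine ⟨T / κ, hmul.trans (min_le_left _ _), ?_, ?_⟩
  · refine le_trans ?_ hfl
    exact_mod_cast hmul.trans (min_le_right _ _)
  · have h5 : T ≤ 2 * (κ * (T / κ)) := by
      have h6 := Nat.div_add_mod T κ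
      have h7 := Nat.mod_lt T hκ
      have h8 : κ * 1 ≤ κ * (T / κ) := Nat.mul_le_mul_left _ ((Nat.one_le_div_iff hκ).2 hκT)
      omega
    have h9 : (T : ℝ) ≤ 2 * (κ * (T / κ : ℕ)) := by exact_mod_cast h5
    rw [div_mul_eq_mul_div, div_le_iff₀ (by positivity)]
    linarith

lemma sqrt_le_of_le_pairs {n t : ℕ} (ht : t ≤ n.choose 2) : √(t : ℝ) ≤ n := by
  rw [Real.sqrt_le_iff]
  refine ⟨by positivity, ?_⟩
  have h1 : (t : ℝ) ≤ n.choose 2 := by exact_mod_cast ht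
  have h2 := pairs_le n
  have h3 : (0 : ℝ) ≤ (n : ℝ) ^ 2 := by positivity
  linarith

set_option maxHeartbeats 1000000 in
/-- Above the thresholds, the parameters of a plan can be chosen so that it fails with
probability at most `η`. -/
theorem exists_planError_le {k : ℕ} {η : ℝ} (hη : 0 < η) :
    ∃ K > 0, ∃ n₀ : ℕ, ∀ n ≥ n₀, ∀ t b : ℕ, t ≤ n.choose 2 →
      K * (n * Real.log n) ≤ t → K * bStar k n t ≤ b →
      ∃ (w τ m r d : ℕ) (q : ℝ), 0 < n.choose 2 ∧ (k + 2) * w ≤ n ∧ (k + 2) * τ ≤ t ∧ 1 ≤ r ∧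
        r ≤ w ∧ 2 ≤ d ∧ 5 * (r * d ^ k) + 1 ≤ b ∧ q ≤ 1 ∧
        q * n.choose 2 + (2 * (r * d ^ k) : ℕ) + m ≤ w ∧
        r * (d : ℝ) ^ (2 * k) / 4 ≤ 2 * n.choose 2 ∧ planError k n w τ m r d q ≤ η := by
  obtain ⟨κ, hκdef⟩ : ∃ κ : ℕ, κ = k + 2 := ⟨_, rfl⟩
  have hκ : 0 < κ := by omega
  have hκ0 : (0 : ℝ) < κ := by exact_mod_cast hκ
  obtain ⟨ε, hε0, hεp, hεη⟩ : ∃ ε : ℝ, 0 < ε ∧ ε ≤ (1 / 4) ^ (4 * κ) ∧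
      16 * (κ : ℝ) ^ 2 * ε ≤ η / 4 := by
    -- The first bound on `ε` serves the maximum degree, the second the closing pairs exposed during
    -- growth.
    refine ⟨min ((1 / 4) ^ (4 * κ)) (η / (64 * κ ^ 2)), by positivity, min_le_left _ _, ?_⟩
    calc _ ≤ 16 * (κ : ℝ) ^ 2 * (η / (64 * κ ^ 2)) := by
          gcongr
          exact min_le_right _ _
      _ = η / 4 := by
          field_simp
          norm_num
  have hε1 : ε ≤ 1 := hεp.trans (pow_le_one₀ (by norm_num) (by norm_num))
  set α : ℝ := ε / (4 * κ) with hα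
  have hα0 : 0 < α := by positivity
  set Y : ℝ := 32 / η with hY
  have hY0 : 0 < Y := by positivity
  -- `K` exceeds every constant needed below: for the integer roundings, for the two budget
  -- thresholds, and for the lower bounds on `D`.
  obtain ⟨K, hK1, hK2, hK3, hK4, hK5, hK6, hK7⟩ : ∃ K : ℝ, 1 ≤ K ∧ 10 * 2 ^ k ≤ K ∧
      20 * Y * (32 * κ) ^ k / α ^ (k + 1) ≤ K ∧ 100 * 4 ^ k * Y / α ≤ K ∧
      32 * κ / α ≤ K ∧ 64 * κ * Y * (32 * κ) ^ k / α ≤ K ∧ 1024 * κ ^ 2 * 4 ^ k * Y / α ≤ K :=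
    ((eventually_ge_atTop _).and <| (eventually_ge_atTop _).and <| (eventually_ge_atTop _).and <|
      (eventually_ge_atTop _).and <| (eventually_ge_atTop _).and <|
      (eventually_ge_atTop _).and (eventually_ge_atTop _)).exists
  rw [div_le_iff₀ (by positivity)] at hK3 hK4 hK5 hK6 hK7
  have hK0 : 0 < K := by linarith
  have hlim : ∀ᶠ n : ℕ in atTop, (n : ℝ) * (1 / 2) ^ n ≤ η / 4 :=
    (tendsto_self_mul_const_pow_of_lt_one (by norm_num) (by norm_num)).eventually_le_const
      (by positivity)
  have hlarge : ∀ x : ℝ, ∀ᶠ n : ℕ in atTop, x ≤ n := fun x =>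
    tendsto_natCast_atTop_atTop.eventually_ge_atTop x
  obtain ⟨n₀, hn₀⟩ := eventually_atTop.1 (hlim.and <| (hlarge (4 * (k + 1) / η)).and <|
    (hlarge (4 * κ / ε)).and <| (eventually_ge_atTop (16 * κ)).and <|
    (eventually_ge_atTop (κ * (8 * 2 ^ k))).and (eventually_ge_atTop 3))
  refine ⟨K, hK0, n₀, fun n hn t b ht htK hbK => ?_⟩
  obtain ⟨hn1, hn2, hn3, hn4, hn5, hn6⟩ := hn₀ n hn
  have hnR : (0 : ℝ) < n := by exact_mod_cast (by omega : 0 < n)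
  have hnR1 : (1 : ℝ) ≤ n := by exact_mod_cast (by omega : 1 ≤ n)
  have hNlow := two_le_pairs n (by omega)
  have hNR : (0 : ℝ) < n.choose 2 := lt_of_lt_of_le (by positivity) hNlow
  have hN : 0 < n.choose 2 := by exact_mod_cast hNR
  have hlog : 1 ≤ Real.log n := by
    rw [Real.le_log_iff_exp_le hnR]
    have h1 := Real.exp_one_lt_d9
    have h2 : (3 : ℝ) ≤ n := by exact_mod_cast hn6
    linarith
  have htn : (n : ℝ) ≤ t := by
    refine le_trans ?_ htK
    have h1 : (n : ℝ) ≤ n * Real.log n := le_mul_of_one_le_right hnR.le hlog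
    exact h1.trans (le_mul_of_one_le_left (by positivity) hK1)
  have htR : (0 : ℝ) < t := by linarith
  have hbK1 : K * ((n : ℝ) ^ (k + 2) / (t : ℝ) ^ (k + 1)) ≤ b :=
    le_trans (by gcongr; exact le_max_left _ _) hbK
  have hbK2 : K * ((n : ℝ) / √t) ≤ b := le_trans (by gcongr; exact le_max_right _ _) hbK
  -- As `√t ≤ n`, the second term of the threshold is at least 1, so `b` is at least `K`; hence the
  -- minimal branching number 2 is affordable.
  have hbig : 10 * 2 ^ k ≤ b := by
    have h1 : (1 : ℝ) ≤ n / √t := by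
      rw [one_le_div (by positivity)]
      exact sqrt_le_of_le_pairs ht
    have h2 : (10 * 2 ^ k : ℝ) ≤ b :=
      hK2.trans ((le_mul_of_one_le_right hK0.le h1).trans hbK2)
    exact_mod_cast h2
  obtain ⟨τ, hτt, hτN, hτα⟩ := exists_rounds hκ hε0 hε1 ht
    (le_trans (by omega : κ ≤ n) (by exact_mod_cast htn)) (by
      rw [div_le_iff₀ hε0] at hn3
      have : (n : ℝ) * n = n ^ 2 := by ring
      calc (κ : ℝ) ≤ n * ε / 4 := by linarith
        _ ≤ n * n * ε / 4 := by
          gcongr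
          exact le_mul_of_one_le_left hnR.le hnR1
        _ = ε * (n ^ 2 / 4) := by ring
        _ ≤ _ := by gcongr)
  rw [← hα] at hτα
  set D : ℝ := (τ : ℝ) / n with hD
  have hDα : α * t / n ≤ D := by
    rw [hD]
    gcongr
  have hDlog : K * α * Real.log n ≤ D := by
    refine le_trans ?_ hDα
    rw [le_div_iff₀ hnR]
    calc K * α * Real.log n * n = α * (K * (n * Real.log n)) := by ring
      _ ≤ α * t := by gcongr
  have hDK : K * α ≤ D := le_trans (le_mul_of_one_le_right (by positivity) hlog) hDlog
  have hD32 : 32 * (κ : ℝ) ≤ D := hK5.trans hDK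
  have hκ1 : (1 : ℝ) ≤ κ := by exact_mod_cast hκ
  have hD1 : 1 ≤ D := by linarith
  set w := n / κ with hw
  set m := w / 4 with hm
  have hw16 : 16 ≤ w := (Nat.le_div_iff_mul_le hκ).2 hn4
  have hw2k : 8 * 2 ^ k ≤ w := (Nat.le_div_iff_mul_le hκ).2 (by rwa [mul_comm])
  have hκw : κ * w ≤ n := Nat.mul_div_le n κ
  have hnw : n < κ * (w + 1) := Nat.lt_mul_div_succ n hκ
  have hwn : w ≤ n := Nat.div_le_self _ _
  have hnw2 : n ≤ 2 * κ * w := by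
    refine hnw.le.trans ?_
    calc κ * (w + 1) ≤ κ * (2 * w) := Nat.mul_le_mul_left _ (by omega)
      _ = _ := by ring
  have hnw2R : (n : ℝ) ≤ 2 * κ * w := by exact_mod_cast hnw2
  have hnm : n ≤ 4 * κ * (m + 1) := by
    refine hnw.le.trans ?_
    calc κ * (w + 1) ≤ κ * (4 * (m + 1)) := Nat.mul_le_mul_left _ (by omega)
      _ = _ := by ring
  -- The largest branching number for which `growth_error_le` works; rounding it down loses at most
  -- a factor 2.
  set x : ℝ := D / (16 * κ) with hx
  have hx2 : 2 ≤ x := by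
    rw [hx, le_div_iff₀ (by positivity)]
    linarith
  set d₀ := ⌊x⌋₊ with hd₀
  have hd₀2 : 2 ≤ d₀ := Nat.le_floor (by exact_mod_cast hx2)
  have hd₀x : (d₀ : ℝ) ≤ x := Nat.floor_le (by linarith)
  have hd₀D : D / (32 * κ) ≤ d₀ := by
    have h1 := Nat.lt_floor_add_one x
    have h2 : D / (32 * κ) = x / 2 := by
      rw [hx]
      field_simp
      norm_num
    rw [h2]
    linarith
  have h2k : 1 ≤ 2 ^ k := Nat.one_le_two_pow
  -- The first cap fits the money budget `5 * (r * d ^ k) + 1 ≤ b`; the second leaves most of each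
  -- block unreached, so that targets remain.
  set b₁ := min ((b - 1) / 5) (w / 8) with hb₁
  have hb₁2 : 2 ^ k ≤ b₁ := le_min (by omega) (by omega)
  have hb₁R : (b : ℝ) / 10 ≤ b₁ ∨ (n : ℝ) / (32 * κ) ≤ b₁ := by
    rcases min_choice ((b - 1) / 5) (w / 8) with h | h
    · left
      rw [hb₁, h, div_le_iff₀ (by norm_num)]
      exact_mod_cast (by omega : b ≤ (b - 1) / 5 * 10)
    · right
      rw [hb₁, h, div_le_iff₀ (by positivity)]
      have h1 : w ≤ w / 8 * 16 := by omega
      have h2 : n ≤ w / 8 * (32 * κ) := by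
        calc n ≤ 2 * κ * w := hnw2
          _ ≤ 2 * κ * (w / 8 * 16) := Nat.mul_le_mul_left _ h1
          _ = _ := by ring
      exact_mod_cast h2
  obtain ⟨r, d, hr, hd, hdd₀, hrd, hbr⟩ := exists_branching k d₀ b₁ hd₀2 hb₁2
  have hrw : r * d ^ k ≤ w / 8 := hrd.trans (min_le_right _ _)
  have hrb : r * d ^ k ≤ (b - 1) / 5 := hrd.trans (min_le_left _ _)
  have hdk : 1 ≤ d ^ k := Nat.one_le_pow _ _ (by omega)
  have hr2 : r ≤ r * d ^ k := Nat.le_mul_of_pos_right r hdk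
  have hXD : Y * n ≤ (r * d ^ (2 * k) : ℕ) * D :=
    branching_large hnR1 hκ0 hY0.le (Nat.cast_nonneg b) hb₁R hd₀D hD1 hbr
      (le_trans (by gcongr) (budget_growth hnR htR hα0.le (Nat.cast_nonneg b) hbK1 hDα))
      (le_trans (by
        rw [pow_two, mul_assoc K K α]
        refine mul_le_mul_of_nonneg_right ?_ hnR.le
        exact hK4.trans (le_mul_of_one_le_left (by positivity) hK1)) (budget_square hnR htR hα0.le hK0.le hbK2 hDα))
      (hK6.trans hDK) (hK7.trans hDK)
  push_cast at hXD
  have hrdR : (r : ℝ) * (d : ℝ) ^ k ≤ w / 8 := by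
    have h1 : r * d ^ k * 8 ≤ w := by omega
    rw [le_div_iff₀ (by norm_num)]
    exact_mod_cast h1
  have hwR : (w : ℝ) ≤ n := by exact_mod_cast hwn
  have hκkR : ((k : ℝ) + 1) ≤ κ := by exact_mod_cast (by omega : k + 1 ≤ κ)
  have hsN : (((k + 1) * τ : ℕ) : ℝ) ≤ ε * n.choose 2 := by
    refine le_trans ?_ hτN
    exact_mod_cast Nat.mul_le_mul_right τ (by omega : k + 1 ≤ κ)
  subst hκdef
  -- With `q = w / (4 * n.choose 2)`, a quarter of the block is kept as targets, a quarter allowed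
  -- for reached vertices and a quarter for pairs already presented.
  refine ⟨w, τ, m, r, d, w / (4 * n.choose 2), hN, hκw, hτt, hr, by omega, hd, by omega, ?_, ?_,
    ?_, ?_⟩
  · rw [div_le_one (by positivity)]
    have : (n : ℝ) ≤ n ^ 2 := le_self_pow₀ hnR1 two_ne_zero
    linarith
  · have h1 : (w : ℝ) / (4 * n.choose 2) * n.choose 2 = w / 4 := by field_simp
    have h2 : ((m : ℕ) : ℝ) ≤ w / 4 := Nat.cast_div_le
    rw [h1]
    push_cast
    linarith
  · have hr1 : (1 : ℝ) ≤ r := by exact_mod_cast hr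
    calc (r : ℝ) * (d : ℝ) ^ (2 * k) / 4 ≤ r * (r * (d : ℝ) ^ (2 * k)) / 4 := by
          gcongr
          exact le_mul_of_one_le_left (by positivity) hr1
      _ = (r * (d : ℝ) ^ k) ^ 2 / 4 := by ring
      _ ≤ ((n : ℝ) / 8) ^ 2 / 4 := by
          gcongr
          exact hrdR.trans (by gcongr)
      _ = n ^ 2 / 256 := by ring
      _ ≤ 2 * n.choose 2 := by linarith [sq_nonneg (n : ℝ)]
  · have hdx : (d : ℝ) ≤ x := le_trans (by exact_mod_cast hdd₀) hd₀x
    have e1 := growth_error_le (k := k) hη hκ (by omega) hnw2R hdx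
      (le_trans (by gcongr) hDlog) hn2
    have e2 := degree_error_le (x := (((k + 1) * τ : ℕ) : ℝ) / n.choose 2) hεp
      (by positivity) (by rwa [div_le_iff₀ hNR]) hnm hn1
    have e3 := exposure_error_le hκ (by omega) hε0.le hεη (by omega) hnw2R hsN
    have e4 := closing_error_le hη (by omega) hXD
    unfold planError
    linarith

/-- Above the thresholds, Builder has a strategy that builds the cycle with probability close
to one. -/
theorem prContains_cycle_large {k ℓ : ℕ} (hk : 1 ≤ k) (hℓ : ℓ = 2 * k + 1 ∨ ℓ = 2 * k + 2)
    {η : ℝ} (hη : 0 < η) :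
    ∃ K > 0, ∃ n₀ : ℕ, ∀ n ≥ n₀, ∀ t b : ℕ, t ≤ n.choose 2 →
      K * (n * Real.log n) ≤ t → K * bStar k n t ≤ b →
      ∃ f : DetStrategy n t b, 1 - η ≤ prContains (SimpleGraph.cycleGraph ℓ) f.rule t := by
  obtain ⟨K, hK, n₀, h⟩ := exists_planError_le (k := k) hη
  refine ⟨K, hK, n₀, fun n hn t b ht h1 h2 => ?_⟩
  obtain ⟨w, τ, m, r, d, q, hN, hw, hτ, hr, hrw, hd, hb, hq1, hq, hf, he⟩ := h n hn t b ht h1 h2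
  rcases hℓ with rfl | rfl
  · obtain ⟨f, hf⟩ := exists_strategy_odd hk ht hN hw hτ hr hrw hd hb hq1 hq hf
    exact ⟨f, le_trans (by linarith) hf⟩
  · obtain ⟨f, hf⟩ := exists_strategy_even hk ht hN hw hτ hr hrw hd hb hq1 hq hf
    exact ⟨f, le_trans (by linarith) hf⟩

end Parameters

end BuilderGame

theorem mainTheorem6 (k : ℕ) (hk : 1 ≤ k) (ℓ : ℕ) (hℓ : ℓ = 2 * k + 1 ∨ ℓ = 2 * k + 2)
    (t b : ℕ → ℕ) (ht : ∀ n, t n ≤ n.choose 2) :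
    (((fun n : ℕ => (n : ℝ) * Real.log n) =o[atTop] fun n => (t n : ℝ)) →
      ((fun n : ℕ => BuilderGame.bStar k n (t n)) =o[atTop] fun n => (b n : ℝ)) →
      ∃ S : ∀ n : ℕ, BuilderGame.Strategy n (t n) (b n),
        Tendsto (fun n => BuilderGame.probContains (SimpleGraph.cycleGraph ℓ) (S n))
          atTop (𝓝 1)) ∧
    ((((fun n => (t n : ℝ)) =o[atTop] fun n : ℕ => (n : ℝ)) ∨
        ((fun n => (b n : ℝ)) =o[atTop] fun n : ℕ => BuilderGame.bStar k n (t n))) →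
      ∀ S : ∀ n : ℕ, BuilderGame.Strategy n (t n) (b n),
        Tendsto (fun n => BuilderGame.probContains (SimpleGraph.cycleGraph ℓ) (S n))
          atTop (𝓝 0)) := by
  refine ⟨fun h1 h2 => BuilderGame.exists_strategy_tendsto_one _
    (fun η hη => BuilderGame.prContains_cycle_large hk hℓ hη) t b ht h1 h2, fun h S => ?_⟩
  -- Both lengths are at least 3 as `k ≥ 1`; the path completed by the closing edge has `L + 2 ≤ 2 *
  -- k + 1` edges, which is all that impossibility uses about `ℓ`.
  obtain ⟨L, rfl, hL⟩ : ∃ L, ℓ = L + 3 ∧ L + 2 ≤ 2 * k + 1 := ⟨ℓ - 3, by omega, by omega⟩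
  exact BuilderGame.strategy_tendsto_zero _
    (fun η hη => BuilderGame.prContains_cycle_small hk hL η hη) t b ht h S
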